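/- Let $\kappa(t)=2/(4-3\cos^2 t)^{3/2}$ be the curvature of the ellipse $(2\cos t,\sin t,0)$, with derivative $\dot\kappa(t)=-18\cos t\,\sin t/(4-3\cos^2 t)^{5/2}$. For real $\varepsilon,\rho,\mu$ let $\mathbf c_\varepsilon(t)=(2\cos t,\sin t,\varepsilon\dot\kappa(t))$, with Frenet frame $(\mathbf t,\mathbf n,\mathbf b)$ and speed $\dot s=|\dot{\mathbf c}_\varepsilon|$, and let $r(t)=\rho+\mu\dot\kappa(t)$. Let $S_{\varepsilon,\rho,\mu}$ be the canal surface $$\alpha(t,\varphi)=\mathbf c_\varepsilon(t)+r\cos\theta\,\mathbf t+r\sin\theta\,(\cos\varphi\,\mathbf n+\sin\varphi\,\mathbf b),\qquad \cos\theta=-\dot r/\dot s,\quad \sin\theta=\sqrt{1-\cos^2\theta},$$ on the torus $(\mathbb R/2\pi\mathbb Z)^2$, with unit normal in the direction of $\alpha_t\wedge\alpha_\varphi$ (pointing inwards). Principal cycles are the closed leaves, in this torus, of the foliation by the lines of curvature of the minimal principal curvature (the lines of the maximal principal curvature are the circles $t=$ const., all closed). A principal cycle is hyperbolic if the derivative of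 its Poincaré return map $h$ at the fixed point is different from $1$. It is double if at the fixed point $h'=1$ and $h''\neq 0$. There are $\rho_0,\mu_0>0$ and functions $\varepsilon_1,\varepsilon_2$, smooth on $]-\mu_0,\mu_0[$, with $\varepsilon_1(\mu)=-\mu+O(\mu^2)$ and $\varepsilon_2(\mu)=\mu+O(\mu^2)$ as $\mu\to0$, such that for all $\rho\in\,]0,\rho_0[$ and $\mu\in\,]0,\mu_0[$ for which the radial function $r$ is everywhere positive the following holds. One has $\varepsilon_1(\mu)<\varepsilon_2(\mu)$, and for every $\varepsilon\in[\varepsilon_1(\mu),\varepsilon_2(\mu)]$ the map $\alpha$ is a smooth immersion without umbilic points. If $\varepsilon\in\,]\varepsilon_1(\mu),\varepsilon_2(\mu)[$, then $S_{\varepsilon,\rho,\mu}$ has exactly two principal cycles, and both are hyperbolic. If $\varepsilon=\varepsilon_1(\mu)$ or $\varepsilon=\varepsilon_2(\mu)$, then $S_{\varepsilon,\rho,\mu}$ has exactly one principal cycle, and it is double. -/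

import Mathlib

open Set Filter Topology Asymptotics
open scoped ContDiff

noncomputable section

namespace Canal

/-- Euclidean three-space. -/
abbrev E3 : Type := EuclideanSpace ℝ (Fin 3)

/-- The wedge (cross) product of `ℝ³`. -/
def cross (a b : E3) : E3 := WithLp.toLp 2 (crossProduct (WithLp.ofLp a) (WithLp.ofLp b))

/-! ### Curves with an arbitrary regular parameter, and canal surfaces -/

/-- The speed `ṡ = |ċ|`. -/
def speed (c : ℝ → E3) (t : ℝ) : ℝ := ‖deriv c t‖

/-- The unit tangent. -/
def frenetT (c : ℝ → E3) (t : ℝ) : E3 := (speed c t)⁻¹ • deriv c t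

/-- The binormal, the unit vector in the direction of `ċ ∧ c̈`. -/
def frenetB (c : ℝ → E3) (t : ℝ) : E3 :=
  ‖cross (deriv c t) (deriv (deriv c) t)‖⁻¹ • cross (deriv c t) (deriv (deriv c) t)

/-- The principal normal; `(T, N, B)` is a positive orthonormal frame. -/
def frenetN (c : ℝ → E3) (t : ℝ) : E3 := cross (frenetB c t) (frenetT c t)

/-- `cos θ = - dr/ds`, where `s` is the arc length of `c`. -/
def canalCos (c : ℝ → E3) (r : ℝ → ℝ) (t : ℝ) : ℝ := -(deriv r t / speed c t)

/-- `sin θ`, for `θ ∈ ]0, π[`. -/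
def canalSin (c : ℝ → E3) (r : ℝ → ℝ) (t : ℝ) : ℝ := Real.sqrt (1 - canalCos c r t ^ 2)

/-- The canal surface with center along `c` and radial function `r`, as a map of `(t, φ)`:
`c + r cos θ T + r sin θ (cos φ N + sin φ B)`, with `cos θ = -dr/ds`. -/
def canalSurface (c : ℝ → E3) (r : ℝ → ℝ) (p : ℝ × ℝ) : E3 :=
  c p.1 + (r p.1 * canalCos c r p.1) • frenetT c p.1
    + (r p.1 * canalSin c r p.1) • (Real.cos p.2 • frenetN c p.1 + Real.sin p.2 • frenetB c p.1)

/-! ### Principal curvature lines of a parametrized surface -/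

/-- A smooth immersion of the parameter plane. -/
def IsSmoothImmersion (α : ℝ × ℝ → E3) : Prop :=
  ContDiff ℝ ∞ α ∧ ∀ p, Function.Injective (fderiv ℝ α p)

/-- The positive unit normal, in the direction of `∂α/∂t ∧ ∂α/∂φ`. -/
def unitNormal (α : ℝ × ℝ → E3) (p : ℝ × ℝ) : E3 :=
  ‖cross (fderiv ℝ α p (1, 0)) (fderiv ℝ α p (0, 1))‖⁻¹ •
    cross (fderiv ℝ α p (1, 0)) (fderiv ℝ α p (0, 1))

/-- `v` is a principal direction at `p` with principal curvature `k`
(equation of Rodrigues: `dN(v) + k dα(v) = 0`). -/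
def IsPrincipalDirection (α : ℝ × ℝ → E3) (p v : ℝ × ℝ) (k : ℝ) : Prop :=
  v ≠ 0 ∧ fderiv ℝ (unitNormal α) p v + k • fderiv ℝ α p v = 0

/-- `k` is a principal curvature at `p`. -/
def IsPrincipalCurvature (α : ℝ × ℝ → E3) (p : ℝ × ℝ) (k : ℝ) : Prop :=
  ∃ v, IsPrincipalDirection α p v k

/-- `p` is umbilic: every direction is principal, with one and the same curvature. -/
def IsUmbilic (α : ℝ × ℝ → E3) (p : ℝ × ℝ) : Prop :=
  ∃ k : ℝ, ∀ v, v ≠ 0 → IsPrincipalDirection α p v k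

/-- `v` is a principal direction at `p` for the minimal principal curvature. -/
def IsMinimalDirection (α : ℝ × ℝ → E3) (p v : ℝ × ℝ) : Prop :=
  ∃ k, IsPrincipalDirection α p v k ∧ ∀ k', IsPrincipalCurvature α p k' → k ≤ k'

/-- The projection of the parameter plane onto the torus `(ℝ / 2πℤ)²`. -/
def toTorus (p : ℝ × ℝ) : Real.Angle × Real.Angle := ((p.1 : Real.Angle), (p.2 : Real.Angle))

/-- The deck translation by `(2πm, 2πn)`. -/
def deck (m n : ℤ) : ℝ × ℝ := (2 * Real.pi * m, 2 * Real.pi * n)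

/-- `C` is a principal cycle (periodic principal line on the torus) of the minimal principal
foliation of the surface `α`, where `α` is `2π`-periodic in both variables. -/
def IsPrincipalCycle (α : ℝ × ℝ → E3) (C : Set (Real.Angle × Real.Angle)) : Prop :=
  ∃ (γ : ℝ → ℝ × ℝ) (T : ℝ) (m n : ℤ), 0 < T ∧ ContDiff ℝ ∞ γ ∧
    (∀ u, IsMinimalDirection α (γ u) (deriv γ u)) ∧
    (∀ u, γ (u + T) = γ u + deck m n) ∧
    C = range (fun u => toTorus (γ u))

/-- `h` is a (germ at `0` of a) Poincaré return map of the minimal principal foliation along the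
closed principal line `C`. The family `H x`, `|x| < δ`, is a smooth family of principal lines
`u ↦ H (x, u)`, `0 ≤ u ≤ T`, which for `x = 0` runs along `C` and closes up; the arc
`x ↦ H (x, 0)` is transversal to `C`, and the line that leaves this arc at the parameter `x`
returns to it, on the torus, at the parameter `h x`. -/
def IsReturnMap (α : ℝ × ℝ → E3) (C : Set (Real.Angle × Real.Angle)) (h : ℝ → ℝ) : Prop :=
  h 0 = 0 ∧ ContDiffAt ℝ ∞ h 0 ∧
  ∃ (H : ℝ × ℝ → ℝ × ℝ) (δ T : ℝ) (m n : ℤ), 0 < δ ∧ 0 < T ∧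
    ContDiffOn ℝ ∞ H (Ioo (-δ) δ ×ˢ univ) ∧
    (∀ x ∈ Ioo (-δ) δ, ∀ u ∈ Icc 0 T,
      IsMinimalDirection α (H (x, u)) (deriv (fun w => H (x, w)) u)) ∧
    C = (fun u => toTorus (H (0, u))) '' Icc 0 T ∧
    LinearIndependent ℝ ![deriv (fun x => H (x, 0)) 0, deriv (fun u => H (0, u)) 0] ∧
    ∀ᶠ x in 𝓝 (0 : ℝ), H (x, T) = H (h x, 0) + deck m n

/-- A hyperbolic (simple) principal cycle: the return map has derivative different from `1`. -/
def IsHyperbolicPrincipalCycle (α : ℝ × ℝ → E3) (C : Set (Real.Angle × Real.Angle)) : Prop :=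
  IsPrincipalCycle α C ∧ ∃ h, IsReturnMap α C h ∧ deriv h 0 ≠ 1

/-- A double (semi-stable) principal cycle: the fixed point of the return map is of
multiplicity two, that is `h' = 1` and `h'' ≠ 0` there. -/
def IsDoublePrincipalCycle (α : ℝ × ℝ → E3) (C : Set (Real.Angle × Real.Angle)) : Prop :=
  IsPrincipalCycle α C ∧ ∃ h, IsReturnMap α C h ∧ deriv h 0 = 1 ∧ deriv (deriv h) 0 ≠ 0

/-! ### The three parameter family -/

/-- The curvature `κ` of the ellipse `(2 cos t, sin t, 0)`. -/
def ellipseCurvature (t : ℝ) : ℝ := 2 / (4 - 3 * Real.cos t ^ 2) ^ (3 / 2 : ℝ)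

/-- The derivative `κ̇` of `κ`. -/
def ellipseCurvatureDot (t : ℝ) : ℝ :=
  -18 * Real.cos t * Real.sin t / (4 - 3 * Real.cos t ^ 2) ^ (5 / 2 : ℝ)

theorem hasDerivAt_ellipseCurvature (t : ℝ) :
    HasDerivAt ellipseCurvature (ellipseCurvatureDot t) t := by
  have hq : 0 < 4 - 3 * Real.cos t ^ 2 := by nlinarith [Real.cos_sq_le_one t]
  have h1 : HasDerivAt (fun t => 4 - 3 * Real.cos t ^ 2) (6 * Real.cos t * Real.sin t) t := by
    refine ((((Real.hasDerivAt_cos t).pow 2).const_mul 3).const_sub 4).congr_deriv ?_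
    norm_num
    ring
  have h2 := (h1.rpow_const (p := -(3 / 2 : ℝ)) (Or.inl hq.ne')).const_mul 2
  have h3 : ellipseCurvature =ᶠ[𝓝 t] fun t => 2 * (4 - 3 * Real.cos t ^ 2) ^ (-(3 / 2 : ℝ)) := by
    refine Eventually.of_forall fun x => ?_
    have hx : 0 < 4 - 3 * Real.cos x ^ 2 := by nlinarith [Real.cos_sq_le_one x]
    simp only [ellipseCurvature, Real.rpow_neg hx.le, div_eq_mul_inv]
  refine (h2.congr_of_eventuallyEq h3).congr_deriv ?_
  have h4 : (-(3 / 2 : ℝ) - 1) = -(5 / 2) := by norm_num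
  rw [ellipseCurvatureDot, h4, Real.rpow_neg hq.le, div_eq_mul_inv]
  ring

/-- The curve `c_ε(t) = (2 cos t, sin t, ε κ̇(t))`. -/
def centerCurve (ε : ℝ) (t : ℝ) : E3 :=
  !₂[2 * Real.cos t, Real.sin t, ε * ellipseCurvatureDot t]

/-- The radial function `r(t, μ) = ρ + μ κ̇(t)`. -/
def radius (ρ μ : ℝ) (t : ℝ) : ℝ := ρ + μ * ellipseCurvatureDot t

/-- The canal surface `S_{ε,ρ,μ}`. -/
def surface (ε ρ μ : ℝ) : ℝ × ℝ → E3 := canalSurface (centerCurve ε) (radius ρ μ)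

end Canal

end

/-!
Along a minimal principal line of a canal surface the angle obeys `φ' = A + B sin φ`, where `-A` is
`ṡ` times the torsion of the center curve and `B` is `ṡ` times its curvature times `cot θ`.
Solutions of this equation are twice the arguments of solutions of a linear system in the plane, so
the return map is a Möbius map of the circle, given by a matrix of determinant one. Hence there are
exactly two closed lines, both hyperbolic, when the monodromy has trace greater than `2`, and
exactly one, which is double, when it is unipotent and nontrivial.

For the family of the theorem and `ε = η μ`, both coefficients are `μ` times smooth functions of
`(μ, η, t)`, so the monodromy is `1 + μ Q (μ, η)` with `Q` smooth. Being of determinant one, it has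
trace `2 - μ² det Q`. At `μ = 0` the matrix `Q` is the average of the linear system, and its
determinant is a multiple of `η² - 1`, because the averages of the two coefficients are `η m` and
`m` for the same `m = ∫ κ̇² > 0`: this follows from the identity `σ̈ + σ = 2κ` for the speed `σ` of
the ellipse. The implicit function theorem continues the zeros `η = ∓1` to smooth curves.
-/

universe u

namespace Canal

theorem eq_of_hasDerivAt_eq {f g f' : ℝ → ℝ} (hf : ∀ t, HasDerivAt f (f' t) t)
    (hg : ∀ t, HasDerivAt g (f' t) t) (a : ℝ) (h : f a = g a) : f = g :=
  eq_of_fderiv_eq (fun t => (hf t).differentiableAt) (fun t => (hg t).differentiableAt)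
    (fun t => (hf t).hasFDerivAt.fderiv.trans (hg t).hasFDerivAt.fderiv.symm) a h

theorem eq_zero_of_hasDerivAt_mul_self {w g : ℝ → ℝ} (hg : Continuous g)
    (hw : ∀ u, HasDerivAt w (g u * w u) u) {a : ℝ} (ha : w a = 0) (u : ℝ) : w u = 0 := by
  have hconst : ∀ u, HasDerivAt (fun u => w u * Real.exp (-∫ s in a..u, g s)) 0 u := fun u =>
    ((hw u).mul (hg.integral_hasStrictDerivAt a u).hasDerivAt.neg.exp).congr_deriv (by ring)
  have hzero := congrFun (eq_of_hasDerivAt_eq hconst (fun t => hasDerivAt_const t (0 : ℝ)) a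
    (by simp [ha])) u
  simpa [Real.exp_ne_zero] using hzero

theorem mul_eq_mul_of_hasDerivAt_mul_self {X Y g : ℝ → ℝ} (hg : Continuous g)
    (hX : ∀ u, HasDerivAt X (g u * X u) u) (hY : ∀ u, HasDerivAt Y (g u * Y u) u) (a u : ℝ) :
    X u * Y a = X a * Y u :=
  sub_eq_zero.1 <| eq_zero_of_hasDerivAt_mul_self hg (w := fun u => X u * Y a - X a * Y u) (a := a)
    (fun u => (((hX u).mul_const (Y a)).sub ((hY u).const_mul (X a))).congr_deriv (by ring))
    (sub_self _) u

theorem contDiff_infty_of_hasDerivAt {f f' : ℝ → ℝ} (hf : ∀ t, HasDerivAt f (f' t) t)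
    (hf' : ∀ n : ℕ, ContDiff ℝ n f → ContDiff ℝ n f') : ContDiff ℝ ∞ f := by
  have hdiff : Differentiable ℝ f := fun t => (hf t).differentiableAt
  refine contDiff_infty.2 fun n => ?_
  induction n with
  | zero => exact contDiff_zero.2 hdiff.continuous
  | succ n ih =>
    push_cast
    refine contDiff_succ_iff_deriv.2 ⟨hdiff, by simp, ?_⟩
    rw [show deriv f = f' from funext fun t => (hf t).deriv]
    exact hf' n ih

theorem contDiff_primitive {f : ℝ → ℝ} (hf : ContDiff ℝ ∞ f) (a : ℝ) :
    ContDiff ℝ ∞ fun t => ∫ s in a..t, f s :=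
  contDiff_infty_of_hasDerivAt (fun t => (hf.continuous.integral_hasStrictDerivAt a t).hasDerivAt)
    fun _ _ => hf.of_le (by exact_mod_cast le_top)

theorem add_int_mul_period {f : ℝ → ℝ} {c p : ℝ} (h : ∀ t, f (t + p) = f t + c) (m : ℤ) (t : ℝ) :
    f (t + p * m) = f t + c * m := by
  have := AddConstMapClass.map_add_zsmul (⟨f, h⟩ : AddConstMap ℝ ℝ p c) t m
  simpa [mul_comm] using this

theorem surjective_of_add_period {f : ℝ → ℝ} (hf : Continuous f) {c p : ℝ} (hc : c ≠ 0)
    (h : ∀ t, f (t + p) = f t + c) : Function.Surjective f := by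
  intro y
  have hvalue (i : ℤ) : f 0 + c * i ∈ range f := ⟨0 + p * i, add_int_mul_period h i 0⟩
  have hfloor : (y - f 0) / c ∈ Icc (⌊(y - f 0) / c⌋ : ℝ) (⌊(y - f 0) / c⌋ + 1 : ℤ) :=
    ⟨Int.floor_le _, by push_cast; exact (Int.lt_floor_add_one _).le⟩
  refine (isPreconnected_range hf).ordConnected.uIcc_subset (hvalue ⌊(y - f 0) / c⌋)
    (hvalue (⌊(y - f 0) / c⌋ + 1)) ?_
  have hy : c * ((y - f 0) / c) = y - f 0 := mul_div_cancel₀ _ hc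
  rw [mem_uIcc]
  rcases hc.lt_or_gt with hc | hc
  · have h₁ := mul_le_mul_of_nonpos_left hfloor.1 hc.le
    have h₂ := mul_le_mul_of_nonpos_left hfloor.2 hc.le
    exact .inr ⟨by linarith, by linarith⟩
  · have h₁ := mul_le_mul_of_nonneg_left hfloor.1 hc.le
    have h₂ := mul_le_mul_of_nonneg_left hfloor.2 hc.le
    exact .inl ⟨by linarith, by linarith⟩

theorem cos_two_mul_arctan (v : ℝ) : Real.cos (2 * Real.arctan v) = (1 - v ^ 2) / (1 + v ^ 2) := by
  rw [Real.cos_two_mul, Real.cos_sq_arctan]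
  field_simp
  ring

theorem sin_two_mul_arctan (v : ℝ) : Real.sin (2 * Real.arctan v) = 2 * v / (1 + v ^ 2) := by
  have hsin : Real.sin (Real.arctan v) = v * Real.cos (Real.arctan v) := by
    rw [← Real.tan_mul_cos (Real.cos_arctan_pos v).ne', Real.tan_arctan]
  rw [Real.sin_two_mul, hsin]
  linear_combination 2 * v * Real.cos_sq_arctan v

/-! ### The equation `φ' = A + B sin φ` -/

/-- A smooth solution of `φ' = A + B sin φ`, the equation of the principal lines of a canal
surface. -/
structure IsSolution (A B φ : ℝ → ℝ) : Prop where
  smooth : ContDiff ℝ ∞ φ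
  hasDerivAt : ∀ t, HasDerivAt φ (A t + B t * Real.sin (φ t)) t

/-- A solution that closes up on the torus after one turn in `t`. -/
structure IsClosedSolution (A B φ : ℝ → ℝ) : Prop extends IsSolution A B φ where
  periodic : ∃ k : ℤ, ∀ t, φ (t + 2 * Real.pi) = φ t + 2 * Real.pi * k

/-- The logarithm of the derivative of the flow along `φ` with respect to the initial angle. -/
noncomputable def logMultiplier (B φ : ℝ → ℝ) (t : ℝ) : ℝ :=
  ∫ s in (0 : ℝ)..t, B s * Real.cos (φ s)

/-- The translation part of the flow: relative to the solution `φ`, the flow from `0` to `t` sends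
the cotangent `c` of half the angle to `exp (-logMultiplier B φ t) * (c + shift B φ t)`. -/
noncomputable def shift (B φ : ℝ → ℝ) (t : ℝ) : ℝ :=
  ∫ s in (0 : ℝ)..t, Real.exp (logMultiplier B φ s) * (B s * Real.sin (φ s))

/-- A closed solution at which the derivative of the return map is different from `1`. -/
structure IsHyperbolicSolution (A B φ : ℝ → ℝ) : Prop extends IsClosedSolution A B φ where
  logMultiplier_ne_zero : logMultiplier B φ (2 * Real.pi) ≠ 0

/-- A closed solution at which the return map is tangent to the identity to first order only. -/
structure IsDoubleSolution (A B φ : ℝ → ℝ) : Prop extends IsClosedSolution A B φ where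
  logMultiplier_eq_zero : logMultiplier B φ (2 * Real.pi) = 0
  shift_ne_zero : shift B φ (2 * Real.pi) ≠ 0

section Solution

variable {A B φ : ℝ → ℝ}

theorem logMultiplier_zero : logMultiplier B φ 0 = 0 := intervalIntegral.integral_same

theorem shift_zero : shift B φ 0 = 0 := intervalIntegral.integral_same

namespace IsSolution

theorem contDiff_logMultiplier (h : IsSolution A B φ) (hB : ContDiff ℝ ∞ B) :
    ContDiff ℝ ∞ (logMultiplier B φ) :=
  contDiff_primitive (hB.mul (Real.contDiff_cos.comp h.smooth)) 0

theorem hasDerivAt_logMultiplier (h : IsSolution A B φ) (hB : Continuous B) (t : ℝ) :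
    HasDerivAt (logMultiplier B φ) (B t * Real.cos (φ t)) t :=
  ((hB.mul (Real.continuous_cos.comp h.smooth.continuous)).integral_hasStrictDerivAt 0 t).hasDerivAt

theorem contDiff_shift (h : IsSolution A B φ) (hB : ContDiff ℝ ∞ B) : ContDiff ℝ ∞ (shift B φ) :=
  contDiff_primitive
    ((h.contDiff_logMultiplier hB).exp.mul (hB.mul (Real.contDiff_sin.comp h.smooth))) 0

theorem hasDerivAt_shift (h : IsSolution A B φ) (hB : Continuous B) (t : ℝ) :
    HasDerivAt (shift B φ) (Real.exp (logMultiplier B φ t) * (B t * Real.sin (φ t))) t := by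
  have hI : Continuous (logMultiplier B φ) :=
    continuous_iff_continuousAt.2 fun t => (h.hasDerivAt_logMultiplier hB t).continuousAt
  have hφ := h.smooth.continuous
  exact (Continuous.integral_hasStrictDerivAt (by fun_prop) 0 t).hasDerivAt

end IsSolution

namespace IsClosedSolution

theorem sin_periodic (h : IsClosedSolution A B φ) :
    Function.Periodic (fun t => Real.sin (φ t)) (2 * Real.pi) := fun t => by
  obtain ⟨k, hk⟩ := h.periodic
  simp only [hk, mul_comm _ (k : ℝ), Real.sin_add_int_mul_two_pi]

theorem cos_periodic (h : IsClosedSolution A B φ) :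
    Function.Periodic (fun t => Real.cos (φ t)) (2 * Real.pi) := fun t => by
  obtain ⟨k, hk⟩ := h.periodic
  simp only [hk, mul_comm _ (k : ℝ), Real.cos_add_int_mul_two_pi]

theorem logMultiplier_add (h : IsClosedSolution A B φ) (hB : Continuous B)
    (hBp : Function.Periodic B (2 * Real.pi)) (t : ℝ) :
    logMultiplier B φ (t + 2 * Real.pi)
      = logMultiplier B φ t + logMultiplier B φ (2 * Real.pi) := by
  have hcont := hB.mul (Real.continuous_cos.comp h.smooth.continuous)
  simpa [logMultiplier] using (hBp.mul h.cos_periodic).intervalIntegral_add_eq_add 0 t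
    fun _ _ => hcont.intervalIntegrable _ _

theorem shift_add (h : IsClosedSolution A B φ) (hB : Continuous B)
    (hBp : Function.Periodic B (2 * Real.pi)) (t : ℝ) :
    shift B φ (t + 2 * Real.pi)
      = shift B φ (2 * Real.pi) + Real.exp (logMultiplier B φ (2 * Real.pi)) * shift B φ t := by
  refine congrFun (eq_of_hasDerivAt_eq
    (fun t => (h.hasDerivAt_shift hB (t + 2 * Real.pi)).comp_add_const t _)
    (fun t => (((h.hasDerivAt_shift hB t).const_mul _).const_add _).congr_deriv ?_) 0
    (by simp [shift_zero])) t
  have hsin : Real.sin (φ (t + 2 * Real.pi)) = Real.sin (φ t) := h.sin_periodic t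
  rw [hBp, hsin, h.logMultiplier_add hB hBp, Real.exp_add]
  ring

end IsClosedSolution

/-! ### All solutions in terms of a given one -/

/-- The cotangent of half the angle from `φ` to the solution with affine parameter `c`. -/
noncomputable def relativeCot (B φ : ℝ → ℝ) (c t : ℝ) : ℝ :=
  Real.exp (-logMultiplier B φ t) * (c + shift B φ t)

/-- The solution whose affine parameter relative to `φ` is `c`; these are all the solutions apart
from `φ`, up to multiples of `2π`. -/
noncomputable def affineSolution (B φ : ℝ → ℝ) (c t : ℝ) : ℝ :=
  φ t + Real.pi - 2 * Real.arctan (relativeCot B φ c t)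

/-- The holonomy of one turn along the closed solution `φ`, in the affine parameter. -/
noncomputable def holonomy (B φ : ℝ → ℝ) (c : ℝ) : ℝ := relativeCot B φ c (2 * Real.pi)

theorem sin_affineSolution (c t : ℝ) : Real.sin (affineSolution B φ c t) =
    -(Real.sin (φ t) * (1 - relativeCot B φ c t ^ 2) - 2 * Real.cos (φ t) * relativeCot B φ c t) /
      (1 + relativeCot B φ c t ^ 2) := by
  rw [affineSolution, add_sub_right_comm, Real.sin_add_pi, Real.sin_sub, cos_two_mul_arctan,
    sin_two_mul_arctan]
  ring

theorem cos_affineSolution (c t : ℝ) : Real.cos (affineSolution B φ c t) =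
    -(Real.cos (φ t) * (1 - relativeCot B φ c t ^ 2) + 2 * Real.sin (φ t) * relativeCot B φ c t) /
      (1 + relativeCot B φ c t ^ 2) := by
  rw [affineSolution, add_sub_right_comm, Real.cos_add_pi, Real.cos_sub, cos_two_mul_arctan,
    sin_two_mul_arctan]
  ring

theorem strictMono_relativeCot (t : ℝ) : StrictMono fun c => relativeCot B φ c t := fun _ _ hab =>
  mul_lt_mul_of_pos_left (add_lt_add_left hab _) (Real.exp_pos _)

theorem IsSolution.contDiff_relativeCot (h : IsSolution A B φ) (hB : ContDiff ℝ ∞ B) (c : ℝ) :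
    ContDiff ℝ ∞ (relativeCot B φ c) :=
  (h.contDiff_logMultiplier hB).neg.exp.mul (contDiff_const.add (h.contDiff_shift hB))

theorem IsSolution.hasDerivAt_relativeCot (h : IsSolution A B φ) (hB : Continuous B) (c t : ℝ) :
    HasDerivAt (relativeCot B φ c)
      (B t * (Real.sin (φ t) - Real.cos (φ t) * relativeCot B φ c t)) t := by
  refine ((h.hasDerivAt_logMultiplier hB t).neg.exp.mul
    ((h.hasDerivAt_shift hB t).const_add c)).congr_deriv ?_
  have hexp : Real.exp (-logMultiplier B φ t) * Real.exp (logMultiplier B φ t) = 1 := by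
    rw [← Real.exp_add, neg_add_cancel, Real.exp_zero]
  simp only [relativeCot, Pi.neg_apply]
  linear_combination (B t * Real.sin (φ t)) * hexp

theorem IsSolution.affine (h : IsSolution A B φ) (hB : ContDiff ℝ ∞ B) (c : ℝ) :
    IsSolution A B (affineSolution B φ c) where
  smooth := (h.smooth.add contDiff_const).sub
    (contDiff_const.mul (Real.contDiff_arctan.comp (h.contDiff_relativeCot hB c)))
  hasDerivAt t := by
    refine (((h.hasDerivAt t).add_const _).sub
      ((h.hasDerivAt_relativeCot hB.continuous c t).arctan.const_mul 2)).congr_deriv ?_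
    rw [sin_affineSolution]
    field_simp
    ring

namespace IsClosedSolution

theorem relativeCot_add (h : IsClosedSolution A B φ) (hB : Continuous B)
    (hBp : Function.Periodic B (2 * Real.pi)) (c t : ℝ) :
    relativeCot B φ c (t + 2 * Real.pi) = relativeCot B φ (holonomy B φ c) t := by
  have hexp := Real.exp_ne_zero (logMultiplier B φ (2 * Real.pi))
  simp only [relativeCot, holonomy, h.logMultiplier_add hB hBp, h.shift_add hB hBp, neg_add,
    Real.exp_add, Real.exp_neg (logMultiplier B φ (2 * Real.pi))]
  field_simp
  ring

theorem relativeCot_add_nat_mul (h : IsClosedSolution A B φ) (hB : Continuous B)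
    (hBp : Function.Periodic B (2 * Real.pi)) (n : ℕ) (c t : ℝ) :
    relativeCot B φ c (t + 2 * Real.pi * n) = relativeCot B φ ((holonomy B φ)^[n] c) t := by
  induction n generalizing c with
  | zero => simp
  | succ n ih =>
    rw [Function.iterate_succ_apply, ← ih, ← h.relativeCot_add hB hBp]
    push_cast
    ring_nf

theorem holonomy_eq_self_of_relativeCot_eq (h : IsClosedSolution A B φ) (hB : Continuous B)
    (hBp : Function.Periodic B (2 * Real.pi)) {m : ℤ} (hm : m ≠ 0) {c t : ℝ}
    (hc : relativeCot B φ c (t + 2 * Real.pi * m) = relativeCot B φ c t) :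
    holonomy B φ c = c := by
  have hiterate : (holonomy B φ)^[m.natAbs] c = id^[m.natAbs] c := by
    rw [Function.iterate_id, id]
    rcases m.natAbs_eq with hm' | hm' <;> rw [hm'] at hc <;>
      simp only [Int.cast_neg, Int.cast_natCast] at hc
    · exact (strictMono_relativeCot t).injective
        ((h.relativeCot_add_nat_mul hB hBp _ _ _).symm.trans hc)
    · have hback := h.relativeCot_add_nat_mul hB hBp m.natAbs c (t + 2 * Real.pi * -m.natAbs)
      rw [mul_neg, neg_add_cancel_right] at hback
      rw [mul_neg] at hc
      exact (strictMono_relativeCot _).injective (hback.symm.trans hc.symm)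
  exact ((Function.Commute.id_right (f := holonomy B φ)).iterate_pos_eq_iff_map_eq
    (strictMono_relativeCot _).monotone strictMono_id (Int.natAbs_pos.2 hm)).1 hiterate

theorem affine (h : IsClosedSolution A B φ) (hB : ContDiff ℝ ∞ B)
    (hBp : Function.Periodic B (2 * Real.pi)) {c : ℝ} (hc : holonomy B φ c = c) :
    IsClosedSolution A B (affineSolution B φ c) where
  toIsSolution := h.toIsSolution.affine hB c
  periodic := by
    obtain ⟨k, hk⟩ := h.periodic
    refine ⟨k, fun t => ?_⟩
    rw [affineSolution, hk, h.relativeCot_add hB.continuous hBp, hc, affineSolution]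
    ring

theorem logMultiplier_affineSolution (h : IsClosedSolution A B φ) (hB : ContDiff ℝ ∞ B)
    (hBp : Function.Periodic B (2 * Real.pi)) {c : ℝ} (hc : holonomy B φ c = c) :
    logMultiplier B (affineSolution B φ c) (2 * Real.pi)
      = -logMultiplier B φ (2 * Real.pi) := by
  let f (t : ℝ) : ℝ := -logMultiplier B φ t - Real.log (1 + relativeCot B φ c t ^ 2)
    + Real.log (1 + relativeCot B φ c 0 ^ 2)
  have hf (t : ℝ) : HasDerivAt f (B t * Real.cos (affineSolution B φ c t)) t := by
    refine (((h.hasDerivAt_logMultiplier hB.continuous t).neg.sub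
      ((((h.hasDerivAt_relativeCot hB.continuous c t).pow 2).const_add 1).log
        (add_pos_of_pos_of_nonneg one_pos (sq_nonneg _)).ne')).add_const _).congr_deriv ?_
    rw [cos_affineSolution]
    simp only [Pi.pow_apply]
    field_simp
    ring
  rw [eq_of_hasDerivAt_eq
    ((h.toIsSolution.affine hB c).hasDerivAt_logMultiplier hB.continuous) hf 0
    (by simp [f, logMultiplier_zero])]
  have hperiodic := h.relativeCot_add hB.continuous hBp c 0
  rw [hc, zero_add] at hperiodic
  simp [f, hperiodic]

end IsClosedSolution

theorem holonomy_eq_self_iff (hI : logMultiplier B φ (2 * Real.pi) ≠ 0) (c : ℝ) :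
    holonomy B φ c = c ↔
      c = shift B φ (2 * Real.pi) / (Real.exp (logMultiplier B φ (2 * Real.pi)) - 1) := by
  have hne : Real.exp (logMultiplier B φ (2 * Real.pi)) - 1 ≠ 0 :=
    sub_ne_zero.2 fun hexp => hI (Real.exp_eq_one_iff _ |>.1 hexp)
  rw [holonomy, relativeCot, Real.exp_neg, inv_mul_eq_iff_eq_mul₀ (Real.exp_ne_zero _),
    eq_div_iff hne]
  constructor <;> intro h <;> linear_combination -h

theorem holonomy_ne_self (hI : logMultiplier B φ (2 * Real.pi) = 0)
    (hJ : shift B φ (2 * Real.pi) ≠ 0) (c : ℝ) : holonomy B φ c ≠ c := by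
  simpa [holonomy, relativeCot, hI] using hJ

end Solution

/-! ### Principal cycles -/

/-- The leaf of a closed solution on the torus. -/
def leaf (φ : ℝ → ℝ) : Set (Real.Angle × Real.Angle) := range fun t => toTorus (t, φ t)

/-- The minimal principal foliation of `α` is the foliation of `φ' = A + B sin φ`. -/
def HasMinimalFoliation (α : ℝ × ℝ → E3) (A B : ℝ → ℝ) : Prop :=
  ∀ p v, IsMinimalDirection α p v ↔ v.1 ≠ 0 ∧ v.2 = (A p.1 + B p.1 * Real.sin p.2) * v.1

/-- `u ↦ (x u, y u)`, with `x' = dx/du`, runs along the foliation of `φ' = A + B sin φ`, in an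
arbitrary parametrization. -/
structure IsLeafPath (A B x y x' : ℝ → ℝ) : Prop where
  continuous_deriv : Continuous x'
  hasDerivAt_fst : ∀ u, HasDerivAt x (x' u) u
  hasDerivAt_snd : ∀ u, HasDerivAt y ((A (x u) + B (x u) * Real.sin (y u)) * x' u) u

/-- Half the angle from the solution `φ` to the path `(x, y)`. -/
noncomputable def halfAngle (φ x y : ℝ → ℝ) (u : ℝ) : ℝ := (y u - φ (x u)) / 2

section Cycle

variable {α : ℝ × ℝ → E3} {A B φ : ℝ → ℝ}

theorem toTorus_eq_iff_sin_half_eq_zero {x y z : ℝ} :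
    toTorus (x, y) = toTorus (x, z) ↔ Real.sin ((y - z) / 2) = 0 := by
  simp only [toTorus, Prod.mk.injEq, true_and, Real.Angle.angle_eq_iff_two_pi_dvd_sub,
    Real.sin_eq_zero_iff]
  exact exists_congr fun n => ⟨fun h => by linarith, fun h => by linarith⟩

theorem toTorus_add_deck (p : ℝ × ℝ) (m n : ℤ) : toTorus (p + deck m n) = toTorus p := by
  simp only [toTorus, deck, Prod.fst_add, Prod.snd_add, Prod.mk.injEq]
  exact ⟨Real.Angle.angle_eq_iff_two_pi_dvd_sub.2 ⟨m, by ring⟩,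
    Real.Angle.angle_eq_iff_two_pi_dvd_sub.2 ⟨n, by ring⟩⟩

theorem range_toTorus_eq_leaf {x y : ℝ → ℝ} (hx : Function.Surjective x)
    (h : ∀ u, Real.sin (halfAngle φ x y u) = 0) :
    (range fun u => toTorus (x u, y u)) = leaf φ := by
  have hcomp : (fun u => toTorus (x u, y u)) = (fun t => toTorus (t, φ t)) ∘ x :=
    funext fun u => toTorus_eq_iff_sin_half_eq_zero.2 (h u)
  rw [hcomp, hx.range_comp, leaf]

theorem IsClosedSolution.isPrincipalCycle (h : IsClosedSolution A B φ)
    (hα : HasMinimalFoliation α A B) : IsPrincipalCycle α (leaf φ) := by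
  obtain ⟨k, hk⟩ := h.periodic
  refine ⟨fun t => (t, φ t), 2 * Real.pi, 1, k, Real.two_pi_pos, contDiff_id.prodMk h.smooth,
    fun u => ?_, fun u => by simp [deck, hk], rfl⟩
  rw [((hasDerivAt_id' u).prodMk (h.hasDerivAt u)).deriv, hα]
  simp

theorem IsPrincipalCycle.exists_isLeafPath {C} (hC : IsPrincipalCycle α C)
    (hα : HasMinimalFoliation α A B) : ∃ (x y x' : ℝ → ℝ) (T : ℝ) (m n : ℤ),
      IsLeafPath A B x y x' ∧ (∀ u, x (u + T) = x u + 2 * Real.pi * m) ∧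
      (∀ u, y (u + T) = y u + 2 * Real.pi * n) ∧ m ≠ 0 ∧
      C = range fun u => toTorus (x u, y u) := by
  obtain ⟨γ, T, m, n, hT, hγ, hmin, hper, rfl⟩ := hC
  have hderiv (u : ℝ) : HasDerivAt γ (deriv γ u) u :=
    (hγ.differentiable (by simp)).differentiableAt.hasDerivAt
  have hx (u : ℝ) : HasDerivAt (fun u => (γ u).1) (deriv γ u).1 u :=
    (ContinuousLinearMap.fst ℝ ℝ ℝ).hasFDerivAt.comp_hasDerivAt u (hderiv u)
  have hy (u : ℝ) : HasDerivAt (fun u => (γ u).2) (deriv γ u).2 u :=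
    (ContinuousLinearMap.snd ℝ ℝ ℝ).hasFDerivAt.comp_hasDerivAt u (hderiv u)
  have hxper (u : ℝ) : (γ (u + T)).1 = (γ u).1 + 2 * Real.pi * m := by rw [hper]; rfl
  refine ⟨fun u => (γ u).1, fun u => (γ u).2, fun u => (deriv γ u).1, T, m, n,
    ⟨continuous_fst.comp (hγ.continuous_deriv (by simp)), hx,
      fun u => (hy u).congr_deriv ((hα _ _).1 (hmin u)).2⟩, hxper,
    fun u => by simp only [hper]; rfl, ?_, rfl⟩
  rintro rfl
  obtain ⟨u, -, hu⟩ := exists_hasDerivAt_eq_zero hT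
    (fun u _ => (hx u).continuousAt.continuousWithinAt) (by simpa using (hxper 0).symm)
    fun u _ => hx u
  exact ((hα _ _).1 (hmin u)).1 hu

theorem IsSolution.hasDerivAt_halfAngle (h : IsSolution A B φ) {x y x' : ℝ → ℝ}
    (hxy : IsLeafPath A B x y x') (u : ℝ) :
    HasDerivAt (halfAngle φ x y) (x' u * B (x u) * Real.cos (φ (x u) + halfAngle φ x y u)
      * Real.sin (halfAngle φ x y u)) u := by
  refine (((hxy.hasDerivAt_snd u).sub
    ((h.hasDerivAt (x u)).comp u (hxy.hasDerivAt_fst u))).div_const 2).congr_deriv ?_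
  have hsin := Real.sin_sub_sin (y u) (φ (x u))
  rw [show (y u + φ (x u)) / 2 = φ (x u) + (y u - φ (x u)) / 2 by ring] at hsin
  rw [halfAngle]
  linear_combination (x' u * B (x u) / 2) * hsin

-- With `d` half the angle from `φ` to the path, both `exp I cos d - J sin d` and `sin d` solve
-- `w' = x' B cos d cos (φ + d) w`: their quotient is the affine parameter of the path.
theorem IsSolution.mul_sin_halfAngle_eq (h : IsSolution A B φ) (hB : Continuous B)
    {x y x' : ℝ → ℝ} (hxy : IsLeafPath A B x y x') {d : ℝ → ℝ} (hd : d = halfAngle φ x y)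
    (a u : ℝ) :
    (Real.exp (logMultiplier B φ (x u)) * Real.cos (d u) - shift B φ (x u) * Real.sin (d u))
        * Real.sin (d a) =
      (Real.exp (logMultiplier B φ (x a)) * Real.cos (d a) - shift B φ (x a) * Real.sin (d a))
        * Real.sin (d u) := by
  have hderiv (u : ℝ) :
      HasDerivAt d (x' u * B (x u) * Real.cos (φ (x u) + d u) * Real.sin (d u)) u :=
    hd ▸ h.hasDerivAt_halfAngle hxy u
  have hx := hxy.hasDerivAt_fst
  have hx' := hxy.continuous_deriv
  have hxc : Continuous x := continuous_iff_continuousAt.2 fun u => (hx u).continuousAt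
  have hdc : Continuous d := continuous_iff_continuousAt.2 fun u => (hderiv u).continuousAt
  have hφc := h.smooth.continuous
  refine mul_eq_mul_of_hasDerivAt_mul_self (Y := fun u => Real.sin (d u))
    (X := fun u => Real.exp (logMultiplier B φ (x u)) * Real.cos (d u) -
      shift B φ (x u) * Real.sin (d u))
    (g := fun u => x' u * B (x u) * Real.cos (d u) * Real.cos (φ (x u) + d u))
    (by fun_prop) (fun u => ?_) (fun u => (hderiv u).sin.congr_deriv (by ring)) a u
  refine ((((h.hasDerivAt_logMultiplier hB (x u)).comp u (hx u)).exp.mul (hderiv u).cos).sub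
    (((h.hasDerivAt_shift hB (x u)).comp u (hx u)).mul (hderiv u).sin)).congr_deriv ?_
  simp only [Function.comp_apply]
  rw [Real.cos_add]
  linear_combination (-Real.exp (logMultiplier B φ (x u)) * x' u * B (x u) * (Real.cos (φ (x u)) *
    Real.cos (d u) - Real.sin (φ (x u)) * Real.sin (d u))) * Real.sin_sq_add_cos_sq (d u)

theorem IsSolution.sin_halfAngle_eq_zero_or_exists_relativeCot (h : IsSolution A B φ)
    (hB : Continuous B) {x y x' : ℝ → ℝ} (hxy : IsLeafPath A B x y x') :
    (∀ u, Real.sin (halfAngle φ x y u) = 0) ∨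
      ∃ c, ∀ u, Real.sin (halfAngle φ x y u) ≠ 0 ∧
        Real.cos (halfAngle φ x y u) = relativeCot B φ c (x u) * Real.sin (halfAngle φ x y u) := by
  obtain ⟨d, hd⟩ : ∃ d, d = halfAngle φ x y := ⟨_, rfl⟩
  have hconst := h.mul_sin_halfAngle_eq hB hxy hd
  rw [← hd]
  have hpythagoras (u : ℝ) := Real.sin_sq_add_cos_sq (d u)
  by_cases hsin : Real.sin (d 0) = 0
  · refine .inl fun u => ?_
    have hcos : Real.cos (d 0) ≠ 0 := fun hcos => by simpa [hsin, hcos] using hpythagoras 0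
    simpa [hsin, hcos, Real.exp_ne_zero] using (hconst 0 u).symm
  · obtain ⟨c, hc⟩ : ∃ c, ∀ u, Real.exp (logMultiplier B φ (x u)) * Real.cos (d u)
        = (c + shift B φ (x u)) * Real.sin (d u) := by
      refine ⟨(Real.exp (logMultiplier B φ (x 0)) * Real.cos (d 0)
        - shift B φ (x 0) * Real.sin (d 0)) / Real.sin (d 0), fun u => ?_⟩
      field_simp
      linear_combination hconst 0 u
    refine .inr ⟨c, fun u => ?_⟩
    have hcos : Real.cos (d u) = relativeCot B φ c (x u) * Real.sin (d u) := by
      rw [relativeCot, Real.exp_neg, mul_assoc, ← hc u, inv_mul_cancel_left₀ (Real.exp_ne_zero _)]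
    refine ⟨fun hsin => ?_, hcos⟩
    rw [hsin, mul_zero] at hcos
    simpa [hsin, hcos] using hpythagoras u

theorem sin_halfAngle_affineSolution {x y : ℝ → ℝ} {c u : ℝ}
    (h : Real.cos (halfAngle φ x y u)
      = relativeCot B φ c (x u) * Real.sin (halfAngle φ x y u)) :
    Real.sin (halfAngle (affineSolution B φ c) x y u) = 0 := by
  have hsin : Real.sin (Real.arctan (relativeCot B φ c (x u)))
      = relativeCot B φ c (x u) * Real.cos (Real.arctan (relativeCot B φ c (x u))) := by
    rw [← Real.tan_mul_cos (Real.cos_arctan_pos _).ne', Real.tan_arctan]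
  rw [show halfAngle (affineSolution B φ c) x y u
      = halfAngle φ x y u + Real.arctan (relativeCot B φ c (x u)) - Real.pi / 2 by
        simp only [halfAngle, affineSolution]; ring,
    Real.sin_sub_pi_div_two, Real.cos_add, hsin]
  linear_combination -Real.cos (Real.arctan (relativeCot B φ c (x u))) * h

theorem IsClosedSolution.halfAngle_add (h : IsClosedSolution A B φ) {x y : ℝ → ℝ} {T : ℝ} {m n : ℤ}
    (hx : ∀ u, x (u + T) = x u + 2 * Real.pi * m) (hy : ∀ u, y (u + T) = y u + 2 * Real.pi * n)
    (u : ℝ) : ∃ j : ℤ, halfAngle φ x y (u + T) = halfAngle φ x y u + j * Real.pi := by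
  obtain ⟨k, hk⟩ := h.periodic
  refine ⟨n - k * m, ?_⟩
  rw [halfAngle, halfAngle, hx, hy, add_int_mul_period hk]
  push_cast
  ring

theorem IsClosedSolution.isPrincipalCycle_iff (h : IsClosedSolution A B φ)
    (hα : HasMinimalFoliation α A B) (hB : ContDiff ℝ ∞ B)
    (hBp : Function.Periodic B (2 * Real.pi)) {C : Set (Real.Angle × Real.Angle)} :
    IsPrincipalCycle α C ↔
      C = leaf φ ∨ ∃ c, holonomy B φ c = c ∧ C = leaf (affineSolution B φ c) := by
  constructor
  · intro hC
    obtain ⟨x, y, x', T, m, n, hxy, hxT, hyT, hm, rfl⟩ := hC.exists_isLeafPath hα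
    have hm' : 2 * Real.pi * (m : ℝ) ≠ 0 := by simpa [Real.pi_ne_zero] using hm
    have hsurj : Function.Surjective x := surjective_of_add_period
      (continuous_iff_continuousAt.2 fun u => (hxy.hasDerivAt_fst u).continuousAt) hm' hxT
    rcases h.sin_halfAngle_eq_zero_or_exists_relativeCot hB.continuous hxy with hzero | ⟨c, hc⟩
    · exact .inl (range_toTorus_eq_leaf hsurj hzero)
    · refine .inr ⟨c, h.holonomy_eq_self_of_relativeCot_eq hB.continuous hBp hm (t := x 0) ?_,
        range_toTorus_eq_leaf hsurj fun u => sin_halfAngle_affineSolution (hc u).2⟩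
      obtain ⟨j, hj⟩ := h.halfAngle_add hxT hyT 0
      have hj' : ((-1 : ℝ) ^ j) ≠ 0 := zpow_ne_zero _ (by norm_num)
      have hT := (hc (0 + T)).2
      rw [hj, Real.sin_add_int_mul_pi, Real.cos_add_int_mul_pi, (hc 0).2, hxT] at hT
      refine mul_right_cancel₀ (mul_ne_zero hj' (hc 0).1) ?_
      linear_combination -hT
  · rintro (rfl | ⟨c, hc, rfl⟩)
    · exact h.isPrincipalCycle hα
    · exact (h.affine hB hBp hc).isPrincipalCycle hα

theorem IsClosedSolution.toTorus_eq_of_mem_leaf (h : IsClosedSolution A B φ) {t y : ℝ}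
    (hy : toTorus (t, y) ∈ leaf φ) : toTorus (t, y) = toTorus (t, φ t) := by
  obtain ⟨k, hk⟩ := h.periodic
  obtain ⟨s, hs⟩ := hy
  obtain ⟨j, hj⟩ := Real.Angle.angle_eq_iff_two_pi_dvd_sub.1 (congrArg Prod.fst hs)
  have hφ := add_int_mul_period hk j t
  rw [← hs, ← toTorus_add_deck (t, φ t) j (k * j), deck, Prod.mk_add_mk]
  simp only [show s = t + 2 * Real.pi * j by linarith, hφ, Int.cast_mul, ← mul_assoc]

theorem IsClosedSolution.leaf_affineSolution_ne (h : IsClosedSolution A B φ) (c : ℝ) :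
    leaf (affineSolution B φ c) ≠ leaf φ := by
  intro heq
  have hmem : toTorus (0, affineSolution B φ c 0) ∈ leaf φ := heq ▸ ⟨0, rfl⟩
  have hsin := toTorus_eq_iff_sin_half_eq_zero.1 (h.toTorus_eq_of_mem_leaf hmem)
  rw [affineSolution, show (φ 0 + Real.pi - 2 * Real.arctan (relativeCot B φ c 0) - φ 0) / 2
    = Real.pi / 2 - Real.arctan (relativeCot B φ c 0) by ring, Real.sin_pi_div_two_sub] at hsin
  exact (Real.cos_arctan_pos _).ne' hsin

/-! ### The return map -/

/-- The solution through the angle `φ 0 + 2 arctan x`, as long as `1 + x * shift B φ t` stays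
positive. -/
noncomputable def nearbySolution (B φ : ℝ → ℝ) (x t : ℝ) : ℝ :=
  φ t + 2 * Real.arctan (Real.exp (logMultiplier B φ t) * x / (1 + x * shift B φ t))

theorem IsSolution.hasDerivAt_nearbySolution (h : IsSolution A B φ) (hB : Continuous B)
    {x t : ℝ} (hx : 1 + x * shift B φ t ≠ 0) :
    HasDerivAt (nearbySolution B φ x) (A t + B t * Real.sin (nearbySolution B φ x t)) t := by
  refine ((h.hasDerivAt t).add (((((h.hasDerivAt_logMultiplier hB t).exp.mul_const x).div
    (((h.hasDerivAt_shift hB t).const_mul x).const_add 1) hx).arctan).const_mul 2)).congr_deriv ?_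
  rw [nearbySolution, Real.sin_add, cos_two_mul_arctan, sin_two_mul_arctan]
  simp only [Pi.div_apply]
  field_simp
  ring

/-- A time change through `0` and `2π` with bounded range: along it, the nearby solutions with small
parameter exist for all times. -/
noncomputable def boundedTime (u : ℝ) : ℝ := 8 * Real.arctan u

theorem boundedTime_zero : boundedTime 0 = 0 := by simp [boundedTime]

theorem boundedTime_one : boundedTime 1 = 2 * Real.pi := by
  rw [boundedTime, Real.arctan_one]
  ring

theorem boundedTime_mem_Icc (u : ℝ) : boundedTime u ∈ Icc (-(4 * Real.pi)) (4 * Real.pi) := by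
  have hlower := Real.neg_pi_div_two_lt_arctan u
  have hupper := Real.arctan_lt_pi_div_two u
  constructor <;> simp only [boundedTime] <;> linarith

theorem contDiff_boundedTime : ContDiff ℝ ∞ boundedTime :=
  contDiff_const.mul Real.contDiff_arctan

theorem hasDerivAt_boundedTime (u : ℝ) : HasDerivAt boundedTime (8 * (1 / (1 + u ^ 2))) u :=
  (Real.hasDerivAt_arctan u).const_mul 8

theorem leaf_eq_image {σ : ℝ → ℝ} (hσ : Continuous σ) (h0 : σ 0 = 0) (h1 : σ 1 = 2 * Real.pi)
    {k : ℤ} (hk : ∀ t, φ (t + 2 * Real.pi) = φ t + 2 * Real.pi * k) :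
    leaf φ = (fun u => toTorus (σ u, φ (σ u))) '' Icc 0 1 := by
  refine Subset.antisymm ?_ (image_subset_iff.2 fun u _ => ⟨σ u, rfl⟩)
  rintro _ ⟨t, rfl⟩
  obtain ⟨j, hj, -⟩ := existsUnique_add_zsmul_mem_Ico Real.two_pi_pos t 0
  obtain ⟨u, hu, hut⟩ := intermediate_value_Icc zero_le_one hσ.continuousOn
    (show t + j • (2 * Real.pi) ∈ Icc (σ 0) (σ 1) by
      rw [h0, h1]; rw [zero_add] at hj; exact Ico_subset_Icc_self hj)
  refine ⟨u, hu, ?_⟩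
  have hdeck : (t + 2 * Real.pi * j, φ (t + 2 * Real.pi * j)) = (t, φ t) + deck j (k * j) := by
    simp only [add_int_mul_period hk, deck, Prod.mk_add_mk, Int.cast_mul]
    ring_nf
  simp only [hut, zsmul_eq_mul, mul_comm (j : ℝ), hdeck, toTorus_add_deck]

/-- The family of principal lines near the leaf of `φ` which defines its return map. -/
noncomputable def leafFamily (B φ : ℝ → ℝ) (p : ℝ × ℝ) : ℝ × ℝ :=
  (boundedTime p.2, nearbySolution B φ p.1 (boundedTime p.2))

theorem exists_forall_one_add_mul_ne_zero {J : ℝ → ℝ} (hJ : Continuous J) :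
    ∃ δ > 0, ∀ x ∈ Ioo (-δ) δ, ∀ u, 1 + x * J (boundedTime u) ≠ 0 := by
  obtain ⟨M, hM⟩ := (isCompact_Icc (a := -(4 * Real.pi))
    (b := 4 * Real.pi)).exists_bound_of_continuousOn
    hJ.continuousOn
  have hM0 : 0 ≤ M := (norm_nonneg _).trans (hM _ (boundedTime_mem_Icc 0))
  refine ⟨1 / (M + 1), by positivity, fun x hx u hzero => ?_⟩
  have hJu : |J (boundedTime u)| < M + 1 := (hM _ (boundedTime_mem_Icc u)).trans_lt (lt_add_one M)
  have hlt : |x * J (boundedTime u)| < 1 := by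
    calc |x * J (boundedTime u)| = |x| * |J (boundedTime u)| := abs_mul _ _
      _ < 1 / (M + 1) * (M + 1) :=
        mul_lt_mul'' (abs_lt.2 hx) hJu (abs_nonneg _) (abs_nonneg _)
      _ = 1 := by field_simp
  linarith [(abs_lt.1 hlt).1]

theorem IsSolution.contDiffOn_leafFamily (h : IsSolution A B φ) (hB : ContDiff ℝ ∞ B)
    {s : Set (ℝ × ℝ)} (hs : ∀ p ∈ s, 1 + p.1 * shift B φ (boundedTime p.2) ≠ 0) :
    ContDiffOn ℝ ∞ (leafFamily B φ) s := by
  have htime : ContDiff ℝ ∞ fun p : ℝ × ℝ => boundedTime p.2 :=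
    contDiff_boundedTime.comp contDiff_snd
  exact htime.contDiffOn.prodMk ((h.smooth.comp htime).contDiffOn.add (contDiffOn_const.mul
    (Real.contDiff_arctan.comp_contDiffOn
      ((((h.contDiff_logMultiplier hB).comp htime).exp.mul contDiff_fst).contDiffOn.div
        (contDiff_const.add (contDiff_fst.mul ((h.contDiff_shift hB).comp htime))).contDiffOn hs))))

theorem IsSolution.hasDerivAt_leafFamily (h : IsSolution A B φ) (hB : Continuous B) {x u : ℝ}
    (hx : 1 + x * shift B φ (boundedTime u) ≠ 0) :
    HasDerivAt (fun w => leafFamily B φ (x, w)) (8 * (1 / (1 + u ^ 2)),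
      (A (boundedTime u) + B (boundedTime u) * Real.sin (leafFamily B φ (x, u)).2)
        * (8 * (1 / (1 + u ^ 2)))) u :=
  (hasDerivAt_boundedTime u).prodMk
    ((h.hasDerivAt_nearbySolution hB hx).comp u (hasDerivAt_boundedTime u))

theorem leafFamily_fst_zero (B φ : ℝ → ℝ) (x : ℝ) :
    leafFamily B φ (x, 0) = (0, φ 0 + 2 * Real.arctan x) := by
  simp [leafFamily, nearbySolution, boundedTime_zero, logMultiplier_zero, shift_zero]

theorem hasDerivAt_leafFamily_transversal (B φ : ℝ → ℝ) :
    HasDerivAt (fun x => leafFamily B φ (x, 0)) (0, 2) 0 := by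
  simp only [leafFamily_fst_zero]
  exact (hasDerivAt_const _ _).prodMk
    ((((Real.hasDerivAt_arctan 0).const_mul 2).const_add _).congr_deriv (by norm_num))

theorem IsClosedSolution.isReturnMap (h : IsClosedSolution A B φ) (hB : ContDiff ℝ ∞ B)
    (hα : HasMinimalFoliation α A B) :
    IsReturnMap α (leaf φ) fun x => Real.exp (logMultiplier B φ (2 * Real.pi)) * x /
      (1 + x * shift B φ (2 * Real.pi)) := by
  obtain ⟨k, hk⟩ := h.periodic
  obtain ⟨δ, hδ, hne⟩ := exists_forall_one_add_mul_ne_zero (h.contDiff_shift hB).continuous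
  have hderiv {x : ℝ} (hx : x ∈ Ioo (-δ) δ) (u : ℝ) :=
    (h.hasDerivAt_leafFamily hB.continuous (hne x hx u)).deriv
  refine ⟨by simp, ?_, leafFamily B φ, δ, 1, 1, k, hδ, one_pos,
    h.contDiffOn_leafFamily hB fun p hp => hne p.1 hp.1 p.2, fun x hx u _ => ?_, ?_, ?_, ?_⟩
  · exact (contDiffAt_const.mul contDiffAt_id).div
      (contDiffAt_const.add (contDiffAt_id.mul contDiffAt_const)) (by simp)
  · rw [hderiv hx, hα]
    exact ⟨by positivity, rfl⟩
  · rw [leaf_eq_image contDiff_boundedTime.continuous boundedTime_zero boundedTime_one hk]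
    simp [leafFamily, nearbySolution]
  · rw [(hasDerivAt_leafFamily_transversal B φ).deriv, hderiv ⟨neg_lt_zero.2 hδ, hδ⟩,
      LinearIndependent.pair_iff]
    intro a b hab
    simp only [Prod.smul_mk, Prod.mk_add_mk, smul_eq_mul, Prod.mk_eq_zero] at hab
    have hb : b = 0 := by simpa using hab.1
    exact ⟨by simpa [hb] using hab.2, hb⟩
  · have hk0 := hk 0
    rw [zero_add] at hk0
    filter_upwards with x
    rw [leafFamily_fst_zero, leafFamily, boundedTime_one, nearbySolution, hk0]
    simp only [deck, Prod.mk_add_mk, Prod.mk.injEq]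
    exact ⟨by simp, by ring⟩

theorem hasDerivAt_moebius (l J : ℝ) {x : ℝ} (hx : 1 + x * J ≠ 0) :
    HasDerivAt (fun x : ℝ => l * x / (1 + x * J)) (l / (1 + x * J) ^ 2) x :=
  (((hasDerivAt_id x).const_mul l).div (((hasDerivAt_id x).mul_const J).const_add 1)
    hx).congr_deriv (by simp only [id]; ring)

theorem deriv_moebius_zero (l J : ℝ) : deriv (fun x : ℝ => l * x / (1 + x * J)) 0 = l := by
  simpa using (hasDerivAt_moebius l J (x := 0) (by simp)).deriv

theorem deriv_deriv_moebius_zero (l J : ℝ) :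
    deriv (deriv fun x : ℝ => l * x / (1 + x * J)) 0 = -2 * l * J := by
  have hne : ∀ᶠ x in 𝓝 (0 : ℝ), 1 + x * J ≠ 0 :=
    (by fun_prop : Continuous fun x : ℝ => 1 + x * J).continuousAt.eventually_ne (by simp)
  rw [EventuallyEq.deriv_eq (hne.mono fun x hx => (hasDerivAt_moebius l J hx).deriv)]
  exact (((hasDerivAt_const 0 l).div ((((hasDerivAt_id 0).mul_const J).const_add 1).pow 2)
    (by simp)).congr_deriv (by simp; ring) : HasDerivAt _ (-2 * l * J) (0 : ℝ)).deriv

namespace IsClosedSolution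

theorem isHyperbolicPrincipalCycle (h : IsClosedSolution A B φ) (hB : ContDiff ℝ ∞ B)
    (hα : HasMinimalFoliation α A B) (hI : logMultiplier B φ (2 * Real.pi) ≠ 0) :
    IsHyperbolicPrincipalCycle α (leaf φ) :=
  ⟨h.isPrincipalCycle hα, _, h.isReturnMap hB hα, by rw [deriv_moebius_zero]; simpa using hI⟩

theorem isDoublePrincipalCycle (h : IsClosedSolution A B φ) (hB : ContDiff ℝ ∞ B)
    (hα : HasMinimalFoliation α A B) (hI : logMultiplier B φ (2 * Real.pi) = 0)
    (hJ : shift B φ (2 * Real.pi) ≠ 0) : IsDoublePrincipalCycle α (leaf φ) :=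
  ⟨h.isPrincipalCycle hα, _, h.isReturnMap hB hα, by rw [deriv_moebius_zero, hI, Real.exp_zero],
    by rw [deriv_deriv_moebius_zero]; simpa [hI] using hJ⟩

end IsClosedSolution

theorem IsHyperbolicSolution.two_hyperbolic_cycles (h : IsHyperbolicSolution A B φ)
    (hB : ContDiff ℝ ∞ B) (hBp : Function.Periodic B (2 * Real.pi))
    (hα : HasMinimalFoliation α A B) :
    {C | IsPrincipalCycle α C}.ncard = 2 ∧
      ∀ C, IsPrincipalCycle α C → IsHyperbolicPrincipalCycle α C := by
  have hφ := h.toIsClosedSolution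
  have hI := h.logMultiplier_ne_zero
  obtain ⟨c, hfix⟩ : ∃ c, ∀ c', holonomy B φ c' = c' ↔ c' = c := ⟨_, holonomy_eq_self_iff hI⟩
  have hcycles (C) : IsPrincipalCycle α C ↔ C = leaf φ ∨ C = leaf (affineSolution B φ c) := by
    simp only [hφ.isPrincipalCycle_iff hα hB hBp, hfix, exists_eq_left]
  have hc : holonomy B φ c = c := (hfix c).2 rfl
  constructor
  · rw [show {C | IsPrincipalCycle α C} = {leaf φ, leaf (affineSolution B φ c)} from ext hcycles,
      ncard_pair (hφ.leaf_affineSolution_ne c).symm]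
  · intro C hC
    rcases (hcycles C).1 hC with rfl | rfl
    · exact hφ.isHyperbolicPrincipalCycle hB hα hI
    · exact (hφ.affine hB hBp hc).isHyperbolicPrincipalCycle hB hα
        (by rwa [hφ.logMultiplier_affineSolution hB hBp hc, neg_ne_zero])

theorem IsDoubleSolution.one_double_cycle (h : IsDoubleSolution A B φ) (hB : ContDiff ℝ ∞ B)
    (hBp : Function.Periodic B (2 * Real.pi)) (hα : HasMinimalFoliation α A B) :
    {C | IsPrincipalCycle α C}.ncard = 1 ∧
      ∀ C, IsPrincipalCycle α C → IsDoublePrincipalCycle α C := by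
  have hcycles (C) : IsPrincipalCycle α C ↔ C = leaf φ := by
    simp only [h.toIsClosedSolution.isPrincipalCycle_iff hα hB hBp,
      holonomy_ne_self h.logMultiplier_eq_zero h.shift_ne_zero, false_and, exists_false, or_false]
  constructor
  · rw [show {C | IsPrincipalCycle α C} = {leaf φ} from ext hcycles, ncard_singleton]
  · intro C hC
    rw [(hcycles C).1 hC]
    exact h.toIsClosedSolution.isDoublePrincipalCycle hB hα h.logMultiplier_eq_zero
      h.shift_ne_zero

end Cycle

/-! ### Vector algebra of three-space -/

theorem inner_eq (a b : E3) : inner ℝ a b = a 0 * b 0 + a 1 * b 1 + a 2 * b 2 := by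
  rw [PiLp.inner_apply, Fin.sum_univ_three]
  simp only [RCLike.inner_apply, conj_trivial, mul_comm]

theorem cross_zero_apply (a b : E3) : cross a b 0 = a 1 * b 2 - a 2 * b 1 := by
  simp [cross, cross_apply]

theorem cross_one_apply (a b : E3) : cross a b 1 = a 2 * b 0 - a 0 * b 2 := by
  simp [cross, cross_apply]

theorem cross_two_apply (a b : E3) : cross a b 2 = a 0 * b 1 - a 1 * b 0 := by
  simp [cross, cross_apply]

theorem ext_three {a b : E3} (h0 : a 0 = b 0) (h1 : a 1 = b 1) (h2 : a 2 = b 2) : a = b := by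
  ext i
  fin_cases i <;> assumption

/-- The cross product as a continuous bilinear map. -/
noncomputable def crossL : E3 →L[ℝ] E3 →L[ℝ] E3 :=
  LinearMap.toContinuousBilinearMap (LinearMap.mk₂ ℝ cross
    (fun a b c => by simp [cross]) (fun a b c => by simp [cross])
    (fun a b c => by simp [cross]) (fun a b c => by simp [cross]))

theorem crossL_apply (a b : E3) : crossL a b = cross a b := rfl

theorem cross_add_left (a b c : E3) : cross (a + b) c = cross a c + cross b c := by
  simp [← crossL_apply]

theorem cross_add_right (a b c : E3) : cross a (b + c) = cross a b + cross a c := by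
  simp [← crossL_apply]

theorem cross_smul_left (k : ℝ) (a b : E3) : cross (k • a) b = k • cross a b := by
  simp [← crossL_apply]

theorem cross_smul_right (k : ℝ) (a b : E3) : cross a (k • b) = k • cross a b := by
  simp [← crossL_apply]

theorem cross_self_eq_zero (a : E3) : cross a a = 0 := by simp [cross]

theorem left_ne_zero_of_cross_ne_zero {a b : E3} (h : cross a b ≠ 0) : a ≠ 0 := by
  rintro rfl
  exact h (by simp [← crossL_apply])

theorem neg_cross_eq_cross_swap (a b : E3) : -cross a b = cross b a := by
  refine ext_three ?_ ?_ ?_ <;>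
    simp only [PiLp.neg_apply, cross_zero_apply, cross_one_apply, cross_two_apply] <;> ring

theorem cross_cross_left (a b c : E3) :
    cross (cross a b) c = (inner ℝ a c) • b - (inner ℝ b c) • a := by
  refine ext_three ?_ ?_ ?_ <;>
    simp only [PiLp.sub_apply, PiLp.smul_apply, smul_eq_mul, inner_eq,
      cross_zero_apply, cross_one_apply, cross_two_apply] <;> ring

theorem inner_cross_self_left (a b : E3) : inner ℝ (cross a b) a = 0 := by
  simp only [inner_eq, cross_zero_apply, cross_one_apply, cross_two_apply]
  ring

theorem inner_cross_self_right (a b : E3) : inner ℝ (cross a b) b = 0 := by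
  simp only [inner_eq, cross_zero_apply, cross_one_apply, cross_two_apply]
  ring

theorem inner_cross_cross (a b : E3) :
    inner ℝ (cross a b) (cross a b) = inner ℝ a a * inner ℝ b b - inner ℝ a b ^ 2 := by
  simp only [inner_eq, cross_zero_apply, cross_one_apply, cross_two_apply]
  ring

theorem inner_cross_smul_cross_sub (a b d : E3) :
    (inner ℝ (cross a b) (cross a b)) • cross a d
      - (inner ℝ (cross a b) (cross a d)) • cross a b
      = -((inner ℝ (cross a b) d) • cross (cross a b) a) := by
  refine ext_three ?_ ?_ ?_ <;>
    simp only [PiLp.sub_apply, PiLp.smul_apply, PiLp.neg_apply, smul_eq_mul, inner_eq,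
      cross_zero_apply, cross_one_apply, cross_two_apply] <;> ring

theorem hasDerivAt_cross {a b : ℝ → E3} {a' b' : E3} {t : ℝ} (ha : HasDerivAt a a' t)
    (hb : HasDerivAt b b' t) :
    HasDerivAt (fun t => cross (a t) (b t)) (cross a' (b t) + cross (a t) b') t :=
  (crossL.hasFDerivAt.comp_hasDerivAt t ha).clm_apply hb

theorem contDiff_cross {n : WithTop ℕ∞} {a b : ℝ → E3} (ha : ContDiff ℝ n a)
    (hb : ContDiff ℝ n b) : ContDiff ℝ n fun t => cross (a t) (b t) :=
  (crossL.contDiff.comp ha).clm_apply hb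

section Calculus

variable {F : Type*} [NormedAddCommGroup F]

theorem contDiff_deriv [NormedSpace ℝ F] {f : ℝ → F} (hf : ContDiff ℝ ∞ f) :
    ContDiff ℝ ∞ (deriv f) :=
  (contDiff_infty_iff_deriv.1 hf).2

theorem hasDerivAt_deriv [NormedSpace ℝ F] {f : ℝ → F} (hf : ContDiff ℝ ∞ f) (t : ℝ) :
    HasDerivAt f (deriv f t) t :=
  ((contDiff_infty_iff_deriv.1 hf).1 t).hasDerivAt

theorem periodic_deriv [NormedSpace ℝ F] {f : ℝ → F} {T : ℝ} (hf : Function.Periodic f T) :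
    Function.Periodic (deriv f) T := fun t => by
  rw [← deriv_comp_add_const, hf.funext]

theorem fderiv_apply_of_partial [NormedSpace ℝ F] {f : ℝ × ℝ → F} {p : ℝ × ℝ} {a b : F}
    (hf : DifferentiableAt ℝ f p) (hfst : HasDerivAt (fun t => f (t, p.2)) a p.1)
    (hsnd : HasDerivAt (fun s => f (p.1, s)) b p.2) (v : ℝ × ℝ) :
    fderiv ℝ f p v = v.1 • a + v.2 • b := by
  have ha := (hf.hasFDerivAt.comp_hasDerivAt p.1
    ((hasDerivAt_id p.1).prodMk (hasDerivAt_const p.1 p.2))).unique hfst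
  have hb := (hf.hasFDerivAt.comp_hasDerivAt p.2
    ((hasDerivAt_const p.2 p.1).prodMk (hasDerivAt_id p.2))).unique hsnd
  rw [← ha, ← hb, ← map_smul, ← map_smul, ← map_add]
  simp

variable [InnerProductSpace ℝ F]

theorem inner_inv_norm_smul_self {a : F} (ha : a ≠ 0) :
    inner ℝ (‖a‖⁻¹ • a) (‖a‖⁻¹ • a) = 1 := by
  rw [real_inner_self_eq_norm_sq, norm_smul, norm_inv, norm_norm,
    inv_mul_cancel₀ (norm_ne_zero_iff.2 ha), one_pow]

theorem hasDerivAt_inv_norm_smul {a : ℝ → F} {a' : F} {t : ℝ} (ha : HasDerivAt a a' t)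
    (hne : a t ≠ 0) :
    HasDerivAt (fun t => ‖a t‖⁻¹ • a t)
      ((‖a t‖ ^ 3)⁻¹ • (inner ℝ (a t) (a t) • a' - inner ℝ (a t) a' • a t)) t := by
  have hnorm : ‖a t‖ ≠ 0 := norm_ne_zero_iff.2 hne
  have hderiv : HasDerivAt (fun t => ‖a t‖) (inner ℝ (a t) a' / ‖a t‖) t := by
    have hsqrt := ha.norm_sq.sqrt (pow_ne_zero 2 hnorm)
    simp only [Real.sqrt_sq (norm_nonneg _)] at hsqrt
    exact hsqrt.congr_deriv (by field_simp)
  refine ((hderiv.inv hnorm).smul ha).congr_deriv ?_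
  rw [real_inner_self_eq_norm_sq]
  simp only [Pi.inv_apply]
  match_scalars <;> field_simp

end Calculus

/-! ### The Frenet frame -/

/-- A smooth positive orthonormal frame with the Frenet equations `T' = ω₁ N`,
`N' = -ω₁ T + ω₂ B`, `B' = -ω₂ N`, where `ω₁`, `ω₂` include the speed of the curve. -/
structure IsMovingFrame (T N B : ℝ → E3) (ω₁ ω₂ : ℝ → ℝ) : Prop where
  smooth_T : ContDiff ℝ ∞ T
  smooth_N : ContDiff ℝ ∞ N
  smooth_B : ContDiff ℝ ∞ B
  deriv_T : ∀ t, HasDerivAt T (ω₁ t • N t) t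
  deriv_N : ∀ t, HasDerivAt N (-ω₁ t • T t + ω₂ t • B t) t
  deriv_B : ∀ t, HasDerivAt B (-ω₂ t • N t) t
  inner_TT : ∀ t, inner ℝ (T t) (T t) = 1
  inner_BB : ∀ t, inner ℝ (B t) (B t) = 1
  inner_BT : ∀ t, inner ℝ (B t) (T t) = 0
  cross_BT : ∀ t, cross (B t) (T t) = N t

theorem cross_cross_self_left {a b : E3} (ha : inner ℝ a a = 1) (hab : inner ℝ a b = 0) :
    cross (cross a b) a = b := by
  rw [cross_cross_left, ha, real_inner_comm, hab, one_smul, zero_smul, sub_zero]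

theorem cross_self_cross {a b : E3} (hb : inner ℝ b b = 1) (hab : inner ℝ a b = 0) :
    cross b (cross a b) = a := by
  rw [← neg_cross_eq_cross_swap, cross_cross_left, hb, hab, one_smul, zero_smul, zero_sub, neg_neg]

namespace IsMovingFrame

variable {T N B : ℝ → E3} {ω₁ ω₂ : ℝ → ℝ}

theorem cross_NB (h : IsMovingFrame T N B ω₁ ω₂) (t : ℝ) : cross (N t) (B t) = T t := by
  rw [← h.cross_BT, cross_cross_self_left (h.inner_BB t) (h.inner_BT t)]

theorem cross_TN (h : IsMovingFrame T N B ω₁ ω₂) (t : ℝ) : cross (T t) (N t) = B t := by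
  rw [← h.cross_BT, cross_self_cross (h.inner_TT t) (h.inner_BT t)]

theorem inner_NN (h : IsMovingFrame T N B ω₁ ω₂) (t : ℝ) : inner ℝ (N t) (N t) = 1 := by
  rw [← h.cross_BT, inner_cross_cross, h.inner_BB, h.inner_TT, h.inner_BT]
  norm_num

theorem inner_NT (h : IsMovingFrame T N B ω₁ ω₂) (t : ℝ) : inner ℝ (N t) (T t) = 0 := by
  rw [← h.cross_BT, inner_cross_self_right]

theorem inner_NB (h : IsMovingFrame T N B ω₁ ω₂) (t : ℝ) : inner ℝ (N t) (B t) = 0 := by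
  rw [← h.cross_BT, inner_cross_self_left]

end IsMovingFrame

/-- The angular speed of the tangent, `ṡ` times the curvature. -/
noncomputable def bending (c : ℝ → E3) (t : ℝ) : ℝ :=
  ‖cross (deriv c t) (deriv (deriv c) t)‖ / speed c t ^ 2

/-- The angular speed of the binormal, `ṡ` times the torsion. -/
noncomputable def twisting (c : ℝ → E3) (t : ℝ) : ℝ :=
  speed c t * inner ℝ (cross (deriv c t) (deriv (deriv c) t)) (deriv (deriv (deriv c)) t) /
    ‖cross (deriv c t) (deriv (deriv c) t)‖ ^ 2

section Frenet

variable {c : ℝ → E3}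

theorem frenetN_eq (c : ℝ → E3) (t : ℝ) :
    frenetN c t = (‖cross (deriv c t) (deriv (deriv c) t)‖⁻¹ * (speed c t)⁻¹) •
      cross (cross (deriv c t) (deriv (deriv c) t)) (deriv c t) := by
  rw [frenetN, frenetB, frenetT, cross_smul_left, cross_smul_right, smul_smul]

theorem hasDerivAt_frenetT (hc : ContDiff ℝ ∞ c) {t : ℝ}
    (hcurved : cross (deriv c t) (deriv (deriv c) t) ≠ 0) :
    HasDerivAt (frenetT c) (bending c t • frenetN c t) t := by
  have hspeed := left_ne_zero_of_cross_ne_zero hcurved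
  refine (hasDerivAt_inv_norm_smul (hasDerivAt_deriv (contDiff_deriv hc) t) hspeed).congr_deriv ?_
  have hnorm := norm_ne_zero_iff.2 hspeed
  have hcross := norm_ne_zero_iff.2 hcurved
  rw [frenetN_eq, cross_cross_left, bending, speed,
    real_inner_comm (deriv c t) (deriv (deriv c) t)]
  match_scalars <;> field_simp

theorem hasDerivAt_frenetB (hc : ContDiff ℝ ∞ c) {t : ℝ}
    (hcurved : cross (deriv c t) (deriv (deriv c) t) ≠ 0) :
    HasDerivAt (frenetB c) (-twisting c t • frenetN c t) t := by
  have hc' := contDiff_deriv hc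
  have hderiv := hasDerivAt_cross (hasDerivAt_deriv hc' t)
    (hasDerivAt_deriv (contDiff_deriv hc') t)
  rw [cross_self_eq_zero, zero_add] at hderiv
  refine (hasDerivAt_inv_norm_smul hderiv hcurved).congr_deriv ?_
  have hspeed := norm_ne_zero_iff.2 (left_ne_zero_of_cross_ne_zero hcurved)
  have hcross := norm_ne_zero_iff.2 hcurved
  rw [inner_cross_smul_cross_sub, frenetN_eq, twisting, speed]
  match_scalars
  field_simp

theorem isMovingFrame_frenet (hc : ContDiff ℝ ∞ c)
    (hcurved : ∀ t, cross (deriv c t) (deriv (deriv c) t) ≠ 0) :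
    IsMovingFrame (frenetT c) (frenetN c) (frenetB c) (bending c) (twisting c) := by
  have hspeed (t) := left_ne_zero_of_cross_ne_zero (hcurved t)
  have hc' := contDiff_deriv hc
  have hW := contDiff_cross hc' (contDiff_deriv hc')
  have hT : ContDiff ℝ ∞ (frenetT c) :=
    ((hc'.norm ℝ hspeed).inv fun t => norm_ne_zero_iff.2 (hspeed t)).smul hc'
  have hB : ContDiff ℝ ∞ (frenetB c) :=
    ((hW.norm ℝ hcurved).inv fun t => norm_ne_zero_iff.2 (hcurved t)).smul hW
  have hTT (t) : inner ℝ (frenetT c t) (frenetT c t) = 1 := inner_inv_norm_smul_self (hspeed t)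
  have hBB (t) : inner ℝ (frenetB c t) (frenetB c t) = 1 := inner_inv_norm_smul_self (hcurved t)
  have hBT (t) : inner ℝ (frenetB c t) (frenetT c t) = 0 := by
    rw [frenetB, frenetT, real_inner_smul_left, real_inner_smul_right, inner_cross_self_left,
      mul_zero, mul_zero]
  refine ⟨hT, contDiff_cross hB hT, hB, fun t => hasDerivAt_frenetT hc (hcurved t), fun t => ?_,
    fun t => hasDerivAt_frenetB hc (hcurved t), hTT, hBB, hBT, fun t => rfl⟩
  refine (hasDerivAt_cross (hasDerivAt_frenetB hc (hcurved t))
    (hasDerivAt_frenetT hc (hcurved t))).congr_deriv ?_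
  have hNT : cross (frenetN c t) (frenetT c t) = -frenetB c t := by
    rw [frenetN, ← neg_cross_eq_cross_swap, cross_self_cross (hTT t) (hBT t)]
  have hBN : cross (frenetB c t) (frenetN c t) = -frenetT c t := by
    rw [frenetN, ← neg_cross_eq_cross_swap, cross_cross_self_left (hBB t) (hBT t)]
  rw [cross_smul_left, cross_smul_right, hNT, hBN]
  module

end Frenet

/-! ### The minimal principal foliation of a canal surface -/

/-- The outward normal of a canal surface. -/
noncomputable def sphereNormal (c : ℝ → E3) (r : ℝ → ℝ) (p : ℝ × ℝ) : E3 :=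
  canalCos c r p.1 • frenetT c p.1
    + canalSin c r p.1 • (Real.cos p.2 • frenetN c p.1 + Real.sin p.2 • frenetB c p.1)

/-- The unit tangent of the characteristic circle. -/
noncomputable def circleTangent (c : ℝ → E3) (p : ℝ × ℝ) : E3 :=
  -Real.sin p.2 • frenetN c p.1 + Real.cos p.2 • frenetB c p.1

/-- The unit tangent orthogonal to the characteristic circle. -/
noncomputable def meridianTangent (c : ℝ → E3) (r : ℝ → ℝ) (p : ℝ × ℝ) : E3 :=
  -canalSin c r p.1 • frenetT c p.1
    + canalCos c r p.1 • (Real.cos p.2 • frenetN c p.1 + Real.sin p.2 • frenetB c p.1)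

/-- The component along `meridianTangent` of the `t`-derivative of the outward normal. -/
noncomputable def normalTurning (c : ℝ → E3) (r : ℝ → ℝ) (p : ℝ × ℝ) : ℝ :=
  -deriv (canalCos c r) p.1 / canalSin c r p.1 + bending c p.1 * Real.cos p.2

/-- The component along `circleTangent` of the `t`-derivative of the outward normal. -/
noncomputable def circleTurning (c : ℝ → E3) (r : ℝ → ℝ) (p : ℝ × ℝ) : ℝ :=
  canalSin c r p.1 * twisting c p.1 - canalCos c r p.1 * bending c p.1 * Real.sin p.2

/-- The component along `meridianTangent` of the `t`-derivative of the canal surface. -/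
noncomputable def meridianSpeed (c : ℝ → E3) (r : ℝ → ℝ) (p : ℝ × ℝ) : ℝ :=
  -speed c p.1 * canalSin c r p.1 + r p.1 * normalTurning c r p

/-- The coefficient of `sin φ` in the equation `dφ/dt = -twisting + forcing * sin φ` of the
minimal principal lines. -/
noncomputable def forcing (c : ℝ → E3) (r : ℝ → ℝ) (t : ℝ) : ℝ :=
  bending c t * (canalCos c r t / canalSin c r t)

/-- The minimal principal curvature of a canal surface; the maximal one is `1 / r`. -/
noncomputable def meridianCurvature (c : ℝ → E3) (r : ℝ → ℝ) (p : ℝ × ℝ) : ℝ :=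
  normalTurning c r p / meridianSpeed c r p

theorem canalSurface_eq (c : ℝ → E3) (r : ℝ → ℝ) :
    canalSurface c r = fun p => c p.1 + r p.1 • sphereNormal c r p := by
  funext p
  simp only [canalSurface, sphereNormal]
  module

/-- A canal surface along a curve with nonvanishing curvature which is an immersion with the
spheres curving more than the meridians: `meridianSpeed` is negative when `r` is small compared
with the focal distance of the meridian. -/
structure IsRegularCanal (c : ℝ → E3) (r : ℝ → ℝ) : Prop where
  smooth_c : ContDiff ℝ ∞ c
  smooth_r : ContDiff ℝ ∞ r
  curved : ∀ t, cross (deriv c t) (deriv (deriv c) t) ≠ 0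
  cos_sq_lt : ∀ t, canalCos c r t ^ 2 < 1
  r_pos : ∀ t, 0 < r t
  meridianSpeed_neg : ∀ p, meridianSpeed c r p < 0

theorem forcing_periodic {c : ℝ → E3} {r : ℝ → ℝ} {T : ℝ} (hc : Function.Periodic c T)
    (hr : Function.Periodic r T) : Function.Periodic (forcing c r) T := fun t => by
  have hc' := periodic_deriv hc
  simp only [forcing, bending, canalSin, canalCos, speed, hc' t, periodic_deriv hc' t,
    periodic_deriv hr t]

theorem hasDerivAt_sphereNormal_snd (c : ℝ → E3) (r : ℝ → ℝ) (p : ℝ × ℝ) :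
    HasDerivAt (fun s => sphereNormal c r (p.1, s)) (canalSin c r p.1 • circleTangent c p) p.2 :=
  ((((Real.hasDerivAt_cos p.2).smul_const (frenetN c p.1)).add
    ((Real.hasDerivAt_sin p.2).smul_const (frenetB c p.1))).const_smul
      (canalSin c r p.1)).const_add (canalCos c r p.1 • frenetT c p.1)

theorem hasDerivAt_canalSurface_snd (c : ℝ → E3) (r : ℝ → ℝ) (p : ℝ × ℝ) :
    HasDerivAt (fun s => canalSurface c r (p.1, s))
      ((r p.1 * canalSin c r p.1) • circleTangent c p) p.2 := by
  rw [canalSurface_eq]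
  refine (((hasDerivAt_sphereNormal_snd c r p).const_smul (r p.1)).const_add (c p.1)).congr_deriv ?_
  rw [smul_smul]

namespace IsRegularCanal

variable {c : ℝ → E3} {r : ℝ → ℝ}

theorem deriv_ne_zero (h : IsRegularCanal c r) (t : ℝ) : deriv c t ≠ 0 :=
  left_ne_zero_of_cross_ne_zero (h.curved t)

theorem speed_pos (h : IsRegularCanal c r) (t : ℝ) : 0 < speed c t :=
  norm_pos_iff.2 (h.deriv_ne_zero t)

theorem isMovingFrame (h : IsRegularCanal c r) :
    IsMovingFrame (frenetT c) (frenetN c) (frenetB c) (bending c) (twisting c) :=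
  isMovingFrame_frenet h.smooth_c h.curved

theorem contDiff_canalCos (h : IsRegularCanal c r) : ContDiff ℝ ∞ (canalCos c r) :=
  ((contDiff_deriv h.smooth_r).div ((contDiff_deriv h.smooth_c).norm ℝ h.deriv_ne_zero)
    fun t => (h.speed_pos t).ne').neg

theorem one_sub_canalCos_sq_pos (h : IsRegularCanal c r) (t : ℝ) : 0 < 1 - canalCos c r t ^ 2 :=
  sub_pos.2 (h.cos_sq_lt t)

theorem contDiff_canalSin (h : IsRegularCanal c r) : ContDiff ℝ ∞ (canalSin c r) :=
  (contDiff_const.sub (h.contDiff_canalCos.pow 2)).sqrt fun t => (h.one_sub_canalCos_sq_pos t).ne'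

theorem canalSin_pos (h : IsRegularCanal c r) (t : ℝ) : 0 < canalSin c r t :=
  Real.sqrt_pos.2 (h.one_sub_canalCos_sq_pos t)

theorem canalSin_sq (h : IsRegularCanal c r) (t : ℝ) :
    canalSin c r t ^ 2 = 1 - canalCos c r t ^ 2 :=
  Real.sq_sqrt (h.one_sub_canalCos_sq_pos t).le

theorem hasDerivAt_canalCos (h : IsRegularCanal c r) (t : ℝ) :
    HasDerivAt (canalCos c r) (deriv (canalCos c r) t) t :=
  hasDerivAt_deriv h.contDiff_canalCos t

theorem hasDerivAt_canalSin (h : IsRegularCanal c r) (t : ℝ) :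
    HasDerivAt (canalSin c r) (-canalCos c r t * deriv (canalCos c r) t / canalSin c r t) t := by
  refine ((((h.hasDerivAt_canalCos t).pow 2).const_sub 1).sqrt
    (h.one_sub_canalCos_sq_pos t).ne').congr_deriv ?_
  have hsin := (h.canalSin_pos t).ne'
  simp only [canalSin, Pi.pow_apply] at hsin ⊢
  field_simp
  norm_num
  ring

theorem contDiff_forcing (h : IsRegularCanal c r) : ContDiff ℝ ∞ (forcing c r) := by
  have hc' := contDiff_deriv h.smooth_c
  have hbending : ContDiff ℝ ∞ (bending c) :=
    ((contDiff_cross hc' (contDiff_deriv hc')).norm ℝ h.curved).div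
      ((hc'.norm ℝ h.deriv_ne_zero).pow 2) fun t => (pow_pos (h.speed_pos t) 2).ne'
  exact hbending.mul (h.contDiff_canalCos.div h.contDiff_canalSin fun t => (h.canalSin_pos t).ne')

theorem contDiff_sphereNormal (h : IsRegularCanal c r) : ContDiff ℝ ∞ (sphereNormal c r) := by
  have hframe := h.isMovingFrame
  exact ((h.contDiff_canalCos.comp contDiff_fst).smul (hframe.smooth_T.comp contDiff_fst)).add
    ((h.contDiff_canalSin.comp contDiff_fst).smul (((Real.contDiff_cos.comp contDiff_snd).smul
      (hframe.smooth_N.comp contDiff_fst)).add ((Real.contDiff_sin.comp contDiff_snd).smul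
        (hframe.smooth_B.comp contDiff_fst))))

theorem contDiff_canalSurface (h : IsRegularCanal c r) : ContDiff ℝ ∞ (canalSurface c r) := by
  rw [canalSurface_eq]
  exact (h.smooth_c.comp contDiff_fst).add
    ((h.smooth_r.comp contDiff_fst).smul h.contDiff_sphereNormal)

theorem hasDerivAt_sphereNormal_fst (h : IsRegularCanal c r) (p : ℝ × ℝ) :
    HasDerivAt (fun t => sphereNormal c r (t, p.2))
      (normalTurning c r p • meridianTangent c r p
        + circleTurning c r p • circleTangent c p) p.1 := by
  have hframe := h.isMovingFrame
  refine (((h.hasDerivAt_canalCos p.1).smul (hframe.deriv_T p.1)).add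
    ((h.hasDerivAt_canalSin p.1).smul (((hframe.deriv_N p.1).const_smul (Real.cos p.2)).add
      ((hframe.deriv_B p.1).const_smul (Real.sin p.2))))).congr_deriv ?_
  simp only [normalTurning, meridianTangent, circleTurning, circleTangent, Pi.add_apply,
    Pi.smul_apply]
  have hne := (h.canalSin_pos p.1).ne'
  match_scalars <;> field_simp
  · linear_combination -(canalCos c r p.1 * bending c p.1 * canalSin c r p.1) *
      Real.sin_sq_add_cos_sq p.2
  · ring
  · ring

theorem hasDerivAt_canalSurface_fst (h : IsRegularCanal c r) (p : ℝ × ℝ) :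
    HasDerivAt (fun t => canalSurface c r (t, p.2))
      (meridianSpeed c r p • meridianTangent c r p +
        (r p.1 * circleTurning c r p) • circleTangent c p) p.1 := by
  have hne := (h.speed_pos p.1).ne'
  rw [canalSurface_eq]
  refine ((hasDerivAt_deriv h.smooth_c p.1).add ((hasDerivAt_deriv h.smooth_r p.1).smul
    (h.hasDerivAt_sphereNormal_fst p))).congr_deriv ?_
  have hderivc : deriv c p.1 = speed c p.1 • frenetT c p.1 := by
    rw [frenetT, smul_smul, mul_inv_cancel₀ hne, one_smul]
  have hderivr : deriv r p.1 = -speed c p.1 * canalCos c r p.1 := by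
    rw [canalCos]
    field_simp
  rw [hderivc, hderivr]
  simp only [meridianSpeed, sphereNormal, meridianTangent]
  match_scalars
  · linear_combination -speed c p.1 * h.canalSin_sq p.1
  all_goals ring

theorem fderiv_sphereNormal (h : IsRegularCanal c r) (p v : ℝ × ℝ) :
    fderiv ℝ (sphereNormal c r) p v = (v.1 * normalTurning c r p) • meridianTangent c r p +
      (v.1 * circleTurning c r p + v.2 * canalSin c r p.1) • circleTangent c p := by
  rw [fderiv_apply_of_partial ((h.contDiff_sphereNormal.differentiable (by simp)) p)
    (h.hasDerivAt_sphereNormal_fst p) (hasDerivAt_sphereNormal_snd c r p)]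
  module

theorem fderiv_canalSurface (h : IsRegularCanal c r) (p v : ℝ × ℝ) :
    fderiv ℝ (canalSurface c r) p v = (v.1 * meridianSpeed c r p) • meridianTangent c r p +
      (r p.1 * (v.1 * circleTurning c r p + v.2 * canalSin c r p.1)) • circleTangent c p := by
  rw [fderiv_apply_of_partial ((h.contDiff_canalSurface.differentiable (by simp)) p)
    (h.hasDerivAt_canalSurface_fst p) (hasDerivAt_canalSurface_snd c r p)]
  module

theorem cross_meridianTangent_circleTangent (h : IsRegularCanal c r) (p : ℝ × ℝ) :
    cross (meridianTangent c r p) (circleTangent c p) = sphereNormal c r p := by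
  have hframe := h.isMovingFrame
  simp only [meridianTangent, circleTangent, sphereNormal, cross_add_left, cross_add_right,
    cross_smul_left, cross_smul_right, cross_self_eq_zero, hframe.cross_TN, hframe.cross_NB,
    ← neg_cross_eq_cross_swap (frenetB c p.1) (frenetT c p.1),
    ← neg_cross_eq_cross_swap (frenetN c p.1) (frenetB c p.1), hframe.cross_BT]
  match_scalars
  · ring
  · linear_combination canalCos c r p.1 * Real.sin_sq_add_cos_sq p.2
  · ring

theorem inner_circleTangent_self (h : IsRegularCanal c r) (p : ℝ × ℝ) :
    inner ℝ (circleTangent c p) (circleTangent c p) = 1 := by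
  have hframe := h.isMovingFrame
  simp only [circleTangent, inner_add_left, inner_add_right, real_inner_smul_left,
    real_inner_smul_right, hframe.inner_NN, hframe.inner_BB, hframe.inner_NB,
    real_inner_comm (frenetN c p.1) (frenetB c p.1)]
  linear_combination Real.sin_sq_add_cos_sq p.2

theorem inner_meridianTangent_self (h : IsRegularCanal c r) (p : ℝ × ℝ) :
    inner ℝ (meridianTangent c r p) (meridianTangent c r p) = 1 := by
  have hframe := h.isMovingFrame
  simp only [meridianTangent, inner_add_left, inner_add_right, real_inner_smul_left,
    real_inner_smul_right, hframe.inner_NN, hframe.inner_TT, hframe.inner_BB, hframe.inner_BT,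
    hframe.inner_NT, hframe.inner_NB, real_inner_comm (frenetN c p.1) (frenetB c p.1),
    real_inner_comm (frenetN c p.1) (frenetT c p.1),
    real_inner_comm (frenetB c p.1) (frenetT c p.1)]
  linear_combination h.canalSin_sq p.1 + canalCos c r p.1 ^ 2 * Real.sin_sq_add_cos_sq p.2

theorem inner_meridianTangent_circleTangent (h : IsRegularCanal c r) (p : ℝ × ℝ) :
    inner ℝ (meridianTangent c r p) (circleTangent c p) = 0 := by
  have hframe := h.isMovingFrame
  simp only [meridianTangent, circleTangent, inner_add_left, inner_add_right,
    real_inner_smul_left, real_inner_smul_right, hframe.inner_NN, hframe.inner_BB,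
    hframe.inner_NT, hframe.inner_NB, hframe.inner_BT,
    real_inner_comm (frenetN c p.1) (frenetB c p.1),
    real_inner_comm (frenetN c p.1) (frenetT c p.1),
    real_inner_comm (frenetB c p.1) (frenetT c p.1)]
  ring

theorem norm_sphereNormal (h : IsRegularCanal c r) (p : ℝ × ℝ) : ‖sphereNormal c r p‖ = 1 := by
  rw [← sq_eq_sq₀ (norm_nonneg _) zero_le_one, ← real_inner_self_eq_norm_sq,
    ← h.cross_meridianTangent_circleTangent, inner_cross_cross, h.inner_meridianTangent_self,
    h.inner_circleTangent_self, h.inner_meridianTangent_circleTangent]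
  norm_num

theorem smul_add_smul_eq_zero (h : IsRegularCanal c r) {p : ℝ × ℝ} {a b : ℝ} :
    a • meridianTangent c r p + b • circleTangent c p = 0 ↔ a = 0 ∧ b = 0 := by
  refine ⟨fun hzero => ⟨?_, ?_⟩, fun ⟨ha, hb⟩ => by rw [ha, hb, zero_smul, zero_smul, add_zero]⟩
  · have hinner := congrArg (inner ℝ (meridianTangent c r p)) hzero
    rwa [inner_add_right, real_inner_smul_right, real_inner_smul_right,
      h.inner_meridianTangent_self, h.inner_meridianTangent_circleTangent, mul_one, mul_zero,
      add_zero, inner_zero_right] at hinner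
  · have hinner := congrArg (fun z => inner ℝ z (circleTangent c p)) hzero
    beta_reduce at hinner
    rwa [inner_add_left, real_inner_smul_left, real_inner_smul_left, h.inner_circleTangent_self,
      h.inner_meridianTangent_circleTangent, mul_one, mul_zero, zero_add,
      inner_zero_left] at hinner

theorem unitNormal_eq (h : IsRegularCanal c r) :
    unitNormal (canalSurface c r) = fun p => -sphereNormal c r p := by
  funext p
  have hcross : cross (fderiv ℝ (canalSurface c r) p (1, 0)) (fderiv ℝ (canalSurface c r) p (0, 1))
      = (meridianSpeed c r p * (r p.1 * canalSin c r p.1)) • sphereNormal c r p := by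
    rw [h.fderiv_canalSurface, h.fderiv_canalSurface, ← h.cross_meridianTangent_circleTangent]
    simp only [cross_add_left, cross_add_right, cross_smul_left, cross_smul_right,
      cross_self_eq_zero]
    module
  have hneg : meridianSpeed c r p * (r p.1 * canalSin c r p.1) < 0 :=
    mul_neg_of_neg_of_pos (h.meridianSpeed_neg p) (mul_pos (h.r_pos p.1) (h.canalSin_pos p.1))
  rw [unitNormal, hcross, norm_smul, h.norm_sphereNormal, mul_one, smul_smul, Real.norm_eq_abs,
    abs_of_neg hneg, inv_neg, neg_mul, inv_mul_cancel₀ hneg.ne, neg_one_smul]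

theorem isSmoothImmersion (h : IsRegularCanal c r) : IsSmoothImmersion (canalSurface c r) := by
  refine ⟨h.contDiff_canalSurface, fun p => (injective_iff_map_eq_zero _).2 fun v hv => ?_⟩
  rw [h.fderiv_canalSurface, h.smul_add_smul_eq_zero] at hv
  obtain ⟨hmeridian, hcircle⟩ := hv
  have hfst : v.1 = 0 := (mul_eq_zero.1 hmeridian).resolve_right (h.meridianSpeed_neg p).ne
  rw [hfst, zero_mul, zero_add] at hcircle
  exact Prod.ext hfst ((mul_eq_zero.1 ((mul_eq_zero.1 hcircle).resolve_left
    (h.r_pos p.1).ne')).resolve_right (h.canalSin_pos p.1).ne')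

theorem isPrincipalDirection_iff (h : IsRegularCanal c r) {p v : ℝ × ℝ} {k : ℝ} :
    IsPrincipalDirection (canalSurface c r) p v k ↔ v ≠ 0 ∧
      v.1 * (k * meridianSpeed c r p - normalTurning c r p) = 0 ∧
      (v.1 * circleTurning c r p + v.2 * canalSin c r p.1) * (k * r p.1 - 1) = 0 := by
  rw [IsPrincipalDirection, h.unitNormal_eq, fderiv_fun_neg, neg_apply,
    h.fderiv_sphereNormal, h.fderiv_canalSurface, ← h.smul_add_smul_eq_zero (p := p)]
  refine and_congr_right fun _ => Eq.congr ?_ rfl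
  module

theorem meridianCurvature_mul_lt_one (h : IsRegularCanal c r) (p : ℝ × ℝ) :
    meridianCurvature c r p * r p.1 < 1 := by
  have hpos := mul_pos (h.speed_pos p.1) (h.canalSin_pos p.1)
  rw [meridianCurvature, div_mul_eq_mul_div, div_lt_one_of_neg (h.meridianSpeed_neg p),
    meridianSpeed]
  linarith

theorem isPrincipalDirection_iff_of_fst_ne_zero (h : IsRegularCanal c r) {p v : ℝ × ℝ} {k : ℝ}
    (hv : v.1 ≠ 0) :
    IsPrincipalDirection (canalSurface c r) p v k ↔ k = meridianCurvature c r p ∧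
      v.1 * circleTurning c r p + v.2 * canalSin c r p.1 = 0 := by
  have hv' : v ≠ 0 := fun hzero => hv (congrArg Prod.fst hzero)
  have hk : k * meridianSpeed c r p - normalTurning c r p = 0 ↔ k = meridianCurvature c r p := by
    rw [meridianCurvature, eq_div_iff (h.meridianSpeed_neg p).ne, sub_eq_zero]
  simp only [h.isPrincipalDirection_iff, hv', hv, mul_eq_zero, hk, false_or, ne_eq,
    not_false_eq_true, true_and]
  refine and_congr_right fun hk => or_iff_left ?_
  rw [hk]
  exact (sub_neg.2 (h.meridianCurvature_mul_lt_one p)).ne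

theorem isPrincipalDirection_iff_of_fst_eq_zero (h : IsRegularCanal c r) {p v : ℝ × ℝ} {k : ℝ}
    (hv : v.1 = 0) :
    IsPrincipalDirection (canalSurface c r) p v k ↔ v ≠ 0 ∧ k * r p.1 = 1 := by
  rw [h.isPrincipalDirection_iff, hv]
  refine and_congr_right fun hne => ?_
  have hsnd : v.2 ≠ 0 := fun hsnd => hne (Prod.ext hv hsnd)
  simp [hsnd, (h.canalSin_pos p.1).ne', sub_eq_zero]

theorem not_isUmbilic (h : IsRegularCanal c r) (p : ℝ × ℝ) :
    ¬ IsUmbilic (canalSurface c r) p := by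
  rintro ⟨k, hk⟩
  have hcircle := ((h.isPrincipalDirection_iff_of_fst_eq_zero rfl).1 (hk (0, 1) (by simp))).2
  have hmeridian := ((h.isPrincipalDirection_iff_of_fst_ne_zero one_ne_zero).1
    (hk (1, 0) (by simp))).1
  exact (h.meridianCurvature_mul_lt_one p).ne (hmeridian ▸ hcircle)

theorem mul_circleTurning_add_eq_zero_iff (h : IsRegularCanal c r) {p v : ℝ × ℝ} :
    v.1 * circleTurning c r p + v.2 * canalSin c r p.1 = 0 ↔
      v.2 = (-twisting c p.1 + forcing c r p.1 * Real.sin p.2) * v.1 := by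
  have hne := (h.canalSin_pos p.1).ne'
  rw [← mul_right_inj' hne, circleTurning, forcing]
  field_simp
  constructor <;> intro heq <;> linear_combination heq

theorem hasMinimalFoliation (h : IsRegularCanal c r) :
    HasMinimalFoliation (canalSurface c r) (fun t => -twisting c t) (forcing c r) := by
  intro p v
  have hlt {k : ℝ} (hk : k * r p.1 = 1) : meridianCurvature c r p < k :=
    lt_of_mul_lt_mul_right (hk ▸ h.meridianCurvature_mul_lt_one p) (h.r_pos p.1).le
  have hattained : IsPrincipalCurvature (canalSurface c r) p (meridianCurvature c r p) :=
    ⟨(1, _), (h.isPrincipalDirection_iff_of_fst_ne_zero one_ne_zero).2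
      ⟨rfl, h.mul_circleTurning_add_eq_zero_iff.2 (mul_one _).symm⟩⟩
  rw [← h.mul_circleTurning_add_eq_zero_iff]
  constructor
  · rintro ⟨k, hv, hmin⟩
    by_cases hfst : v.1 = 0
    · have hk := ((h.isPrincipalDirection_iff_of_fst_eq_zero hfst).1 hv).2
      exact absurd (hmin _ hattained) (hlt hk).not_ge
    · exact ⟨hfst, ((h.isPrincipalDirection_iff_of_fst_ne_zero hfst).1 hv).2⟩
  · rintro ⟨hfst, hv⟩
    refine ⟨_, (h.isPrincipalDirection_iff_of_fst_ne_zero hfst).2 ⟨rfl, hv⟩, ?_⟩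
    rintro k' ⟨w, hw⟩
    by_cases hw₁ : w.1 = 0
    · exact (hlt ((h.isPrincipalDirection_iff_of_fst_eq_zero hw₁).1 hw).2).le
    · exact ((h.isPrincipalDirection_iff_of_fst_ne_zero hw₁).1 hw).1.ge

theorem two_hyperbolic_cycles (h : IsRegularCanal c r) (hc : Function.Periodic c (2 * Real.pi))
    (hr : Function.Periodic r (2 * Real.pi)) {φ : ℝ → ℝ}
    (hφ : IsHyperbolicSolution (fun t => -twisting c t) (forcing c r) φ) :
    {C | IsPrincipalCycle (canalSurface c r) C}.ncard = 2 ∧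
      ∀ C, IsPrincipalCycle (canalSurface c r) C →
        IsHyperbolicPrincipalCycle (canalSurface c r) C :=
  hφ.two_hyperbolic_cycles h.contDiff_forcing (forcing_periodic hc hr) h.hasMinimalFoliation

theorem one_double_cycle (h : IsRegularCanal c r) (hc : Function.Periodic c (2 * Real.pi))
    (hr : Function.Periodic r (2 * Real.pi)) {φ : ℝ → ℝ}
    (hφ : IsDoubleSolution (fun t => -twisting c t) (forcing c r) φ) :
    {C | IsPrincipalCycle (canalSurface c r) C}.ncard = 1 ∧
      ∀ C, IsPrincipalCycle (canalSurface c r) C → IsDoublePrincipalCycle (canalSurface c r) C :=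
  hφ.one_double_cycle h.contDiff_forcing (forcing_periodic hc hr) h.hasMinimalFoliation

end IsRegularCanal

/-! ### Global solutions -/

theorem exists_hasDerivAt_of_lipschitzWith_of_bounded {E : Type*} [NormedAddCommGroup E]
    [NormedSpace ℝ E] [CompleteSpace E] {v : ℝ → E → E} {K L : NNReal}
    (hK : ∀ t, LipschitzWith K (v t)) (hcont : ∀ x, Continuous fun t => v t x)
    (hL : ∀ t x, ‖v t x‖ ≤ L) (x : E) :
    ∃ f : ℝ → E, f 0 = x ∧ ∀ t, HasDerivAt f (v t (f t)) t := by
  have hlocal (n : ℕ) : ∃ f : ℝ → E, f 0 = x ∧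
      ∀ t ∈ Ioo (-n : ℝ) n, HasDerivAt f (v t (f t)) t := by
    have hpl : IsPicardLindelof v (tmin := -n) (tmax := n) ⟨0, by simp⟩ x (L * n) 0 L K :=
      ⟨fun t _ => (hK t).lipschitzOnWith, fun x _ => (hcont x).continuousOn,
        fun t _ x _ => hL t x, by simp⟩
    obtain ⟨f, hf₀, hf⟩ := hpl.exists_eq_forall_mem_Icc_hasDerivWithinAt₀
    exact ⟨f, hf₀, fun t ht => (hf t (Ioo_subset_Icc_self ht)).hasDerivAt (Icc_mem_nhds ht.1 ht.2)⟩
  choose f hf₀ hf using hlocal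
  have hagree {m n : ℕ} (hm : 0 < m) (hmn : m ≤ n) : EqOn (f m) (f n) (Ioo (-m : ℝ) m) := by
    have hsub : Ioo (-m : ℝ) m ⊆ Ioo (-n : ℝ) n := Ioo_subset_Ioo (by gcongr) (by gcongr)
    exact ODE_solution_unique_of_mem_Ioo (t₀ := 0) (fun t _ => (hK t).lipschitzOnWith (s := univ))
      (by simpa using hm) (fun t ht => ⟨hf m t ht, mem_univ _⟩)
      (fun t ht => ⟨hf n t (hsub ht), mem_univ _⟩) ((hf₀ m).trans (hf₀ n).symm)
  have hmem (t : ℝ) : t ∈ Ioo (-(⌊|t|⌋₊ + 1 : ℕ) : ℝ) (⌊|t|⌋₊ + 1 : ℕ) :=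
    abs_lt.1 (mod_cast Nat.lt_floor_add_one |t|)
  refine ⟨fun t => f (⌊|t|⌋₊ + 1) t, hf₀ _, fun t => ?_⟩
  have hglue {N : ℕ} : EqOn (fun t => f (⌊|t|⌋₊ + 1) t) (f N) (Ioo (-N : ℝ) N) := fun s hs => by
    have hfloor : ⌊|s|⌋₊ + 1 ≤ N := (Nat.floor_lt (abs_nonneg s)).2 (abs_lt.2 hs)
    exact hagree (Nat.succ_pos _) hfloor (hmem s)
  exact (hf _ t (hmem t)).congr_of_eventuallyEq
    (hglue.eventuallyEq_of_mem (Ioo_mem_nhds (hmem t).1 (hmem t).2))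

theorem exists_nnreal_norm_le_of_periodic {f : ℝ → ℝ} {p : ℝ} (hp : p ≠ 0) (hf : Continuous f)
    (hfp : Function.Periodic f p) : ∃ C : NNReal, ∀ t, ‖f t‖ ≤ C := by
  obtain ⟨C, hC⟩ := (hfp.isBounded_of_continuous hp hf).exists_norm_le
  exact ⟨C.toNNReal, fun t => (hC _ (mem_range_self t)).trans (Real.le_coe_toNNReal C)⟩

section Existence

variable {A B φ : ℝ → ℝ}

theorem lipschitzWith_field {C : NNReal} (hC : ∀ t, ‖B t‖ ≤ C) (t : ℝ) :
    LipschitzWith C fun x => A t + B t * Real.sin x :=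
  LipschitzWith.of_dist_le_mul fun x y => by
    rw [dist_add_left, Real.dist_eq, ← mul_sub, abs_mul]
    exact mul_le_mul (hC t) (Real.abs_sin_sub_sin_le x y) (abs_nonneg _) C.2

theorem isSolution_of_hasDerivAt (hA : ContDiff ℝ ∞ A) (hB : ContDiff ℝ ∞ B)
    (h : ∀ t, HasDerivAt φ (A t + B t * Real.sin (φ t)) t) : IsSolution A B φ where
  smooth := contDiff_infty_of_hasDerivAt h fun _ hφ =>
    (hA.of_le (mod_cast le_top)).add ((hB.of_le (mod_cast le_top)).mul hφ.sin)
  hasDerivAt := h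

theorem exists_isSolution (hA : ContDiff ℝ ∞ A) (hB : ContDiff ℝ ∞ B)
    (hAp : Function.Periodic A (2 * Real.pi)) (hBp : Function.Periodic B (2 * Real.pi)) (x : ℝ) :
    ∃ φ, IsSolution A B φ ∧ φ 0 = x := by
  obtain ⟨CA, hCA⟩ := exists_nnreal_norm_le_of_periodic Real.two_pi_pos.ne' hA.continuous hAp
  obtain ⟨CB, hCB⟩ := exists_nnreal_norm_le_of_periodic Real.two_pi_pos.ne' hB.continuous hBp
  have hbound (t x : ℝ) : ‖A t + B t * Real.sin x‖ ≤ (CA + CB : NNReal) := by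
    refine norm_add_le_of_le (hCA t) ?_
    rw [norm_mul]
    exact (mul_le_of_le_one_right (norm_nonneg _) (Real.abs_sin_le_one x)).trans (hCB t)
  obtain ⟨φ, hφ₀, hφ⟩ := exists_hasDerivAt_of_lipschitzWith_of_bounded (lipschitzWith_field hCB)
    (fun x => hA.continuous.add (hB.continuous.mul_const (Real.sin x))) hbound x
  exact ⟨φ, isSolution_of_hasDerivAt hA hB hφ, hφ₀⟩

theorem IsSolution.isClosedSolution (h : IsSolution A B φ) (hB : Continuous B)
    (hAp : Function.Periodic A (2 * Real.pi)) (hBp : Function.Periodic B (2 * Real.pi)) {k : ℤ}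
    (hk : φ (2 * Real.pi) = φ 0 + 2 * Real.pi * k) : IsClosedSolution A B φ where
  toIsSolution := h
  periodic := by
    obtain ⟨C, hC⟩ := exists_nnreal_norm_le_of_periodic Real.two_pi_pos.ne' hB hBp
    refine ⟨k, fun t => congrFun (ODE_solution_unique_univ (t₀ := 0)
      (f := fun t => φ (t + 2 * Real.pi)) (g := fun t => φ t + 2 * Real.pi * k)
      (fun t => (lipschitzWith_field (A := A) hC t).lipschitzOnWith (s := univ))
      (fun t => ⟨?_, mem_univ _⟩) (fun t => ⟨?_, mem_univ _⟩) (by simpa using hk)) t⟩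
    · simpa only [hAp t, hBp t] using (h.hasDerivAt (t + 2 * Real.pi)).comp_add_const t _
    · refine ((h.hasDerivAt t).add_const (2 * Real.pi * k)).congr_deriv ?_
      rw [mul_comm _ (k : ℝ), Real.sin_add_int_mul_two_pi]

end Existence

/-! ### Smooth dependence of the monodromy on parameters -/

section Curry

variable {E F : Type u} [NormedAddCommGroup E] [NormedSpace ℝ E] [NormedAddCommGroup F]
  [NormedSpace ℝ F]

/-- A function of a parameter and of time as a function of the parameter with values in the
continuous functions on a compact time interval. -/
def curryIcc (l u : ℝ) (f : E × ℝ → F) (hf : Continuous f) (p : E) : C(Icc l u, F) :=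
  ⟨fun t => f (p, t), by fun_prop⟩

/-- A continuous family of linear maps as one linear map into the continuous functions. -/
noncomputable def familyToLinear (l u : ℝ) :
    C(Icc l u, E →L[ℝ] F) →L[ℝ] E →L[ℝ] C(Icc l u, F) :=
  LinearMap.mkContinuous₂ (LinearMap.mk₂ ℝ
    (fun (g : C(Icc l u, E →L[ℝ] F)) (v : E) => (⟨fun t => g t v, by fun_prop⟩ : C(Icc l u, F)))
    (fun _ _ _ => rfl) (fun _ _ _ => rfl) (fun g v w => by ext t; exact (g t).map_add v w)
    (fun k g v => by ext t; exact (g t).map_smul k v)) 1 (fun g v => by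
      rw [one_mul, LinearMap.mk₂_apply, ContinuousMap.norm_le _ (by positivity)]
      exact fun t => (g t).le_of_opNorm_le (g.norm_coe_le_norm t) v)

/-- The partial derivative with respect to the parameter. -/
noncomputable def parameterFDeriv (f : E × ℝ → F) (z : E × ℝ) : E →L[ℝ] F :=
  (fderiv ℝ f z).comp (ContinuousLinearMap.inl ℝ E ℝ)

theorem contDiff_parameterFDeriv {f : E × ℝ → F} (hf : ContDiff ℝ ∞ f) :
    ContDiff ℝ ∞ (parameterFDeriv f) :=
  (hf.fderiv_right (m := ∞) (by simp)).clm_comp contDiff_const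

theorem hasFDerivAt_curryIcc {f : E × ℝ → F} (l u : ℝ) (hf : ContDiff ℝ ∞ f) (p : E) :
    HasFDerivAt (curryIcc l u f hf.continuous) (familyToLinear l u
      (curryIcc l u (parameterFDeriv f) (contDiff_parameterFDeriv hf).continuous p)) p := by
  have hf' := (contDiff_parameterFDeriv hf).continuous
  refine HasFDerivAt.of_isLittleO (isLittleO_iff.2 fun ε hε => ?_)
  have huniform := (isCompact_Icc (a := l) (b := u)).eventually_forall_of_forall_eventually
    (x₀ := p) (P := fun q t => ‖parameterFDeriv f (q, t) - parameterFDeriv f (p, t)‖ < ε)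
    fun t _ => by
      have hcont : Continuous fun z : E × ℝ =>
          ‖parameterFDeriv f (z.1, z.2) - parameterFDeriv f (p, z.2)‖ := by fun_prop
      exact hcont.continuousAt.eventually_lt continuousAt_const (by simpa using hε)
  obtain ⟨δ, hδ, hball⟩ := Metric.eventually_nhds_iff_ball.1 huniform
  filter_upwards [Metric.ball_mem_nhds p hδ] with q hq
  rw [ContinuousMap.norm_le _ (by positivity)]
  intro t
  have hderiv : ∀ x ∈ Metric.ball p δ, HasFDerivWithinAt (fun x => f (x, (t : ℝ)))
      (parameterFDeriv f (x, t)) (Metric.ball p δ) x := fun x _ =>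
    ((hf.differentiable (by simp) (x, (t : ℝ))).hasFDerivAt.comp x
      (hasFDerivAt_prodMk_left x (t : ℝ))).hasFDerivWithinAt
  exact (convex_ball p δ).norm_image_sub_le_of_norm_hasFDerivWithin_le' hderiv
    (fun x hx => (hball x hx t t.2).le) (Metric.mem_ball_self hδ) hq

end Curry

theorem contDiff_curryIcc {E F : Type u} [NormedAddCommGroup E] [NormedSpace ℝ E]
    [NormedAddCommGroup F] [NormedSpace ℝ F] (l u : ℝ) {f : E × ℝ → F} (hf : ContDiff ℝ ∞ f) :
    ContDiff ℝ ∞ (curryIcc l u f hf.continuous) := by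
  refine contDiff_infty.2 fun n => ?_
  induction n generalizing F with
  | zero => exact contDiff_zero.2 (continuous_iff_continuousAt.2 fun p =>
      (hasFDerivAt_curryIcc l u hf p).continuousAt)
  | succ n ih =>
    push_cast
    have hlinear : ContDiff ℝ n fun g => familyToLinear (E := E) (F := F) l u g := by fun_prop
    exact (contDiff_succ_iff_hasFDerivAt (n := n)).2
      ⟨_, hlinear.comp (ih (contDiff_parameterFDeriv hf)), hasFDerivAt_curryIcc l u hf⟩

section Volterra

variable {F : Type*} [NormedAddCommGroup F] [NormedSpace ℝ F] [CompleteSpace F] {T : ℝ}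

theorem hasDerivAt_integral_IccExtend (hT : 0 ≤ T) (g : C(Icc 0 T, F)) (t : ℝ) :
    HasDerivAt (fun t => ∫ s in (0 : ℝ)..t, IccExtend hT g s) (IccExtend hT g t) t :=
  (g.continuous.Icc_extend'.integral_hasStrictDerivAt 0 t).hasDerivAt

/-- The Volterra operator: integration from `0`. -/
noncomputable def volterra (F : Type*) [NormedAddCommGroup F] [NormedSpace ℝ F] [CompleteSpace F]
    (hT : 0 ≤ T) : C(Icc 0 T, F) →L[ℝ] C(Icc 0 T, F) :=
  LinearMap.mkContinuous
    { toFun := fun g => ⟨fun t => ∫ s in (0 : ℝ)..t, IccExtend hT g s,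
        (continuous_iff_continuousAt.2 fun t =>
          (hasDerivAt_integral_IccExtend hT g t).continuousAt).comp continuous_subtype_val⟩
      map_add' := fun f g => by
        ext t
        exact intervalIntegral.integral_add (f.continuous.Icc_extend'.intervalIntegrable _ _)
          (g.continuous.Icc_extend'.intervalIntegrable _ _)
      map_smul' := fun k f => by
        ext t
        exact intervalIntegral.integral_smul k (IccExtend hT f) } T (fun g => by
    rw [ContinuousMap.norm_le _ (by positivity)]
    intro t
    have hintegral : ‖∫ s in (0 : ℝ)..t, IccExtend hT g s‖ ≤ ‖g‖ * |(t : ℝ) - 0| :=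
      intervalIntegral.norm_integral_le_of_norm_le_const fun s _ => g.norm_coe_le_norm _
    refine hintegral.trans ?_
    rw [mul_comm, sub_zero, abs_of_nonneg t.2.1]
    exact mul_le_mul_of_nonneg_right t.2.2 (norm_nonneg _))

end Volterra

/-- `M` is the value at `T` of the solution of the linear equation `Y' = L Y` with `Y 0 = 1`. -/
def IsMonodromy {R : Type*} [NormedRing R] [NormedAlgebra ℝ R] (L : ℝ → R) (T : ℝ) (M : R) :
    Prop :=
  ∃ Y : ℝ → R, Y 0 = 1 ∧ Y T = M ∧ ∀ t ∈ Icc 0 T, HasDerivAt Y (L t * Y t) t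

section Monodromy

theorem IsMonodromy.eq_mul {R : Type*} [NormedRing R] [NormedAlgebra ℝ R] {L : ℝ → R} {T : ℝ}
    {M : R} (h : IsMonodromy L T M) (hT : 0 ≤ T) (hL : Continuous L) {Z : ℝ → R}
    (hZ : ∀ t, HasDerivAt Z (L t * Z t) t) : Z T = M * Z 0 := by
  obtain ⟨Y, hY₀, rfl, hY⟩ := h
  obtain ⟨K, hK⟩ := (isCompact_Icc (a := 0) (b := T)).exists_bound_of_continuousOn hL.continuousOn
  have hYZ : ∀ t ∈ Icc 0 T, HasDerivAt (fun t => Y t * Z 0) (L t * (Y t * Z 0)) t := fun t ht =>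
    ((hY t ht).mul_const (Z 0)).congr_deriv (mul_assoc _ _ _)
  refine ODE_solution_unique_of_mem_Icc_right (v := fun t y => L t * y) (s := fun _ => univ)
    (g := fun t => Y t * Z 0) (K := K.toNNReal) (fun t ht => LipschitzWith.lipschitzOnWith
      (LipschitzWith.of_dist_le_mul fun x y => ?_)) ?_ ?_ (fun _ _ => mem_univ _) ?_ ?_
    (fun _ _ => mem_univ _) (by simp only [hY₀, one_mul]) (right_mem_Icc.2 hT)
  · rw [dist_eq_norm, dist_eq_norm, ← mul_sub]
    refine (norm_mul_le _ _).trans (mul_le_mul_of_nonneg_right ?_ (norm_nonneg _))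
    exact (hK t (Ico_subset_Icc_self ht)).trans (Real.le_coe_toNNReal K)
  · exact fun t _ => (hZ t).continuousAt.continuousWithinAt
  · exact fun t _ => (hZ t).hasDerivWithinAt
  · exact fun t ht => (hYZ t ht).continuousAt.continuousWithinAt
  · exact fun t ht => (hYZ t (Ico_subset_Icc_self ht)).hasDerivWithinAt

theorem isMonodromy_of_eq_add_volterra {R : Type*} [NormedRing R] [NormedAlgebra ℝ R]
    [CompleteSpace R] {T : ℝ} (hT : 0 ≤ T) {L : ℝ → R} {μ : ℝ} {a y : C(Icc 0 T, R)}
    (ha : ∀ t : Icc 0 T, L t = μ • a t) (hy : y = 1 + μ • volterra R hT (a * y)) :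
    IsMonodromy L T (1 + μ • volterra R hT (a * y) ⟨T, hT, le_rfl⟩) := by
  refine ⟨fun t => 1 + μ • ∫ s in (0 : ℝ)..t, IccExtend hT (a * y) s, by simp, rfl, fun t ht => ?_⟩
  refine (((hasDerivAt_integral_IccExtend hT (a * y) t).const_smul μ).const_add 1).congr_deriv ?_
  have hyt : y ⟨t, ht⟩ = 1 + μ • ∫ s in (0 : ℝ)..t, IccExtend hT (a * y) s :=
    DFunLike.congr_fun hy ⟨t, ht⟩
  simp only [← hyt]
  rw [ha ⟨t, ht⟩, IccExtend_of_mem _ _ ht, ContinuousMap.mul_apply, smul_mul_assoc]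

theorem exists_resolvent {E X : Type*} [NormedAddCommGroup E] [NormedSpace ℝ E] [NormedRing X]
    [NormedAlgebra ℝ X] [CompleteSpace X] (V : X →L[ℝ] X) {a : E → X} (ha : ContDiff ℝ ∞ a)
    {m : E → ℝ} (hm : ContDiff ℝ ∞ m) :
    ∃ (D : Set E) (y : E → X), IsOpen D ∧ ContDiffOn ℝ ∞ y D ∧ (∀ p, m p = 0 → p ∈ D ∧ y p = 1) ∧
      ∀ p ∈ D, y p = 1 + m p • V (a p * y p) := by
  let S (p : E) : X →L[ℝ] X := 1 - m p • V.comp (ContinuousLinearMap.mul ℝ X (a p))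
  have hS : ContDiff ℝ ∞ S := contDiff_const.sub
    (hm.smul (contDiff_const.clm_comp ((ContinuousLinearMap.contDiff _).comp ha)))
  have hzero (p : E) (hp : m p = 0) : S p = 1 := by ext; simp [S, hp]
  refine ⟨{p | IsUnit (S p)}, fun p => Ring.inverse (S p) 1, Units.isOpen.preimage hS.continuous,
    fun p hp => ?_, fun p hp => by simp [hzero p hp], fun p hp => ?_⟩
  · obtain ⟨w, hw⟩ := (hp : IsUnit (S p))
    have hinverse : ContDiffAt ℝ ∞ Ring.inverse (S p) := hw ▸ contDiffAt_ringInverse ℝ w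
    exact ((hinverse.comp p hS.contDiffAt).clm_apply contDiffAt_const).contDiffWithinAt
  · have hsolve : S p (Ring.inverse (S p) 1) = 1 :=
      congrArg (fun P : X →L[ℝ] X => P 1) (Ring.mul_inverse_cancel (S p) hp)
    exact sub_eq_iff_eq_add.1 hsolve

theorem exists_smooth_monodromy {E R : Type u} [NormedAddCommGroup E] [NormedSpace ℝ E]
    [NormedRing R] [NormedAlgebra ℝ R] [CompleteSpace R] {A : E × ℝ → R} (hA : ContDiff ℝ ∞ A)
    {m : E → ℝ} (hm : ContDiff ℝ ∞ m) {T : ℝ} (hT : 0 ≤ T) :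
    ∃ (D : Set E) (Q : E → R), IsOpen D ∧ ContDiffOn ℝ ∞ Q D ∧
      (∀ p, m p = 0 → p ∈ D ∧ Q p = ∫ t in (0 : ℝ)..T, A (p, t)) ∧
      ∀ p ∈ D, IsMonodromy (fun t => m p • A (p, t)) T (1 + m p • Q p) := by
  have ha := contDiff_curryIcc 0 T hA
  obtain ⟨D, y, hD, hy, hy₀, hsolve⟩ := exists_resolvent (volterra R hT) ha hm
  let endpoint : Icc 0 T := ⟨T, hT, le_rfl⟩
  refine ⟨D, fun p => volterra R hT (curryIcc 0 T A hA.continuous p * y p) endpoint, hD,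
    ((ContinuousMap.evalCLM ℝ endpoint).comp (volterra R hT)).contDiff.comp_contDiffOn
      (ha.contDiffOn.mul hy), fun p hp => ⟨(hy₀ p hp).1, ?_⟩,
    fun p hp => isMonodromy_of_eq_add_volterra hT (fun _ => rfl) (hsolve p hp)⟩
  simp only [(hy₀ p hp).2, mul_one]
  refine intervalIntegral.integral_congr fun t ht => ?_
  rw [uIcc_of_le hT] at ht
  exact IccExtend_of_mem _ _ ht

end Monodromy

/-! ### Closed solutions from the monodromy -/

section LinearSystem

attribute [local instance] Matrix.linftyOpNormedRing Matrix.linftyOpNormedAlgebra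

variable {A B φ : ℝ → ℝ} {M : Matrix (Fin 2) (Fin 2) ℝ}

/-- The coefficient matrix of the linear system whose directions turn at half the rate of
`φ' = a + b sin φ`. -/
noncomputable def systemMatrix (a b : ℝ) : Matrix (Fin 2) (Fin 2) ℝ :=
  !![-b / 2, -a / 2; a / 2, b / 2]

/-- Rotation of the plane by the angle `θ`. -/
noncomputable def rotationMatrix (θ : ℝ) : Matrix (Fin 2) (Fin 2) ℝ :=
  !![Real.cos θ, -Real.sin θ; Real.sin θ, Real.cos θ]

/-- The fundamental solution of the linear system, in the frame turning with `φ`. -/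
noncomputable def triangularMatrix (B φ : ℝ → ℝ) (t : ℝ) : Matrix (Fin 2) (Fin 2) ℝ :=
  !![Real.exp (-(logMultiplier B φ t / 2)), Real.exp (-(logMultiplier B φ t / 2)) * shift B φ t;
    0, Real.exp (logMultiplier B φ t / 2)]

/-- The fundamental solution of the linear system obtained from a solution `φ`. -/
noncomputable def fundamentalMatrix (B φ : ℝ → ℝ) (t : ℝ) : Matrix (Fin 2) (Fin 2) ℝ :=
  rotationMatrix (φ t / 2) * triangularMatrix B φ t

theorem hasDerivAt_matrix {Y : ℝ → Matrix (Fin 2) (Fin 2) ℝ} {Y' : Matrix (Fin 2) (Fin 2) ℝ}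
    {t : ℝ} (h : ∀ i j, HasDerivAt (fun t => Y t i j) (Y' i j) t) : HasDerivAt Y Y' t :=
  hasDerivAt_pi.2 fun i => hasDerivAt_pi.2 fun j => h i j

theorem continuous_systemMatrix (hA : Continuous A) (hB : Continuous B) :
    Continuous fun t => systemMatrix (A t) (B t) := by
  refine continuous_matrix fun i j => ?_
  fin_cases i <;> fin_cases j
  exacts [hB.neg.div_const 2, hA.neg.div_const 2, hA.div_const 2, hB.div_const 2]

theorem hasDerivAt_rotationMatrix {θ : ℝ → ℝ} {θ' t : ℝ} (h : HasDerivAt θ θ' t) :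
    HasDerivAt (fun t => rotationMatrix (θ t)) (rotationMatrix (θ t) * !![0, -θ'; θ', 0]) t := by
  refine hasDerivAt_matrix fun i j => ?_
  simp only [rotationMatrix, Matrix.mul_fin_two]
  fin_cases i <;> fin_cases j
  · simpa using h.cos
  · simpa using h.sin.fun_neg
  · simpa using h.sin
  · simpa using h.cos

theorem IsSolution.hasDerivAt_triangularMatrix (h : IsSolution A B φ) (hB : Continuous B) (t : ℝ) :
    HasDerivAt (triangularMatrix B φ)
      (!![-(B t * Real.cos (φ t)) / 2, B t * Real.sin (φ t); 0, B t * Real.cos (φ t) / 2] *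
        triangularMatrix B φ t) t := by
  have hI := (h.hasDerivAt_logMultiplier hB t).div_const 2
  have hJ := h.hasDerivAt_shift hB t
  have hexp : Real.exp (-(logMultiplier B φ t / 2)) * Real.exp (logMultiplier B φ t)
      = Real.exp (logMultiplier B φ t / 2) := by
    rw [← Real.exp_add]
    ring_nf
  refine hasDerivAt_matrix fun i j => ?_
  simp only [triangularMatrix, Matrix.mul_fin_two]
  fin_cases i <;> fin_cases j
  · exact hI.neg.exp.congr_deriv (by simp; ring)
  · exact (hI.neg.exp.mul hJ).congr_deriv (by
      simp
      linear_combination B t * Real.sin (φ t) * hexp)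
  · exact (hasDerivAt_const t (0 : ℝ)).congr_deriv (by simp)
  · exact hI.exp.congr_deriv (by simp; ring)

theorem systemMatrix_mul_rotationMatrix (a b x : ℝ) :
    systemMatrix a b * rotationMatrix (x / 2) = rotationMatrix (x / 2) *
      (!![0, -((a + b * Real.sin x) / 2); (a + b * Real.sin x) / 2, 0] +
        !![-(b * Real.cos x) / 2, b * Real.sin x; 0, b * Real.cos x / 2]) := by
  obtain ⟨y, rfl⟩ : ∃ y, x = 2 * y := ⟨x / 2, by ring⟩
  have hsq := Real.sin_sq_add_cos_sq y
  rw [mul_div_cancel_left₀ y two_ne_zero, Real.sin_two_mul, Real.cos_two_mul']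
  simp only [systemMatrix, rotationMatrix, Matrix.mul_fin_two]
  ext i j
  fin_cases i <;> fin_cases j <;> simp
  · linear_combination (b * Real.cos y / 2) * hsq
  · linear_combination (-b * Real.sin y / 2) * hsq
  · linear_combination (-b * Real.sin y / 2) * hsq
  · linear_combination (-b * Real.cos y / 2) * hsq

theorem IsSolution.hasDerivAt_fundamentalMatrix (h : IsSolution A B φ) (hB : Continuous B)
    (t : ℝ) : HasDerivAt (fundamentalMatrix B φ)
      (systemMatrix (A t) (B t) * fundamentalMatrix B φ t) t := by
  refine ((hasDerivAt_rotationMatrix ((h.hasDerivAt t).div_const 2)).mul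
    (h.hasDerivAt_triangularMatrix hB t)).congr_deriv ?_
  rw [fundamentalMatrix, ← mul_assoc (systemMatrix _ _), systemMatrix_mul_rotationMatrix]
  noncomm_ring

theorem det_rotationMatrix (θ : ℝ) : (rotationMatrix θ).det = 1 := by
  simp [rotationMatrix, Matrix.det_fin_two_of, ← sq]

theorem det_triangularMatrix (t : ℝ) : (triangularMatrix B φ t).det = 1 := by
  rw [triangularMatrix, Matrix.det_fin_two_of, ← Real.exp_add]
  simp

theorem trace_triangularMatrix (t : ℝ) :
    (triangularMatrix B φ t).trace = 2 * Real.cosh (logMultiplier B φ t / 2) := by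
  rw [triangularMatrix, Matrix.trace_fin_two_of, Real.cosh_eq]
  ring

theorem IsMonodromy.mul_rotationMatrix (hM : IsMonodromy (fun t => systemMatrix (A t) (B t))
    (2 * Real.pi) M) (h : IsSolution A B φ) (hA : Continuous A) (hB : Continuous B) :
    M * rotationMatrix (φ 0 / 2)
      = rotationMatrix (φ (2 * Real.pi) / 2) * triangularMatrix B φ (2 * Real.pi) := by
  have hstart : fundamentalMatrix B φ 0 = rotationMatrix (φ 0 / 2) := by
    simp [fundamentalMatrix, triangularMatrix, logMultiplier_zero, shift_zero,
      ← Matrix.one_fin_two]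
  rw [← hstart, ← hM.eq_mul Real.two_pi_pos.le (continuous_systemMatrix hA hB)
    (h.hasDerivAt_fundamentalMatrix hB), fundamentalMatrix]

theorem IsMonodromy.det_eq_one (hM : IsMonodromy (fun t => systemMatrix (A t) (B t))
    (2 * Real.pi) M) (h : IsSolution A B φ) (hA : Continuous A) (hB : Continuous B) :
    M.det = 1 := by
  simpa [Matrix.det_mul, det_rotationMatrix, det_triangularMatrix] using
    congrArg Matrix.det (hM.mul_rotationMatrix h hA hB)

theorem rotationMatrix_add_int_mul_pi (θ : ℝ) (k : ℤ) :
    rotationMatrix (θ + k * Real.pi) = (-1 : ℝ) ^ k • rotationMatrix θ := by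
  simp [rotationMatrix, Real.cos_add_int_mul_pi, Real.sin_add_int_mul_pi]

theorem exists_angle_mulVec_eq_smul (h : 4 * M.det ≤ M.trace ^ 2) :
    ∃ θ c : ℝ, M.mulVec ![Real.cos θ, Real.sin θ] = c • ![Real.cos θ, Real.sin θ] := by
  obtain ⟨c, hc⟩ := exists_quadratic_eq_zero (a := (1 : ℝ)) (b := -M.trace) (c := M.det) one_ne_zero
    ⟨√(M.trace ^ 2 - 4 * M.det), by
      rw [Real.mul_self_sqrt (sub_nonneg.2 h), discrim]
      ring⟩
  obtain ⟨v, hv, hMv⟩ := (Matrix.exists_mulVec_eq_zero_iff (M := M - c • 1)).2 (by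
    rw [Matrix.trace_fin_two, Matrix.det_fin_two] at hc
    simp [Matrix.det_fin_two]
    linear_combination hc)
  let z : ℂ := ⟨v 0, v 1⟩
  have hz : ‖z‖ ≠ 0 := by
    refine norm_ne_zero_iff.2 fun hz => hv (funext fun i => ?_)
    fin_cases i
    · exact congrArg Complex.re hz
    · exact congrArg Complex.im hz
  have hpolar : v = ‖z‖ • ![Real.cos z.arg, Real.sin z.arg] := by
    ext i
    fin_cases i
    · exact (Complex.norm_mul_cos_arg z).symm
    · exact (Complex.norm_mul_sin_arg z).symm
  refine ⟨z.arg, c, smul_right_injective _ hz ?_⟩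
  rw [Matrix.sub_mulVec, Matrix.smul_mulVec, Matrix.one_mulVec, sub_eq_zero] at hMv
  simpa only [← Matrix.mulVec_smul, smul_comm ‖z‖ c, ← hpolar] using hMv

theorem IsMonodromy.mulVec_eq_smul (hM : IsMonodromy (fun t => systemMatrix (A t) (B t))
    (2 * Real.pi) M) (h : IsSolution A B φ) (hA : Continuous A) (hB : Continuous B) :
    M.mulVec ![Real.cos (φ 0 / 2), Real.sin (φ 0 / 2)]
      = Real.exp (-(logMultiplier B φ (2 * Real.pi) / 2)) •
        ![Real.cos (φ (2 * Real.pi) / 2), Real.sin (φ (2 * Real.pi) / 2)] := by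
  ext i
  have hcol := congrFun (congrFun (hM.mul_rotationMatrix h hA hB) i) 0
  fin_cases i <;>
    simpa [Matrix.mul_apply, Fin.sum_univ_two, Matrix.vecHead, Matrix.vecTail, rotationMatrix,
      triangularMatrix, mul_comm (Real.exp _)] using hcol

theorem IsMonodromy.exists_isClosedSolution_of_mulVec_eq_smul
    (hM : IsMonodromy (fun t => systemMatrix (A t) (B t)) (2 * Real.pi) M)
    (hA : ContDiff ℝ ∞ A) (hB : ContDiff ℝ ∞ B)
    (hAp : Function.Periodic A (2 * Real.pi)) (hBp : Function.Periodic B (2 * Real.pi))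
    {θ c : ℝ} (hθ : M.mulVec ![Real.cos θ, Real.sin θ] = c • ![Real.cos θ, Real.sin θ]) :
    ∃ φ, IsClosedSolution A B φ := by
  obtain ⟨φ, hφ, hφ0⟩ := exists_isSolution hA hB hAp hBp (2 * θ)
  have hdir := hM.mulVec_eq_smul hφ hA.continuous hB.continuous
  rw [hφ0, mul_div_cancel_left₀ θ two_ne_zero, hθ] at hdir
  have hcos := congrFun hdir 0
  have hsin := congrFun hdir 1
  simp only [Pi.smul_apply, Matrix.cons_val_zero, Matrix.cons_val_one, smul_eq_mul] at hcos hsin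
  have hparallel : Real.sin (φ (2 * Real.pi) / 2 - θ) = 0 := by
    refine (mul_eq_zero_iff_left
      (Real.exp_pos (-(logMultiplier B φ (2 * Real.pi) / 2))).ne').1 ?_
    rw [Real.sin_sub]
    linear_combination Real.sin θ * hcos - Real.cos θ * hsin
  obtain ⟨k, hk⟩ := Real.sin_eq_zero_iff.1 hparallel
  exact ⟨φ, hφ.isClosedSolution hB.continuous hAp hBp (k := k) (by rw [hφ0]; linarith)⟩

theorem IsMonodromy.exists_sign_mul_rotationMatrix
    (hM : IsMonodromy (fun t => systemMatrix (A t) (B t)) (2 * Real.pi) M)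
    (h : IsClosedSolution A B φ) (hA : Continuous A) (hB : Continuous B) :
    ∃ ε : ℝ, ε ^ 2 = 1 ∧ M * rotationMatrix (φ 0 / 2)
      = ε • (rotationMatrix (φ 0 / 2) * triangularMatrix B φ (2 * Real.pi)) := by
  obtain ⟨k, hk⟩ := h.periodic
  have hhalf : φ (2 * Real.pi) / 2 = φ 0 / 2 + k * Real.pi := by
    linarith [zero_add (2 * Real.pi) ▸ hk 0]
  refine ⟨(-1) ^ k, by rw [← zpow_natCast, ← zpow_mul]; simp [zpow_mul'], ?_⟩
  rw [hM.mul_rotationMatrix h.toIsSolution hA hB, hhalf, rotationMatrix_add_int_mul_pi,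
    Matrix.smul_mul]

theorem isUnit_det_rotationMatrix (θ : ℝ) : IsUnit (rotationMatrix θ).det := by
  simp [det_rotationMatrix]

theorem trace_eq_of_mul_rotationMatrix {U : Matrix (Fin 2) (Fin 2) ℝ} {θ ε : ℝ}
    (h : M * rotationMatrix θ = ε • (rotationMatrix θ * U)) : M.trace = ε * U.trace := by
  have hR := isUnit_det_rotationMatrix θ
  rw [← Matrix.mul_nonsing_inv_cancel_right (rotationMatrix θ) M hR, h, Matrix.smul_mul,
    Matrix.trace_smul, Matrix.trace_mul_comm, Matrix.nonsing_inv_mul_cancel_left _ _ hR,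
    smul_eq_mul]

theorem IsMonodromy.trace_sq (hM : IsMonodromy (fun t => systemMatrix (A t) (B t))
    (2 * Real.pi) M) (h : IsClosedSolution A B φ) (hA : Continuous A) (hB : Continuous B) :
    M.trace ^ 2 = 4 * Real.cosh (logMultiplier B φ (2 * Real.pi) / 2) ^ 2 := by
  obtain ⟨ε, hε, hMε⟩ := hM.exists_sign_mul_rotationMatrix h hA hB
  rw [trace_eq_of_mul_rotationMatrix hMε, trace_triangularMatrix, mul_pow, hε]
  ring

theorem IsMonodromy.logMultiplier_eq_zero_iff
    (hM : IsMonodromy (fun t => systemMatrix (A t) (B t)) (2 * Real.pi) M)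
    (h : IsClosedSolution A B φ) (hA : Continuous A) (hB : Continuous B) :
    logMultiplier B φ (2 * Real.pi) = 0 ↔ M.trace ^ 2 = 4 := by
  rw [hM.trace_sq h hA hB, mul_eq_left₀ four_ne_zero, Real.cosh_sq', add_eq_left,
    sq_eq_zero_iff, Real.sinh_eq_zero, div_eq_zero_iff, or_iff_left two_ne_zero]

theorem IsMonodromy.eq_one_of_shift_eq_zero
    (hM : IsMonodromy (fun t => systemMatrix (A t) (B t)) (2 * Real.pi) M)
    (h : IsClosedSolution A B φ) (hA : Continuous A) (hB : Continuous B) (htr : M.trace = 2)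
    (hI : logMultiplier B φ (2 * Real.pi) = 0) (hJ : shift B φ (2 * Real.pi) = 0) : M = 1 := by
  obtain ⟨ε, -, hMε⟩ := hM.exists_sign_mul_rotationMatrix h hA hB
  have hU : triangularMatrix B φ (2 * Real.pi) = 1 := by
    simp [triangularMatrix, hI, hJ, Matrix.one_fin_two]
  have hε : ε = 1 := by
    have htrace := trace_eq_of_mul_rotationMatrix hMε
    rw [hU, htr, Matrix.trace_one, Fintype.card_fin] at htrace
    push_cast at htrace
    linarith
  rw [hU, hε, one_smul, mul_one] at hMε
  rw [← Matrix.mul_nonsing_inv_cancel_right _ M (isUnit_det_rotationMatrix (φ 0 / 2)), hMε,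
    Matrix.mul_nonsing_inv _ (isUnit_det_rotationMatrix _)]

theorem IsMonodromy.exists_isClosedSolution_of_two_le_trace
    (hM : IsMonodromy (fun t => systemMatrix (A t) (B t)) (2 * Real.pi) M)
    (hA : ContDiff ℝ ∞ A) (hB : ContDiff ℝ ∞ B) (hAp : Function.Periodic A (2 * Real.pi))
    (hBp : Function.Periodic B (2 * Real.pi)) (htr : 2 ≤ M.trace) :
    ∃ φ, IsClosedSolution A B φ := by
  obtain ⟨φ, hφ, -⟩ := exists_isSolution hA hB hAp hBp 0
  have hdet := hM.det_eq_one hφ hA.continuous hB.continuous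
  obtain ⟨θ, c, hθ⟩ := exists_angle_mulVec_eq_smul (M := M) (by rw [hdet]; nlinarith)
  exact hM.exists_isClosedSolution_of_mulVec_eq_smul hA hB hAp hBp hθ

theorem IsMonodromy.exists_isHyperbolicSolution
    (hM : IsMonodromy (fun t => systemMatrix (A t) (B t)) (2 * Real.pi) M)
    (hA : ContDiff ℝ ∞ A) (hB : ContDiff ℝ ∞ B) (hAp : Function.Periodic A (2 * Real.pi))
    (hBp : Function.Periodic B (2 * Real.pi)) (htr : 2 < M.trace) :
    ∃ φ, IsHyperbolicSolution A B φ := by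
  obtain ⟨φ, hφ⟩ := hM.exists_isClosedSolution_of_two_le_trace hA hB hAp hBp htr.le
  exact ⟨φ, hφ, (hM.logMultiplier_eq_zero_iff hφ hA.continuous hB.continuous).not.2 (by nlinarith)⟩

theorem IsMonodromy.exists_isDoubleSolution
    (hM : IsMonodromy (fun t => systemMatrix (A t) (B t)) (2 * Real.pi) M)
    (hA : ContDiff ℝ ∞ A) (hB : ContDiff ℝ ∞ B) (hAp : Function.Periodic A (2 * Real.pi))
    (hBp : Function.Periodic B (2 * Real.pi)) (htr : M.trace = 2) (hne : M ≠ 1) :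
    ∃ φ, IsDoubleSolution A B φ := by
  obtain ⟨φ, hφ⟩ := hM.exists_isClosedSolution_of_two_le_trace hA hB hAp hBp htr.ge
  have hI := (hM.logMultiplier_eq_zero_iff hφ hA.continuous hB.continuous).2 (by
    rw [htr]
    norm_num)
  exact ⟨φ, hφ, hI, fun hJ =>
    hne (hM.eq_one_of_shift_eq_zero hφ hA.continuous hB.continuous htr hI hJ)⟩

theorem IsMonodromy.trace_one_add_smul {μ : ℝ} {Q : Matrix (Fin 2) (Fin 2) ℝ}
    (hM : IsMonodromy (fun t => systemMatrix (A t) (B t)) (2 * Real.pi) (1 + μ • Q))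
    (hA : ContDiff ℝ ∞ A) (hB : ContDiff ℝ ∞ B) (hAp : Function.Periodic A (2 * Real.pi))
    (hBp : Function.Periodic B (2 * Real.pi)) :
    (1 + μ • Q).trace = 2 - μ ^ 2 * Q.det := by
  obtain ⟨φ, hφ, -⟩ := exists_isSolution hA hB hAp hBp 0
  have hdet := hM.det_eq_one hφ hA.continuous hB.continuous
  simp [Matrix.det_fin_two, Matrix.trace_fin_two] at hdet ⊢
  linear_combination hdet

theorem IsMonodromy.exists_isHyperbolicSolution_of_det_neg {μ : ℝ} {Q : Matrix (Fin 2) (Fin 2) ℝ}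
    (hM : IsMonodromy (fun t => systemMatrix (A t) (B t)) (2 * Real.pi) (1 + μ • Q))
    (hA : ContDiff ℝ ∞ A) (hB : ContDiff ℝ ∞ B) (hAp : Function.Periodic A (2 * Real.pi))
    (hBp : Function.Periodic B (2 * Real.pi)) (hμ : μ ≠ 0) (hdet : Q.det < 0) :
    ∃ φ, IsHyperbolicSolution A B φ := by
  refine hM.exists_isHyperbolicSolution hA hB hAp hBp ?_
  rw [hM.trace_one_add_smul hA hB hAp hBp]
  linarith [mul_neg_of_pos_of_neg (sq_pos_of_ne_zero hμ) hdet]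

theorem IsMonodromy.exists_isDoubleSolution_of_det_eq_zero {μ : ℝ} {Q : Matrix (Fin 2) (Fin 2) ℝ}
    (hM : IsMonodromy (fun t => systemMatrix (A t) (B t)) (2 * Real.pi) (1 + μ • Q))
    (hA : ContDiff ℝ ∞ A) (hB : ContDiff ℝ ∞ B) (hAp : Function.Periodic A (2 * Real.pi))
    (hBp : Function.Periodic B (2 * Real.pi)) (hμ : μ ≠ 0) (hdet : Q.det = 0) (hQ : Q ≠ 0) :
    ∃ φ, IsDoubleSolution A B φ :=
  hM.exists_isDoubleSolution hA hB hAp hBp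
    (by rw [hM.trace_one_add_smul hA hB hAp hBp, hdet, mul_zero, sub_zero])
    (by rwa [ne_eq, add_eq_left, smul_eq_zero_iff_right hμ])

end LinearSystem

/-! ### The bifurcation -/

theorem eventually_forall_mem_of_continuousOn {X Y Z : Type*} [TopologicalSpace X]
    [TopologicalSpace Y] [TopologicalSpace Z] {D : Set (X × Y)} {f : X × Y → Z} {x₀ : X}
    {K : Set Y} {U : Set Z} (hD : IsOpen D) (hf : ContinuousOn f D) (hK : IsCompact K)
    (hU : IsOpen U) (h : ∀ y ∈ K, (x₀, y) ∈ D ∧ f (x₀, y) ∈ U) :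
    ∀ᶠ x in 𝓝 x₀, ∀ y ∈ K, (x, y) ∈ D ∧ f (x, y) ∈ U :=
  hK.eventually_forall_of_forall_eventually fun y hy =>
    (hf.isOpen_inter_preimage hD hU).mem_nhds (h y hy)

theorem hasDerivAt_slice {E : Type*} [NormedAddCommGroup E] [NormedSpace ℝ E] {g : E × ℝ → ℝ}
    {p : E × ℝ} (hg : DifferentiableAt ℝ g p) :
    HasDerivAt (fun y => g (p.1, y)) (fderiv ℝ g p (0, 1)) p.2 :=
  HasFDerivAt.comp_hasDerivAt p.2 (f := fun y => (p.1, y)) hg.hasFDerivAt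
    ((hasDerivAt_const _ _).prodMk (hasDerivAt_id _))

theorem isInvertible_of_apply_one_ne_zero {L : ℝ →L[ℝ] ℝ} (hL : L 1 ≠ 0) : L.IsInvertible := by
  refine ⟨ContinuousLinearEquiv.unitsEquivAut ℝ (Units.mk0 (L 1) hL), ?_⟩
  ext
  simp

theorem contDiffAt_of_unique_root {g : ℝ × ℝ → ℝ} {e : ℝ → ℝ} {x : ℝ}
    (hg : ContDiffAt ℝ ∞ g (x, e x)) (hd : fderiv ℝ g (x, e x) (0, 1) ≠ 0) {U : Set ℝ}
    (hU : U ∈ 𝓝 (e x)) (huniq : ∀ᶠ x' in 𝓝 x, ∀ y ∈ U, g (x', y) = g (x, e x) → y = e x') :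
    ContDiffAt ℝ ∞ e x := by
  have hinv : (fderiv ℝ g (x, e x) ∘L .inr ℝ ℝ ℝ).IsInvertible :=
    isInvertible_of_apply_one_ne_zero (by simpa using hd)
  have himplicit := hg.contDiffAt_implicitFunction (by simp) hinv
  have hmem := himplicit.continuousAt.eventually_mem (by
    rwa [hg.implicitFunction_apply_self (by simp) hinv])
  refine himplicit.congr_of_eventuallyEq ?_
  filter_upwards [hg.eventually_apply_implicitFunction (by simp) hinv, hmem, huniq]
    with x' hroot hx' huniq
  exact (huniq _ hx' hroot).symm

theorem exists_contDiffOn_root {D : Set (ℝ × ℝ)} {g : ℝ × ℝ → ℝ} (hD : IsOpen D)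
    (hg : ContDiffOn ℝ ∞ g D) {S : Set ℝ} (hS : IsOpen S) {a b : ℝ} (hab : a ≤ b)
    (hd : ∀ x ∈ S, ∀ y ∈ Icc a b, (x, y) ∈ D ∧ fderiv ℝ g (x, y) (0, 1) < 0)
    (ha : ∀ x ∈ S, 0 < g (x, a)) (hb : ∀ x ∈ S, g (x, b) < 0) :
    ∃ e : ℝ → ℝ, ContDiffOn ℝ ∞ e S ∧
      ∀ x ∈ S, e x ∈ Ioo a b ∧ g (x, e x) = 0 ∧ ∀ y ∈ Ico a (e x), 0 < g (x, y) := by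
  have hgD : ∀ p ∈ D, ContDiffAt ℝ ∞ g p := fun p hp => hg.contDiffAt (hD.mem_nhds hp)
  have hslice : ∀ x ∈ S, ∀ y ∈ Icc a b,
      HasDerivAt (fun y => g (x, y)) (fderiv ℝ g (x, y) (0, 1)) y := fun x hx y hy =>
    hasDerivAt_slice ((hgD _ (hd x hx y hy).1).differentiableAt (by simp))
  have hcont : ∀ x ∈ S, ContinuousOn (fun y => g (x, y)) (Icc a b) := fun x hx =>
    HasDerivAt.continuousOn (hslice x hx)
  have hanti : ∀ x ∈ S, StrictAntiOn (fun y => g (x, y)) (Icc a b) := fun x hx =>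
    strictAntiOn_of_deriv_neg (convex_Icc a b) (hcont x hx) fun y hy => by
      rw [(hslice x hx y (interior_subset hy)).deriv]
      exact (hd x hx y (interior_subset hy)).2
  have hroot : ∀ x ∈ S, ∃ y ∈ Ioo a b, g (x, y) = 0 := fun x hx =>
    intermediate_value_Ioo' hab (hcont x hx) ⟨hb x hx, ha x hx⟩
  choose! e he hge using hroot
  have heI : ∀ x ∈ S, e x ∈ Icc a b := fun x hx => Ioo_subset_Icc_self (he x hx)
  refine ⟨e, fun x hx => ContDiffAt.contDiffWithinAt ?_, fun x hx => ⟨he x hx, hge x hx,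
    fun y hy => ?_⟩⟩
  · have hmem := hd x hx _ (heI x hx)
    refine contDiffAt_of_unique_root (hgD _ hmem.1) hmem.2.ne
      (Ioo_mem_nhds (he x hx).1 (he x hx).2) ?_
    filter_upwards [hS.mem_nhds hx] with x' hx' y hy hgy
    exact (hanti x' hx').injOn (Ioo_subset_Icc_self hy) (heI x' hx')
      (hgy.trans ((hge x hx).trans (hge x' hx').symm))
  · have hlt := hanti x hx ⟨hy.1, hy.2.le.trans (heI x hx).2⟩ (heI x hx) hy.2
    simpa [hge x hx] using hlt

section RootOfUnfolding

variable {D : Set (ℝ × ℝ)} {g : ℝ × ℝ → ℝ} {K : ℝ}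

theorem fderiv_apply_of_eq_mul_one_sub_sq (hg : ∀ y, DifferentiableAt ℝ g (0, y))
    (hg0 : ∀ y, g (0, y) = K * (1 - y ^ 2)) (y : ℝ) :
    fderiv ℝ g (0, y) (0, 1) = -(2 * K * y) := by
  have hslice := hasDerivAt_slice (hg y)
  simp only [hg0] at hslice
  refine hslice.unique (((((hasDerivAt_id y).pow 2).const_sub 1).const_mul K).congr_deriv ?_)
  simp
  ring

theorem exists_contDiffOn_root_of_eq_mul_one_sub_sq (hD : IsOpen D) (hD0 : ∀ y, ((0 : ℝ), y) ∈ D)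
    (hg : ContDiffOn ℝ ∞ g D) (hK : 0 < K) (hg0 : ∀ y, g (0, y) = K * (1 - y ^ 2)) :
    ∃ (e : ℝ → ℝ) (δ : ℝ), 0 < δ ∧ ContDiffOn ℝ ∞ e (Ioo (-δ) δ) ∧ e 0 = 1 ∧
      ∀ x ∈ Ioo (-δ) δ, e x ∈ Ioo (1 / 2) 2 ∧ g (x, e x) = 0 ∧ ∀ y ∈ Ico 0 (e x), 0 < g (x, y) := by
  have hpos : ∀ᶠ x in 𝓝 (0 : ℝ), ∀ y ∈ Icc (0 : ℝ) (1 / 2), (x, y) ∈ D ∧ g (x, y) ∈ Ioi 0 :=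
    eventually_forall_mem_of_continuousOn hD hg.continuousOn isCompact_Icc isOpen_Ioi
      fun y hy => ⟨hD0 y, by
        rw [hg0, mem_Ioi]
        exact mul_pos hK (by nlinarith [hy.1, hy.2])⟩
  have hdecr : ∀ᶠ x in 𝓝 (0 : ℝ), ∀ y ∈ Icc (1 / 2 : ℝ) 2,
      (x, y) ∈ D ∧ fderiv ℝ g (x, y) (0, 1) ∈ Iio 0 :=
    eventually_forall_mem_of_continuousOn hD
      ((hg.continuousOn_fderiv_of_isOpen hD (by simp)).clm_apply continuousOn_const)
      isCompact_Icc isOpen_Iio fun y hy => ⟨hD0 y, by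
        rw [fderiv_apply_of_eq_mul_one_sub_sq (fun y =>
          (hg.contDiffAt (hD.mem_nhds (hD0 y))).differentiableAt (by simp)) hg0, mem_Iio]
        nlinarith [hy.1]⟩
  have hneg : ∀ᶠ x in 𝓝 (0 : ℝ), ∀ y ∈ ({2} : Set ℝ), (x, y) ∈ D ∧ g (x, y) ∈ Iio 0 :=
    eventually_forall_mem_of_continuousOn hD hg.continuousOn isCompact_singleton isOpen_Iio
      fun y hy => ⟨hD0 y, by
        rw [hg0, mem_singleton_iff.1 hy, mem_Iio]
        linarith⟩
  obtain ⟨δ, hδ, h⟩ := Metric.eventually_nhds_iff_ball.1 (hpos.and (hdecr.and hneg))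
  rw [Real.ball_eq_Ioo, zero_sub, zero_add] at h
  obtain ⟨e, he, hroot⟩ := exists_contDiffOn_root hD hg isOpen_Ioo (a := 1 / 2) (b := 2)
    (by norm_num) (fun x hx => (h x hx).2.1) (fun x hx => ((h x hx).1 _ (by norm_num)).2)
    (fun x hx => ((h x hx).2.2 _ rfl).2)
  refine ⟨e, δ, hδ, he, ?_, fun x hx => ⟨(hroot x hx).1, (hroot x hx).2.1, fun y hy => ?_⟩⟩
  · obtain ⟨hmem, hzero, -⟩ := hroot 0 ⟨neg_lt_zero.2 hδ, hδ⟩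
    rw [hg0, mul_eq_zero_iff_left hK.ne'] at hzero
    nlinarith [hmem.1]
  · rcases le_or_gt y (1 / 2) with hle | hlt
    · exact ((h x hx).1 y ⟨hy.1, hle⟩).2
    · exact (hroot x hx).2.2 y ⟨hlt.le, hy.2⟩

theorem exists_root_pair (hD : IsOpen D) (hD0 : ∀ y, ((0 : ℝ), y) ∈ D)
    (hg : ContDiffOn ℝ ∞ g D) (hK : 0 < K) (hg0 : ∀ y, g (0, y) = K * (1 - y ^ 2)) :
    ∃ (e₁ e₂ : ℝ → ℝ) (δ : ℝ), 0 < δ ∧ ContDiffOn ℝ ∞ e₁ (Ioo (-δ) δ) ∧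
      ContDiffOn ℝ ∞ e₂ (Ioo (-δ) δ) ∧ e₁ 0 = 1 ∧ e₂ 0 = 1 ∧ ∀ x ∈ Ioo (-δ) δ,
        e₁ x ∈ Ioo 0 2 ∧ e₂ x ∈ Ioo 0 2 ∧ g (x, -e₁ x) = 0 ∧ g (x, e₂ x) = 0 ∧
        ∀ y ∈ Ioo (-e₁ x) (e₂ x), 0 < g (x, y) := by
  have hreflect : ContDiff ℝ ∞ fun p : ℝ × ℝ => (p.1, -p.2) := by fun_prop
  obtain ⟨e₁, δ₁, hδ₁, he₁, he₁0, hroot₁⟩ := exists_contDiffOn_root_of_eq_mul_one_sub_sq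
    (g := fun p => g (p.1, -p.2)) (hD.preimage hreflect.continuous) (fun y => hD0 (-y))
    (hg.comp hreflect.contDiffOn fun p hp => hp) hK (fun y => by simp [hg0])
  obtain ⟨e₂, δ₂, hδ₂, he₂, he₂0, hroot₂⟩ :=
    exists_contDiffOn_root_of_eq_mul_one_sub_sq hD hD0 hg hK hg0
  have hsub₁ : Ioo (-min δ₁ δ₂) (min δ₁ δ₂) ⊆ Ioo (-δ₁) δ₁ :=
    Ioo_subset_Ioo (neg_le_neg (min_le_left _ _)) (min_le_left _ _)
  have hsub₂ : Ioo (-min δ₁ δ₂) (min δ₁ δ₂) ⊆ Ioo (-δ₂) δ₂ :=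
    Ioo_subset_Ioo (neg_le_neg (min_le_right _ _)) (min_le_right _ _)
  refine ⟨e₁, e₂, min δ₁ δ₂, lt_min hδ₁ hδ₂, he₁.mono hsub₁, he₂.mono hsub₂, he₁0, he₂0,
    fun x hx => ?_⟩
  obtain ⟨hmem₁, hzero₁, hpos₁⟩ := hroot₁ x (hsub₁ hx)
  obtain ⟨hmem₂, hzero₂, hpos₂⟩ := hroot₂ x (hsub₂ hx)
  refine ⟨⟨by linarith [hmem₁.1], hmem₁.2⟩, ⟨by linarith [hmem₂.1], hmem₂.2⟩, hzero₁, hzero₂,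
    fun y hy => ?_⟩
  rcases le_total 0 y with h | h
  · exact hpos₂ y ⟨h, hy.2⟩
  · simpa using hpos₁ (-y) ⟨by linarith, by linarith [hy.1]⟩

end RootOfUnfolding

section Bifurcation

attribute [local instance] Matrix.linftyOpNormedRing Matrix.linftyOpNormedAlgebra

theorem systemMatrix_eq_add_smul (a b : ℝ) :
    systemMatrix a b = a • systemMatrix 1 0 + b • systemMatrix 0 1 := by
  ext i j
  fin_cases i <;> fin_cases j <;> simp [systemMatrix] <;> ring

theorem contDiff_systemMatrix {E : Type*} [NormedAddCommGroup E] [NormedSpace ℝ E] {a b : E → ℝ}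
    (ha : ContDiff ℝ ∞ a) (hb : ContDiff ℝ ∞ b) :
    ContDiff ℝ ∞ fun p => systemMatrix (a p) (b p) := by
  simp only [fun p => systemMatrix_eq_add_smul (a p) (b p)]
  exact (ha.smul contDiff_const).add (hb.smul contDiff_const)

theorem integral_systemMatrix {a b : ℝ → ℝ} (ha : Continuous a) (hb : Continuous b) (s t : ℝ) :
    ∫ u in s..t, systemMatrix (a u) (b u)
      = systemMatrix (∫ u in s..t, a u) (∫ u in s..t, b u) := by
  simp only [fun u => systemMatrix_eq_add_smul (a u) (b u)]
  rw [intervalIntegral.integral_add (f := fun u => a u • systemMatrix 1 0)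
    (g := fun u => b u • systemMatrix 0 1) ((ha.smul continuous_const).intervalIntegrable _ _)
    ((hb.smul continuous_const).intervalIntegrable _ _), intervalIntegral.integral_smul_const,
    intervalIntegral.integral_smul_const, ← systemMatrix_eq_add_smul]

theorem smul_systemMatrix (μ a b : ℝ) : μ • systemMatrix a b = systemMatrix (μ * a) (μ * b) := by
  rw [systemMatrix_eq_add_smul a, systemMatrix_eq_add_smul (μ * a), smul_add, smul_smul, smul_smul]

theorem det_systemMatrix (a b : ℝ) : (systemMatrix a b).det = (a ^ 2 - b ^ 2) / 4 := by
  rw [systemMatrix, Matrix.det_fin_two_of]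
  ring

theorem systemMatrix_apply_one_one (a b : ℝ) : systemMatrix a b 1 1 = b / 2 := by
  simp [systemMatrix]

variable {a b : (ℝ × ℝ) × ℝ → ℝ}

theorem exists_monodromy_family (ha : ContDiff ℝ ∞ a) (hb : ContDiff ℝ ∞ b) :
    ∃ (D : Set (ℝ × ℝ)) (Q : ℝ × ℝ → Matrix (Fin 2) (Fin 2) ℝ), IsOpen D ∧ ContDiffOn ℝ ∞ Q D ∧
      (∀ η, (0, η) ∈ D ∧ Q (0, η) = systemMatrix (∫ t in (0 : ℝ)..(2 * Real.pi), a ((0, η), t))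
        (∫ t in (0 : ℝ)..(2 * Real.pi), b ((0, η), t))) ∧
      ∀ p ∈ D, IsMonodromy (fun t => systemMatrix (p.1 * a (p, t)) (p.1 * b (p, t)))
        (2 * Real.pi) (1 + p.1 • Q p) := by
  obtain ⟨D, Q, hD, hQ, hQ0, hmono⟩ := exists_smooth_monodromy (contDiff_systemMatrix ha hb)
    (contDiff_fst (E := ℝ) (F := ℝ)) Real.two_pi_pos.le
  have hslice : ∀ η : ℝ, Continuous fun t : ℝ => (((0 : ℝ), η), t) := fun η => by fun_prop
  refine ⟨D, Q, hD, hQ, fun η => ⟨(hQ0 _ rfl).1, ?_⟩, fun p hp => ?_⟩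
  · rw [(hQ0 (0, η) rfl).2]
    exact integral_systemMatrix (ha.continuous.comp (hslice η)) (hb.continuous.comp (hslice η)) _ _
  · simpa only [smul_systemMatrix] using hmono p hp

theorem exists_discriminant (ha : ContDiff ℝ ∞ a) (hb : ContDiff ℝ ∞ b)
    (hap : ∀ p, Function.Periodic (fun t => a (p, t)) (2 * Real.pi))
    (hbp : ∀ p, Function.Periodic (fun t => b (p, t)) (2 * Real.pi)) :
    ∃ (D : Set (ℝ × ℝ)) (g q : ℝ × ℝ → ℝ), IsOpen D ∧ ContDiffOn ℝ ∞ g D ∧ ContDiffOn ℝ ∞ q D ∧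
      (∀ η, (0, η) ∈ D ∧ q (0, η) = (∫ t in (0 : ℝ)..(2 * Real.pi), b ((0, η), t)) / 2 ∧
        g (0, η) = ((∫ t in (0 : ℝ)..(2 * Real.pi), b ((0, η), t)) ^ 2 -
          (∫ t in (0 : ℝ)..(2 * Real.pi), a ((0, η), t)) ^ 2) / 4) ∧
      ∀ p ∈ D, p.1 ≠ 0 →
        (0 < g p → ∃ φ,
          IsHyperbolicSolution (fun t => p.1 * a (p, t)) (fun t => p.1 * b (p, t)) φ) ∧
        (g p = 0 → q p ≠ 0 → ∃ φ,
          IsDoubleSolution (fun t => p.1 * a (p, t)) (fun t => p.1 * b (p, t)) φ) := by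
  obtain ⟨D, Q, hD, hQ, hQ0, hmono⟩ := exists_monodromy_family ha hb
  have hentry : ∀ i j, ContDiffOn ℝ ∞ (fun p => Q p i j) D := fun i j =>
    (Matrix.entryLinearMap ℝ ℝ i j).toContinuousLinearMap.contDiff.comp_contDiffOn hQ
  have hdet : ContDiffOn ℝ ∞ (fun p => -(Q p).det) D := by
    simp only [Matrix.det_fin_two]
    exact (((hentry 0 0).mul (hentry 1 1)).sub ((hentry 0 1).mul (hentry 1 0))).neg
  refine ⟨D, fun p => -(Q p).det, fun p => Q p 1 1, hD, hdet, hentry 1 1,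
    fun η => ⟨(hQ0 η).1, ?_, ?_⟩, fun p hp hp0 => ?_⟩
  · simp only [(hQ0 η).2, systemMatrix_apply_one_one]
  · simp only [(hQ0 η).2, det_systemMatrix]
    ring
  have hslice : ContDiff ℝ ∞ fun t : ℝ => (p, t) := by fun_prop
  have hA : ContDiff ℝ ∞ fun t => p.1 * a (p, t) := contDiff_const.mul (ha.comp hslice)
  have hB : ContDiff ℝ ∞ fun t => p.1 * b (p, t) := contDiff_const.mul (hb.comp hslice)
  have hAp : Function.Periodic (fun t => p.1 * a (p, t)) (2 * Real.pi) :=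
    fun t => congrArg (p.1 * ·) (hap p t)
  have hBp : Function.Periodic (fun t => p.1 * b (p, t)) (2 * Real.pi) :=
    fun t => congrArg (p.1 * ·) (hbp p t)
  refine ⟨fun hpos => ?_, fun hzero hentry_ne => ?_⟩
  · exact (hmono p hp).exists_isHyperbolicSolution_of_det_neg hA hB hAp hBp hp0 (neg_pos.1 hpos)
  · exact (hmono p hp).exists_isDoubleSolution_of_det_eq_zero hA hB hAp hBp hp0
      (neg_eq_zero.1 hzero) fun h => hentry_ne (congrFun (congrFun h 1) 1)

theorem exists_bifurcation (ha : ContDiff ℝ ∞ a) (hb : ContDiff ℝ ∞ b)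
    (hap : ∀ p, Function.Periodic (fun t => a (p, t)) (2 * Real.pi))
    (hbp : ∀ p, Function.Periodic (fun t => b (p, t)) (2 * Real.pi)) {k : ℝ} (hk : 0 < k)
    (ha0 : ∀ η, ∫ t in (0 : ℝ)..(2 * Real.pi), a ((0, η), t) = η * k)
    (hb0 : ∀ η, ∫ t in (0 : ℝ)..(2 * Real.pi), b ((0, η), t) = k) :
    ∃ (e₁ e₂ : ℝ → ℝ) (δ : ℝ), 0 < δ ∧ ContDiffOn ℝ ∞ e₁ (Ioo (-δ) δ) ∧
      ContDiffOn ℝ ∞ e₂ (Ioo (-δ) δ) ∧ e₁ 0 = 1 ∧ e₂ 0 = 1 ∧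
      ∀ μ ∈ Ioo 0 δ, e₁ μ ∈ Ioo 0 2 ∧ e₂ μ ∈ Ioo 0 2 ∧
        (∀ η ∈ Ioo (-e₁ μ) (e₂ μ), ∃ φ,
          IsHyperbolicSolution (fun t => μ * a ((μ, η), t)) (fun t => μ * b ((μ, η), t)) φ) ∧
        ∀ η, η = -e₁ μ ∨ η = e₂ μ → ∃ φ,
          IsDoubleSolution (fun t => μ * a ((μ, η), t)) (fun t => μ * b ((μ, η), t)) φ := by
  obtain ⟨D, g, q, hD, hg, hq, h0, hsolution⟩ := exists_discriminant ha hb hap hbp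
  have hg0 : ∀ η, g (0, η) = k ^ 2 / 4 * (1 - η ^ 2) := fun η => by
    rw [(h0 η).2.2, ha0, hb0]
    ring
  obtain ⟨e₁, e₂, δ, hδ, he₁, he₂, he₁0, he₂0, hroot⟩ :=
    exists_root_pair hD (fun η => (h0 η).1) hg (by positivity) hg0
  have hqpos : ∀ᶠ μ in 𝓝 (0 : ℝ), ∀ η ∈ Icc (-2 : ℝ) 2, (μ, η) ∈ D ∧ q (μ, η) ∈ Ioi 0 :=
    eventually_forall_mem_of_continuousOn hD hq.continuousOn isCompact_Icc isOpen_Ioi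
      fun η _ => ⟨(h0 η).1, by
        rw [(h0 η).2.1, hb0]
        exact half_pos hk⟩
  obtain ⟨δ', hδ', hqpos⟩ := Metric.eventually_nhds_iff_ball.1 hqpos
  rw [Real.ball_eq_Ioo, zero_sub, zero_add] at hqpos
  have hsub : Ioo (-min δ δ') (min δ δ') ⊆ Ioo (-δ) δ :=
    Ioo_subset_Ioo (neg_le_neg (min_le_left _ _)) (min_le_left _ _)
  refine ⟨e₁, e₂, min δ δ', lt_min hδ hδ', he₁.mono hsub, he₂.mono hsub, he₁0, he₂0,
    fun μ hμ => ?_⟩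
  obtain ⟨hmem₁, hmem₂, hzero₁, hzero₂, hpos⟩ := hroot μ (hsub ⟨by linarith [hμ.1, hμ.2], hμ.2⟩)
  have hmem : ∀ η ∈ Icc (-e₁ μ) (e₂ μ), (μ, η) ∈ D ∧ q (μ, η) ∈ Ioi 0 := fun η hη =>
    hqpos μ ⟨by linarith [hμ.1], hμ.2.trans_le (min_le_right _ _)⟩ η
      ⟨by linarith [hη.1, hmem₁.2], by linarith [hη.2, hmem₂.2]⟩
  refine ⟨hmem₁, hmem₂, fun η hη => ?_, fun η hη => ?_⟩
  · exact (hsolution _ (hmem η (Ioo_subset_Icc_self hη)).1 hμ.1.ne').1 (hpos η hη)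
  · have hηIcc : η ∈ Icc (-e₁ μ) (e₂ μ) := by
      rcases hη with rfl | rfl <;> constructor <;> linarith [hmem₁.1, hmem₂.1]
    have hzero : g (μ, η) = 0 := by rcases hη with rfl | rfl <;> assumption
    exact (hsolution _ (hmem η hηIcc).1 hμ.1.ne').2 hzero (hmem η hηIcc).2.ne'

theorem isBigO_mul_sub_self {e : ℝ → ℝ} {δ : ℝ} (hδ : 0 < δ) (he : ContDiffOn ℝ ∞ e (Ioo (-δ) δ))
    (h0 : e 0 = 1) : (fun μ => μ * e μ - μ) =O[𝓝 0] fun μ => μ ^ 2 := by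
  have hlinear : (fun μ => e μ - 1) =O[𝓝 0] fun μ => μ := by
    have hdiff := (he.contDiffAt (Ioo_mem_nhds (neg_lt_zero.2 hδ) hδ)).differentiableAt (by simp)
    simpa only [h0, sub_zero] using hdiff.isBigO_sub
  exact ((isBigO_refl (fun μ : ℝ => μ) (𝓝 0)).mul hlinear).congr (fun μ => by ring)
    fun μ => (sq μ).symm

end Bifurcation

/-! ### The three parameter family: explicit formulas -/

theorem hasDerivAt_vec_three {x y z : ℝ → ℝ} {x' y' z' t : ℝ} (hx : HasDerivAt x x' t)
    (hy : HasDerivAt y y' t) (hz : HasDerivAt z z' t) :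
    HasDerivAt (fun t => (!₂[x t, y t, z t] : E3)) !₂[x', y', z'] t := by
  have hpi : HasDerivAt (fun t => ![x t, y t, z t]) ![x', y', z'] t := by
    rw [hasDerivAt_pi]
    intro i
    fin_cases i <;> simpa
  exact (PiLp.continuousLinearEquiv 2 ℝ (fun _ : Fin 3 => ℝ)).symm.hasFDerivAt.comp_hasDerivAt t hpi

theorem ellipse_speed_sq_pos (t : ℝ) : 0 < 4 - 3 * Real.cos t ^ 2 := by
  nlinarith [Real.cos_sq_le_one t]

section

local notation "ζ" => ellipseCurvatureDot
local notation "ζ₁" => deriv ellipseCurvatureDot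
local notation "ζ₂" => deriv (deriv ellipseCurvatureDot)
local notation "ζ₃" => deriv (deriv (deriv ellipseCurvatureDot))

theorem contDiff_ellipseCurvatureDot : ContDiff ℝ ∞ ζ := by
  have hq : ContDiff ℝ ∞ fun t => 4 - 3 * Real.cos t ^ 2 := by fun_prop
  exact ContDiff.div (by fun_prop) (hq.rpow_const_of_ne fun t => (ellipse_speed_sq_pos t).ne')
    fun t => (Real.rpow_pos_of_pos (ellipse_speed_sq_pos t) _).ne'

theorem contDiff_deriv_ellipseCurvatureDot : ContDiff ℝ ∞ ζ₁ :=
  contDiff_deriv contDiff_ellipseCurvatureDot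

theorem contDiff_deriv_deriv_ellipseCurvatureDot : ContDiff ℝ ∞ ζ₂ :=
  contDiff_deriv contDiff_deriv_ellipseCurvatureDot

theorem ellipseCurvatureDot_periodic : Function.Periodic ζ (2 * Real.pi) := fun t => by
  simp [ellipseCurvatureDot]

theorem deriv_ellipseCurvatureDot_periodic : Function.Periodic ζ₁ (2 * Real.pi) :=
  periodic_deriv ellipseCurvatureDot_periodic

theorem deriv_deriv_ellipseCurvatureDot_periodic : Function.Periodic ζ₂ (2 * Real.pi) :=
  periodic_deriv deriv_ellipseCurvatureDot_periodic

theorem ellipseCurvatureDot_neg (t : ℝ) : ζ (-t) = -ζ t := by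
  simp [ellipseCurvatureDot, neg_div]

theorem exists_pos_abs_deriv_ellipseCurvatureDot_le : ∃ M, 0 < M ∧ ∀ t, |ζ₁ t| ≤ M := by
  obtain ⟨C, hC⟩ := exists_nnreal_norm_le_of_periodic (by positivity)
    contDiff_deriv_ellipseCurvatureDot.continuous deriv_ellipseCurvatureDot_periodic
  exact ⟨C + 1, by positivity, fun t => (hC t).trans (by linarith)⟩

theorem contDiff_centerCurve (ε : ℝ) : ContDiff ℝ ∞ (centerCurve ε) := by
  have hζ := contDiff_ellipseCurvatureDot
  rw [contDiff_euclidean]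
  intro i
  fin_cases i
  · exact contDiff_const.mul Real.contDiff_cos
  · exact Real.contDiff_sin
  · exact contDiff_const.mul hζ

theorem centerCurve_periodic (ε : ℝ) : Function.Periodic (centerCurve ε) (2 * Real.pi) :=
  fun t => by
    simp only [centerCurve, Real.cos_add_two_pi, Real.sin_add_two_pi,
      ellipseCurvatureDot_periodic t]

theorem deriv_centerCurve (ε : ℝ) :
    deriv (centerCurve ε) = fun t => !₂[-(2 * Real.sin t), Real.cos t, ε * ζ₁ t] := by
  funext t
  refine HasDerivAt.deriv (hasDerivAt_vec_three ?_ (Real.hasDerivAt_sin t)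
    ((hasDerivAt_deriv contDiff_ellipseCurvatureDot t).const_mul ε))
  exact ((Real.hasDerivAt_cos t).const_mul 2).congr_deriv (by ring)

theorem deriv_deriv_centerCurve (ε : ℝ) :
    deriv (deriv (centerCurve ε)) =
      fun t => !₂[-(2 * Real.cos t), -Real.sin t, ε * ζ₂ t] := by
  funext t
  rw [deriv_centerCurve]
  exact HasDerivAt.deriv (hasDerivAt_vec_three ((Real.hasDerivAt_sin t).const_mul 2).neg
    (Real.hasDerivAt_cos t)
    ((hasDerivAt_deriv contDiff_deriv_ellipseCurvatureDot t).const_mul ε))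

theorem deriv_deriv_deriv_centerCurve (ε : ℝ) :
    deriv (deriv (deriv (centerCurve ε))) =
      fun t => !₂[2 * Real.sin t, -Real.cos t, ε * ζ₃ t] := by
  funext t
  rw [deriv_deriv_centerCurve]
  refine HasDerivAt.deriv (hasDerivAt_vec_three ?_ (Real.hasDerivAt_sin t).neg
    ((hasDerivAt_deriv contDiff_deriv_deriv_ellipseCurvatureDot t).const_mul ε))
  exact ((Real.hasDerivAt_cos t).const_mul 2).neg.congr_deriv (by ring)

/-- `|ċ|²` for `c = centerCurve ε`, as a function of `ε` and `t`. -/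
noncomputable def speedSq (ε t : ℝ) : ℝ := 4 - 3 * Real.cos t ^ 2 + ε ^ 2 * ζ₁ t ^ 2

/-- `|ċ ∧ c̈|²` for `c = centerCurve ε`, as a function of `ε` and `t`. -/
noncomputable def bendSq (ε t : ℝ) : ℝ :=
  4 + ε ^ 2 * ((Real.cos t * ζ₂ t + Real.sin t * ζ₁ t) ^ 2
    + 4 * (Real.sin t * ζ₂ t - Real.cos t * ζ₁ t) ^ 2)

theorem one_le_speedSq (ε t : ℝ) : 1 ≤ speedSq ε t := by
  have hnonneg := mul_nonneg (sq_nonneg ε) (sq_nonneg (ζ₁ t))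
  rw [speedSq]
  linarith [Real.cos_sq_le_one t]

theorem speedSq_pos (ε t : ℝ) : 0 < speedSq ε t := zero_lt_one.trans_le (one_le_speedSq ε t)

theorem bendSq_pos (ε t : ℝ) : 0 < bendSq ε t := by
  rw [bendSq]
  positivity

theorem contDiff_speedSq : ContDiff ℝ ∞ fun p : ℝ × ℝ => speedSq p.1 p.2 := by
  have hζ₁ := contDiff_deriv_ellipseCurvatureDot
  unfold speedSq
  fun_prop

theorem contDiff_bendSq : ContDiff ℝ ∞ fun p : ℝ × ℝ => bendSq p.1 p.2 := by
  have hζ₁ := contDiff_deriv_ellipseCurvatureDot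
  unfold bendSq
  fun_prop

theorem speedSq_periodic (ε : ℝ) : Function.Periodic (speedSq ε) (2 * Real.pi) := fun t => by
  simp only [speedSq, Real.cos_add_two_pi, deriv_ellipseCurvatureDot_periodic t]

theorem bendSq_periodic (ε : ℝ) : Function.Periodic (bendSq ε) (2 * Real.pi) := fun t => by
  simp only [bendSq, Real.cos_add_two_pi, Real.sin_add_two_pi,
    deriv_ellipseCurvatureDot_periodic t, deriv_deriv_ellipseCurvatureDot_periodic t]

theorem speed_centerCurve (ε t : ℝ) : speed (centerCurve ε) t = √(speedSq ε t) := by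
  rw [speed, ← Real.sqrt_sq (norm_nonneg _), ← real_inner_self_eq_norm_sq, deriv_centerCurve,
    inner_eq]
  congr 1
  simp only [Matrix.cons_val_zero, Matrix.cons_val_one, Matrix.cons_val, speedSq]
  linear_combination 4 * Real.sin_sq_add_cos_sq t

theorem cross_centerCurve (ε t : ℝ) :
    cross (deriv (centerCurve ε) t) (deriv (deriv (centerCurve ε)) t) =
      !₂[ε * (Real.cos t * ζ₂ t + Real.sin t * ζ₁ t),
        ε * (2 * (Real.sin t * ζ₂ t - Real.cos t * ζ₁ t)), 2] := by
  rw [deriv_deriv_centerCurve, deriv_centerCurve]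
  refine ext_three ?_ ?_ ?_
  · simp only [cross_zero_apply, Matrix.cons_val_one, Matrix.cons_val]
    ring
  · simp only [cross_one_apply, Matrix.cons_val, Matrix.cons_val_zero]
    ring
  · simp only [cross_two_apply, Matrix.cons_val_zero, Matrix.cons_val_one, Matrix.cons_val]
    linear_combination 2 * Real.sin_sq_add_cos_sq t

theorem norm_sq_cross_centerCurve (ε t : ℝ) :
    ‖cross (deriv (centerCurve ε) t) (deriv (deriv (centerCurve ε)) t)‖ ^ 2 = bendSq ε t := by
  rw [← real_inner_self_eq_norm_sq, cross_centerCurve, inner_eq]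
  simp only [Matrix.cons_val_zero, Matrix.cons_val_one, Matrix.cons_val, bendSq]
  ring

theorem cross_centerCurve_ne_zero (ε t : ℝ) :
    cross (deriv (centerCurve ε) t) (deriv (deriv (centerCurve ε)) t) ≠ 0 := by
  rw [← norm_ne_zero_iff, ← sq_pos_iff, norm_sq_cross_centerCurve]
  exact bendSq_pos ε t

theorem bending_centerCurve (ε t : ℝ) :
    bending (centerCurve ε) t = √(bendSq ε t) / speedSq ε t := by
  rw [bending, speed_centerCurve, Real.sq_sqrt (speedSq_pos ε t).le,
    ← norm_sq_cross_centerCurve, Real.sqrt_sq (norm_nonneg _)]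

theorem twisting_centerCurve (ε t : ℝ) :
    twisting (centerCurve ε) t =
      √(speedSq ε t) * (2 * ε * (ζ₁ t + ζ₃ t)) / bendSq ε t := by
  rw [twisting, speed_centerCurve, norm_sq_cross_centerCurve, cross_centerCurve,
    deriv_deriv_deriv_centerCurve, inner_eq]
  congr 2
  simp only [Matrix.cons_val_zero, Matrix.cons_val_one, Matrix.cons_val]
  linear_combination 2 * ε * ζ₁ t * Real.sin_sq_add_cos_sq t

theorem contDiff_radius (ρ μ : ℝ) : ContDiff ℝ ∞ (radius ρ μ) :=
  contDiff_const.add (contDiff_const.mul contDiff_ellipseCurvatureDot)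

theorem radius_periodic (ρ μ : ℝ) : Function.Periodic (radius ρ μ) (2 * Real.pi) := fun t => by
  simp only [radius, ellipseCurvatureDot_periodic t]

theorem deriv_radius (ρ μ t : ℝ) : deriv (radius ρ μ) t = μ * ζ₁ t :=
  (((hasDerivAt_deriv contDiff_ellipseCurvatureDot t).const_mul μ).const_add ρ).deriv

theorem radius_lt_two_mul {ρ μ : ℝ} (hpos : ∀ t, 0 < radius ρ μ t) (t : ℝ) :
    radius ρ μ t < 2 * ρ := by
  have hneg := hpos (-t)
  rw [radius, ellipseCurvatureDot_neg] at hneg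
  rw [radius]
  linarith

theorem canalCos_centerCurve (ε ρ μ t : ℝ) :
    canalCos (centerCurve ε) (radius ρ μ) t = -(μ * ζ₁ t / √(speedSq ε t)) := by
  rw [canalCos, speed_centerCurve, deriv_radius]

theorem canalCos_div_canalSin (ε ρ μ t : ℝ) :
    canalCos (centerCurve ε) (radius ρ μ) t / canalSin (centerCurve ε) (radius ρ μ) t =
      -(μ * ζ₁ t) / √(speedSq ε t - μ ^ 2 * ζ₁ t ^ 2) := by
  have hpos := speedSq_pos ε t
  have hsin_sq : 1 - (-(μ * ζ₁ t / √(speedSq ε t))) ^ 2 =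
      (speedSq ε t - μ ^ 2 * ζ₁ t ^ 2) / speedSq ε t := by
    rw [neg_sq, div_pow, Real.sq_sqrt hpos.le]
    field_simp
  rw [canalSin, canalCos_centerCurve, hsin_sq, Real.sqrt_div' _ hpos.le, ← neg_div,
    div_div_div_cancel_right₀ (Real.sqrt_pos.2 hpos).ne']

theorem forcing_centerCurve (ε ρ μ t : ℝ) :
    forcing (centerCurve ε) (radius ρ μ) t =
      -(μ * (√(bendSq ε t) * ζ₁ t / (speedSq ε t * √(speedSq ε t - μ ^ 2 * ζ₁ t ^ 2)))) := by
  rw [forcing, bending_centerCurve, canalCos_div_canalSin, div_mul_div_comm]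
  ring

/-! ### First order averages along the ellipse -/

/-- The speed `σ` of the ellipse `(2 cos t, sin t, 0)`. -/
noncomputable def ellipseSpeed (t : ℝ) : ℝ := √(4 - 3 * Real.cos t ^ 2)

local notation "σ" => ellipseSpeed
local notation "κ" => ellipseCurvature

theorem ellipseSpeed_pos (t : ℝ) : 0 < σ t := Real.sqrt_pos.2 (ellipse_speed_sq_pos t)

theorem ellipseSpeed_sq (t : ℝ) : σ t ^ 2 = 4 - 3 * Real.cos t ^ 2 :=
  Real.sq_sqrt (ellipse_speed_sq_pos t).le

theorem continuous_ellipseSpeed : Continuous σ := by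
  unfold ellipseSpeed
  fun_prop

theorem ellipseSpeed_periodic : Function.Periodic σ (2 * Real.pi) := fun t => by
  simp only [ellipseSpeed, Real.cos_add_two_pi]

theorem hasDerivAt_ellipseSpeed (t : ℝ) :
    HasDerivAt σ (3 * Real.cos t * Real.sin t / σ t) t := by
  have hsq : HasDerivAt (fun t => 4 - 3 * Real.cos t ^ 2) (6 * Real.cos t * Real.sin t) t := by
    refine ((((Real.hasDerivAt_cos t).pow 2).const_mul 3).const_sub 4).congr_deriv ?_
    norm_num
    ring
  refine (hsq.sqrt (ellipse_speed_sq_pos t).ne').congr_deriv ?_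
  have hne := (ellipseSpeed_pos t).ne'
  rw [ellipseSpeed] at hne ⊢
  field_simp
  ring

theorem deriv_ellipseSpeed : deriv σ = fun t => 3 * Real.cos t * Real.sin t / σ t :=
  funext fun t => (hasDerivAt_ellipseSpeed t).deriv

theorem ellipseCurvature_eq (t : ℝ) : κ t = 2 / σ t ^ 3 := by
  have hpow := Real.rpow_mul_natCast (ellipse_speed_sq_pos t).le (1 / 2) 3
  rw [ellipseCurvature, ellipseSpeed, Real.sqrt_eq_rpow, ← hpow]
  norm_num

theorem hasDerivAt_deriv_ellipseSpeed (t : ℝ) : HasDerivAt (deriv σ) (2 * κ t - σ t) t := by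
  have hquot := ((((Real.hasDerivAt_cos t).const_mul 3).mul (Real.hasDerivAt_sin t)).div
    (hasDerivAt_ellipseSpeed t) (ellipseSpeed_pos t).ne')
  rw [deriv_ellipseSpeed]
  refine hquot.congr_deriv ?_
  have hpos := ellipseSpeed_pos t
  have hsq := ellipseSpeed_sq t
  have hfourth : σ t ^ 4 = (4 - 3 * Real.cos t ^ 2) ^ 2 := by rw [← hsq]; ring
  rw [ellipseCurvature_eq]
  simp only [Pi.mul_apply]
  field_simp
  linear_combination (3 * (Real.cos t ^ 2 - Real.sin t ^ 2)) * hsq + hfourth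
    - (9 * Real.cos t ^ 2 + 3 * (4 - 3 * Real.cos t ^ 2)) * Real.sin_sq t

theorem continuous_ellipseCurvature : Continuous κ :=
  continuous_iff_continuousAt.2 fun t => (hasDerivAt_ellipseCurvature t).continuousAt

theorem ellipseCurvature_periodic : Function.Periodic κ (2 * Real.pi) := fun t => by
  simp only [ellipseCurvature, Real.cos_add_two_pi]

theorem integral_eq_of_hasDerivAt_sub_periodic {f g F : ℝ → ℝ} {T : ℝ}
    (hF : ∀ t, HasDerivAt F (f t - g t) t) (hf : Continuous f) (hg : Continuous g)
    (hFp : Function.Periodic F T) : ∫ t in (0 : ℝ)..T, f t = ∫ t in (0 : ℝ)..T, g t := by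
  rw [← sub_eq_zero, ← intervalIntegral.integral_sub (hf.intervalIntegrable _ _)
    (hg.intervalIntegrable _ _), intervalIntegral.integral_eq_sub_of_hasDerivAt (fun t _ => hF t)
    ((hf.sub hg).intervalIntegrable _ _), hFp.eq, sub_self]

theorem integral_neg_ellipseCurvature_mul :
    ∫ t in (0 : ℝ)..(2 * Real.pi), -(κ t * ζ₁ t) = ∫ t in (0 : ℝ)..(2 * Real.pi), ζ t ^ 2 := by
  have hκ := continuous_ellipseCurvature
  have hζ := contDiff_ellipseCurvatureDot.continuous
  have hζ₁ := contDiff_deriv_ellipseCurvatureDot.continuous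
  refine integral_eq_of_hasDerivAt_sub_periodic (F := fun t => -(κ t * ζ t)) (fun t => ?_)
    (by fun_prop) (by fun_prop) fun t => ?_
  · refine ((hasDerivAt_ellipseCurvature t).mul
      (hasDerivAt_deriv contDiff_ellipseCurvatureDot t)).neg.congr_deriv ?_
    ring
  · simp only [ellipseCurvature_periodic t, ellipseCurvatureDot_periodic t]

/-- Two integrations by parts move the second derivative from `ζ₁` to the speed `σ`, where
`σ̈ + σ = 2κ`; a third one turns `-κ ζ₁` into `ζ²`. -/
theorem integral_neg_mul_ellipseSpeed :
    ∫ t in (0 : ℝ)..(2 * Real.pi), -((ζ₁ t + ζ₃ t) * σ t / 2) =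
      ∫ t in (0 : ℝ)..(2 * Real.pi), ζ t ^ 2 := by
  have hσ := continuous_ellipseSpeed
  have hζ := contDiff_ellipseCurvatureDot.continuous
  have hζ₁ := contDiff_deriv_ellipseCurvatureDot.continuous
  have hζ₃ := (contDiff_deriv contDiff_deriv_deriv_ellipseCurvatureDot).continuous
  refine integral_eq_of_hasDerivAt_sub_periodic
    (F := fun t => -((σ t * ζ₂ t - deriv σ t * ζ₁ t + 2 * κ t * ζ t) / 2)) (fun t => ?_)
    (by fun_prop) (by fun_prop) fun t => ?_
  · have hσ' : HasDerivAt σ (deriv σ t) t :=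
      (hasDerivAt_ellipseSpeed t).differentiableAt.hasDerivAt
    refine (((hσ'.mul (hasDerivAt_deriv contDiff_deriv_deriv_ellipseCurvatureDot t)).sub
      ((hasDerivAt_deriv_ellipseSpeed t).mul
        (hasDerivAt_deriv contDiff_deriv_ellipseCurvatureDot t))).add
      (((hasDerivAt_ellipseCurvature t).const_mul 2).mul
        (hasDerivAt_deriv contDiff_ellipseCurvatureDot t))).div_const 2 |>.neg.congr_deriv ?_
    ring
  · simp only [ellipseSpeed_periodic t, periodic_deriv ellipseSpeed_periodic t,
      ellipseCurvature_periodic t, ellipseCurvatureDot_periodic t,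
      deriv_ellipseCurvatureDot_periodic t, deriv_deriv_ellipseCurvatureDot_periodic t]

theorem integral_sq_ellipseCurvatureDot_pos :
    0 < ∫ t in (0 : ℝ)..(2 * Real.pi), ζ t ^ 2 := by
  have hζ := contDiff_ellipseCurvatureDot.continuous
  have hpi := Real.pi_pos
  have hne : ζ (Real.pi / 4) ≠ 0 := by
    have hcos : Real.cos (Real.pi / 4) ≠ 0 := by rw [Real.cos_pi_div_four]; positivity
    have hsin : Real.sin (Real.pi / 4) ≠ 0 := by rw [Real.sin_pi_div_four]; positivity
    exact div_ne_zero (mul_ne_zero (mul_ne_zero (by norm_num) hcos) hsin)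
      (Real.rpow_pos_of_pos (ellipse_speed_sq_pos _) _).ne'
  exact intervalIntegral.integral_pos (by positivity) (by fun_prop) (fun t _ => sq_nonneg _)
    ⟨Real.pi / 4, ⟨by positivity, by linarith⟩, by positivity⟩

/-! ### The equation of the principal lines in the family -/

/-- The coefficient of `1` in the equation of the principal lines, divided by `μ`, as a function
of `μ`, `η = ε / μ` and `t`. -/
noncomputable def constCoeff (q : (ℝ × ℝ) × ℝ) : ℝ :=
  q.1.2 * -(√(speedSq (q.1.2 * q.1.1) q.2) * (2 * (ζ₁ q.2 + ζ₃ q.2)) /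
    bendSq (q.1.2 * q.1.1) q.2)

/-- The coefficient of `sin φ` in the equation of the principal lines, divided by `μ`, as a
function of `μ`, `η = ε / μ` and `t`. A cutoff `χ μ` replaces `μ` in the denominator, in order
that the function be smooth for all values of the parameters. -/
noncomputable def sinCoeff (χ : ℝ → ℝ) (q : (ℝ × ℝ) × ℝ) : ℝ :=
  -(√(bendSq (q.1.2 * q.1.1) q.2) * ζ₁ q.2 / (speedSq (q.1.2 * q.1.1) q.2 *
    √(speedSq (q.1.2 * q.1.1) q.2 - χ q.1.1 ^ 2 * ζ₁ q.2 ^ 2)))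

theorem contDiff_comp_rescaled {f : ℝ → ℝ → ℝ} (hf : ContDiff ℝ ∞ fun p : ℝ × ℝ => f p.1 p.2) :
    ContDiff ℝ ∞ fun q : (ℝ × ℝ) × ℝ => f (q.1.2 * q.1.1) q.2 :=
  hf.comp (by fun_prop : ContDiff ℝ ∞ fun q : (ℝ × ℝ) × ℝ => (q.1.2 * q.1.1, q.2))

theorem contDiff_constCoeff : ContDiff ℝ ∞ constCoeff := by
  have hζ : ContDiff ℝ ∞ fun q : (ℝ × ℝ) × ℝ => ζ₁ q.2 + ζ₃ q.2 :=
    (contDiff_deriv_ellipseCurvatureDot.add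
      (contDiff_deriv contDiff_deriv_deriv_ellipseCurvatureDot)).comp contDiff_snd
  exact (contDiff_snd.comp contDiff_fst).mul
    ((((contDiff_comp_rescaled contDiff_speedSq).sqrt fun q => (speedSq_pos _ _).ne').mul
      (contDiff_const.mul hζ)).div (contDiff_comp_rescaled contDiff_bendSq)
        fun q => (bendSq_pos _ _).ne').neg

theorem contDiff_sinCoeff {χ : ℝ → ℝ} (hχ : ContDiff ℝ ∞ χ)
    (hpos : ∀ ε μ t, 0 < speedSq ε t - χ μ ^ 2 * ζ₁ t ^ 2) : ContDiff ℝ ∞ (sinCoeff χ) := by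
  have hζ₁ : ContDiff ℝ ∞ fun q : (ℝ × ℝ) × ℝ => ζ₁ q.2 :=
    contDiff_deriv_ellipseCurvatureDot.comp contDiff_snd
  have hχ₁ : ContDiff ℝ ∞ fun q : (ℝ × ℝ) × ℝ => χ q.1.1 :=
    hχ.comp (contDiff_fst.comp contDiff_fst)
  have hspeed := contDiff_comp_rescaled contDiff_speedSq
  have hsqrt := (hspeed.sub ((hχ₁.pow 2).mul (hζ₁.pow 2))).sqrt fun q => (hpos _ _ _).ne'
  exact ((((contDiff_comp_rescaled contDiff_bendSq).sqrt fun q => (bendSq_pos _ _).ne').mul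
    hζ₁).div (hspeed.mul hsqrt)
      fun q => (mul_pos (speedSq_pos _ _) (Real.sqrt_pos.2 (hpos _ _ _))).ne').neg

theorem constCoeff_periodic (p : ℝ × ℝ) :
    Function.Periodic (fun t => constCoeff (p, t)) (2 * Real.pi) := fun t => by
  simp only [constCoeff, speedSq_periodic _ t, bendSq_periodic _ t,
    deriv_ellipseCurvatureDot_periodic t, periodic_deriv deriv_deriv_ellipseCurvatureDot_periodic t]

theorem sinCoeff_periodic (χ : ℝ → ℝ) (p : ℝ × ℝ) :
    Function.Periodic (fun t => sinCoeff χ (p, t)) (2 * Real.pi) := fun t => by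
  simp only [sinCoeff, speedSq_periodic _ t, bendSq_periodic _ t,
    deriv_ellipseCurvatureDot_periodic t]

theorem speedSq_zero (t : ℝ) : speedSq 0 t = σ t ^ 2 := by
  rw [speedSq, ellipseSpeed_sq]
  ring

theorem bendSq_zero (t : ℝ) : bendSq 0 t = 2 ^ 2 := by
  rw [bendSq]
  ring

theorem integral_constCoeff_zero (η : ℝ) :
    ∫ t in (0 : ℝ)..(2 * Real.pi), constCoeff ((0, η), t) =
      η * ∫ t in (0 : ℝ)..(2 * Real.pi), ζ t ^ 2 := by
  rw [← integral_neg_mul_ellipseSpeed, ← intervalIntegral.integral_const_mul]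
  congr 1
  funext t
  rw [constCoeff, mul_zero, speedSq_zero, bendSq_zero, Real.sqrt_sq (ellipseSpeed_pos t).le]
  ring

theorem integral_sinCoeff_zero {χ : ℝ → ℝ} (hχ : χ 0 = 0) (η : ℝ) :
    ∫ t in (0 : ℝ)..(2 * Real.pi), sinCoeff χ ((0, η), t) =
      ∫ t in (0 : ℝ)..(2 * Real.pi), ζ t ^ 2 := by
  rw [← integral_neg_ellipseCurvature_mul]
  congr 1
  funext t
  have hpos := ellipseSpeed_pos t
  rw [sinCoeff, mul_zero, speedSq_zero, bendSq_zero, hχ, Real.sqrt_sq zero_le_two,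
    zero_pow two_ne_zero, zero_mul, sub_zero, Real.sqrt_sq hpos.le, ellipseCurvature_eq]
  field_simp

theorem neg_twisting_eq_constCoeff (μ η t : ℝ) :
    -twisting (centerCurve (η * μ)) t = μ * constCoeff ((μ, η), t) := by
  rw [twisting_centerCurve, constCoeff]
  ring

theorem forcing_eq_sinCoeff {χ : ℝ → ℝ} {μ : ℝ} (hχ : χ μ = μ) (ρ η t : ℝ) :
    forcing (centerCurve (η * μ)) (radius ρ μ) t = μ * sinCoeff χ ((μ, η), t) := by
  rw [forcing_centerCurve, sinCoeff, hχ, mul_neg]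

theorem exists_smooth_cutoff {r : ℝ} (hr : 0 < r) : ∃ χ : ℝ → ℝ, ContDiff ℝ ∞ χ ∧
    (∀ μ, |χ μ| ≤ 2 * r) ∧ ∀ μ, |μ| ≤ r → χ μ = μ := by
  let f : ContDiffBump (0 : ℝ) := ⟨r, 2 * r, hr, by linarith⟩
  refine ⟨fun μ => f μ * μ, f.contDiff.mul contDiff_id, fun μ => ?_, fun μ hμ => ?_⟩
  · rcases le_or_gt |μ| (2 * r) with hle | hgt
    · rw [abs_mul, abs_of_nonneg f.nonneg]
      exact (mul_le_of_le_one_left (abs_nonneg _) f.le_one).trans hle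
    · have hzero : f μ = 0 := f.zero_of_le_dist (by simpa using hgt.le)
      simp only [hzero, zero_mul, abs_zero]
      positivity
  · have hone : f μ = 1 := f.one_of_mem_closedBall (by simpa using hμ)
    simp only [hone, one_mul]

theorem exists_coefficients : ∃ (a b : (ℝ × ℝ) × ℝ → ℝ) (δ : ℝ), 0 < δ ∧
    ContDiff ℝ ∞ a ∧ ContDiff ℝ ∞ b ∧
    (∀ p, Function.Periodic (fun t => a (p, t)) (2 * Real.pi)) ∧
    (∀ p, Function.Periodic (fun t => b (p, t)) (2 * Real.pi)) ∧
    (∀ η, ∫ t in (0 : ℝ)..(2 * Real.pi), a ((0, η), t) =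
      η * ∫ t in (0 : ℝ)..(2 * Real.pi), ζ t ^ 2) ∧
    (∀ η, ∫ t in (0 : ℝ)..(2 * Real.pi), b ((0, η), t) =
      ∫ t in (0 : ℝ)..(2 * Real.pi), ζ t ^ 2) ∧
    ∀ μ, |μ| ≤ δ → ∀ ρ η t, -twisting (centerCurve (η * μ)) t = μ * a ((μ, η), t) ∧
      forcing (centerCurve (η * μ)) (radius ρ μ) t = μ * b ((μ, η), t) := by
  obtain ⟨M, hM, hζ₁⟩ := exists_pos_abs_deriv_ellipseCurvatureDot_le
  obtain ⟨χ, hχ, hχ_le, hχ_eq⟩ := exists_smooth_cutoff (r := 1 / (4 * M)) (by positivity)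
  have hpos : ∀ ε μ t, 0 < speedSq ε t - χ μ ^ 2 * ζ₁ t ^ 2 := by
    intro ε μ t
    have habs : |χ μ * ζ₁ t| ≤ 1 / 2 := by
      rw [abs_mul]
      calc |χ μ| * |ζ₁ t| ≤ (2 * (1 / (4 * M))) * M :=
            mul_le_mul (hχ_le μ) (hζ₁ t) (abs_nonneg _) (by positivity)
        _ = 1 / 2 := by field_simp; norm_num
    have hsq := sq_le_sq' (abs_le.1 habs).1 (abs_le.1 habs).2
    rw [mul_pow] at hsq
    linarith [one_le_speedSq ε t]
  exact ⟨constCoeff, sinCoeff χ, 1 / (4 * M), by positivity, contDiff_constCoeff,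
    contDiff_sinCoeff hχ hpos, constCoeff_periodic, sinCoeff_periodic χ,
    integral_constCoeff_zero, integral_sinCoeff_zero (hχ_eq 0 (by rw [abs_zero]; positivity)),
    fun μ hμ ρ η t => ⟨neg_twisting_eq_constCoeff μ η t, forcing_eq_sinCoeff (hχ_eq μ hμ) ρ η t⟩⟩

theorem exists_bifurcation_curves : ∃ (ε₁ ε₂ : ℝ → ℝ) (δ : ℝ), 0 < δ ∧
    ContDiffOn ℝ ∞ ε₁ (Ioo (-δ) δ) ∧ ContDiffOn ℝ ∞ ε₂ (Ioo (-δ) δ) ∧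
    (fun μ => ε₁ μ - (-μ)) =O[𝓝 0] (fun μ => μ ^ 2) ∧
    (fun μ => ε₂ μ - μ) =O[𝓝 0] (fun μ => μ ^ 2) ∧
    ∀ μ ∈ Ioo 0 δ, ε₁ μ < ε₂ μ ∧ Icc (ε₁ μ) (ε₂ μ) ⊆ Icc (-1) 1 ∧ ∀ ρ,
      (∀ ε ∈ Ioo (ε₁ μ) (ε₂ μ), ∃ φ, IsHyperbolicSolution
        (fun t => -twisting (centerCurve ε) t) (forcing (centerCurve ε) (radius ρ μ)) φ) ∧
      ∀ ε, ε = ε₁ μ ∨ ε = ε₂ μ → ∃ φ, IsDoubleSolution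
        (fun t => -twisting (centerCurve ε) t) (forcing (centerCurve ε) (radius ρ μ)) φ := by
  obtain ⟨a, b, δ₁, hδ₁, ha, hb, hap, hbp, ha0, hb0, hab⟩ := exists_coefficients
  obtain ⟨e₁, e₂, δ₂, hδ₂, he₁, he₂, he₁0, he₂0, hbif⟩ :=
    exists_bifurcation ha hb hap hbp integral_sq_ellipseCurvatureDot_pos ha0 hb0
  obtain ⟨δ, hδ, hδlt⟩ : ∃ δ, 0 < δ ∧ δ < min (min δ₁ δ₂) (1 / 2) := exists_between (by positivity)
  simp only [lt_min_iff] at hδlt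
  obtain ⟨⟨hδδ₁, hδδ₂⟩, hδhalf⟩ := hδlt
  have hsub : Ioo (-δ) δ ⊆ Ioo (-δ₂) δ₂ := Ioo_subset_Ioo (neg_le_neg hδδ₂.le) hδδ₂.le
  refine ⟨fun μ => -(μ * e₁ μ), fun μ => μ * e₂ μ, δ, hδ,
    (contDiffOn_id.mul (he₁.mono hsub)).neg, contDiffOn_id.mul (he₂.mono hsub),
    (isBigO_mul_sub_self hδ₂ he₁ he₁0).neg_left.congr_left fun μ => by ring,
    isBigO_mul_sub_self hδ₂ he₂ he₂0, fun μ hμ => ?_⟩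
  obtain ⟨hmem₁, hmem₂, hhyperbolic, hdouble⟩ := hbif μ ⟨hμ.1, hμ.2.trans hδδ₂⟩
  have hμ0 : 0 < μ := hμ.1
  have hprod₁ := mul_pos hμ0 hmem₁.1
  have hprod₂ := mul_pos hμ0 hmem₂.1
  refine ⟨by linarith, Icc_subset_Icc (by nlinarith [hmem₁.2, hμ.2]) (by nlinarith [hmem₂.2, hμ.2]),
    fun ρ => ?_⟩
  have hcoeff (ε : ℝ) : (fun t => -twisting (centerCurve ε) t) =
      (fun t => μ * a ((μ, ε / μ), t)) ∧
      forcing (centerCurve ε) (radius ρ μ) = fun t => μ * b ((μ, ε / μ), t) := by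
    have h := hab μ (by rw [abs_of_pos hμ0]; linarith [hμ.2]) ρ (ε / μ)
    rw [div_mul_cancel₀ _ hμ0.ne'] at h
    exact ⟨funext fun t => (h t).1, funext fun t => (h t).2⟩
  refine ⟨fun ε hε => ?_, fun ε hε => ?_⟩
  · rw [(hcoeff ε).1, (hcoeff ε).2]
    exact hhyperbolic (ε / μ) ⟨by rw [lt_div_iff₀ hμ0]; linarith [hε.1],
      by rw [div_lt_iff₀ hμ0]; linarith [hε.2]⟩
  · rw [(hcoeff ε).1, (hcoeff ε).2]
    refine hdouble (ε / μ) (hε.imp (fun h => ?_) fun h => ?_) <;> rw [h] <;> field_simp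

/-! ### Regularity for small parameters -/

theorem exists_abs_le_of_periodic_snd {X : Type*} [TopologicalSpace X] {K : Set X}
    (hK : IsCompact K) {g : X × ℝ → ℝ} (hg : Continuous g) {T : ℝ} (hT : 0 < T)
    (hgp : ∀ x, Function.Periodic (fun t => g (x, t)) T) :
    ∃ N, ∀ x ∈ K, ∀ t, |g (x, t)| ≤ N := by
  obtain ⟨N, hN⟩ := (hK.prod isCompact_Icc).exists_bound_of_continuousOn
    (s := K ×ˢ Icc 0 T) hg.continuousOn
  refine ⟨N, fun x hx t => ?_⟩
  obtain ⟨s, hs, hts⟩ := (hgp x).exists_mem_Ico₀ hT t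
  exact hts ▸ hN (x, s) ⟨hx, Ico_subset_Icc_self hs⟩

theorem exists_abs_deriv_le_of_periodic_snd {E : Type*} [NormedAddCommGroup E] [NormedSpace ℝ E]
    {K : Set E} (hK : IsCompact K) {g : E × ℝ → ℝ} (hg : ContDiff ℝ 1 g) {T : ℝ} (hT : 0 < T)
    (hgp : ∀ x, Function.Periodic (fun t => g (x, t)) T) :
    ∃ N, ∀ x ∈ K, ∀ t, |deriv (fun t => g (x, t)) t| ≤ N := by
  have hderiv : ∀ x t, deriv (fun t => g (x, t)) t = fderiv ℝ g (x, t) (0, 1) := fun x t =>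
    (hasDerivAt_slice (p := (x, t)) (hg.differentiable one_ne_zero _)).deriv
  simp only [hderiv]
  refine exists_abs_le_of_periodic_snd (g := fun p => fderiv ℝ g p (0, 1)) hK
    ((hg.continuous_fderiv one_ne_zero).clm_apply continuous_const) hT fun x => ?_
  exact funext (hderiv x) ▸ periodic_deriv (hgp x)

theorem exists_abs_deriv_canalCos_le : ∃ N, ∀ ε ∈ Icc (-1 : ℝ) 1, ∀ ρ, ∀ μ ∈ Icc (-1 : ℝ) 1,
    ∀ t, |deriv (canalCos (centerCurve ε) (radius ρ μ)) t| ≤ N := by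
  have hζ₁ := contDiff_deriv_ellipseCurvatureDot
  have hspeed : ContDiff ℝ ∞ fun q : (ℝ × ℝ) × ℝ => √(speedSq q.1.1 q.2) :=
    (contDiff_speedSq.comp (by fun_prop : ContDiff ℝ ∞ fun q : (ℝ × ℝ) × ℝ => (q.1.1, q.2))).sqrt
      fun q => (speedSq_pos _ _).ne'
  have hcos : ContDiff ℝ ∞ fun q : (ℝ × ℝ) × ℝ => -(q.1.2 * ζ₁ q.2 / √(speedSq q.1.1 q.2)) := by
    refine (ContDiff.div ?_ hspeed fun q => (Real.sqrt_pos.2 (speedSq_pos _ _)).ne').neg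
    fun_prop
  obtain ⟨N, hN⟩ := exists_abs_deriv_le_of_periodic_snd
    (isCompact_Icc.prod isCompact_Icc : IsCompact (Icc (-1 : ℝ) 1 ×ˢ Icc (-1 : ℝ) 1))
    (hcos.of_le (mod_cast le_top)) Real.two_pi_pos fun x t => by
      simp only [speedSq_periodic _ t, deriv_ellipseCurvatureDot_periodic t]
  refine ⟨N, fun ε hε ρ μ hμ t => ?_⟩
  rw [funext (canalCos_centerCurve ε ρ μ)]
  exact hN (ε, μ) ⟨hε, hμ⟩ t

theorem exists_abs_bending_le :
    ∃ N, ∀ ε ∈ Icc (-1 : ℝ) 1, ∀ t, |bending (centerCurve ε) t| ≤ N := by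
  simp only [bending_centerCurve]
  exact exists_abs_le_of_periodic_snd (g := fun p => √(bendSq p.1 p.2) / speedSq p.1 p.2)
    isCompact_Icc (contDiff_bendSq.continuous.sqrt.div contDiff_speedSq.continuous
      fun p => (speedSq_pos _ _).ne') Real.two_pi_pos fun ε t => by
        simp only [speedSq_periodic ε t, bendSq_periodic ε t]

theorem canalCos_centerCurve_sq_le {M μ : ℝ} (hM : 0 < M) (hζ₁ : ∀ t, |ζ₁ t| ≤ M)
    (hμ : |μ| ≤ 1 / (2 * M)) (ε ρ t : ℝ) :
    canalCos (centerCurve ε) (radius ρ μ) t ^ 2 ≤ 1 / 4 := by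
  have habs : |canalCos (centerCurve ε) (radius ρ μ) t| ≤ 1 / 2 := by
    rw [canalCos_centerCurve, abs_neg, abs_div, abs_of_nonneg (Real.sqrt_nonneg _), abs_mul]
    calc |μ| * |ζ₁ t| / √(speedSq ε t) ≤ |μ| * |ζ₁ t| :=
          div_le_self (by positivity) (Real.one_le_sqrt.2 (one_le_speedSq ε t))
      _ ≤ (1 / (2 * M)) * M := mul_le_mul hμ (hζ₁ t) (abs_nonneg _) (by positivity)
      _ = 1 / 2 := by field_simp
  exact (sq_le_sq' (abs_le.1 habs).1 (abs_le.1 habs).2).trans_eq (by norm_num)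

theorem normalTurning_le {c : ℝ → E3} {r : ℝ → ℝ} {N : ℝ} {p : ℝ × ℝ}
    (hsin : 1 / 2 ≤ canalSin c r p.1) (hcos : |deriv (canalCos c r) p.1| ≤ N)
    (hbend : |bending c p.1| ≤ N) : normalTurning c r p ≤ 3 * N := by
  have hturn : -deriv (canalCos c r) p.1 / canalSin c r p.1 ≤ 2 * N := by
    rw [div_le_iff₀ (by linarith)]
    nlinarith [neg_le_of_abs_le hcos, (abs_nonneg _).trans hcos]
  have hbend_cos : bending c p.1 * Real.cos p.2 ≤ N := by
    refine (le_abs_self _).trans ?_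
    rw [abs_mul]
    exact (mul_le_of_le_one_right (abs_nonneg _) (Real.abs_cos_le_one _)).trans hbend
  rw [normalTurning]
  linarith

theorem meridianSpeed_neg_of_lt {c : ℝ → E3} {r : ℝ → ℝ} {N : ℝ} {p : ℝ × ℝ}
    (hspeed : 1 ≤ speed c p.1) (hsin : 1 / 2 ≤ canalSin c r p.1) (hr : 0 < r p.1)
    (hrN : r p.1 * (3 * N) < 1 / 2) (hN : normalTurning c r p ≤ 3 * N) :
    meridianSpeed c r p < 0 := by
  have hmain : 1 / 2 ≤ speed c p.1 * canalSin c r p.1 := hsin.trans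
    (le_mul_of_one_le_left (by linarith) hspeed)
  have hturn := mul_le_mul_of_nonneg_left hN hr.le
  rw [meridianSpeed]
  linarith

theorem exists_isRegularCanal : ∃ ρ₀ μ₀ : ℝ, 0 < ρ₀ ∧ 0 < μ₀ ∧ ∀ ρ < ρ₀, ∀ μ, |μ| ≤ μ₀ →
    (∀ t, 0 < radius ρ μ t) → ∀ ε ∈ Icc (-1) 1,
      IsRegularCanal (centerCurve ε) (radius ρ μ) := by
  obtain ⟨M, hM, hζ₁⟩ := exists_pos_abs_deriv_ellipseCurvatureDot_le
  obtain ⟨N₁, hN₁⟩ := exists_abs_deriv_canalCos_le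
  obtain ⟨N₂, hN₂⟩ := exists_abs_bending_le
  let N := max (max N₁ N₂) 1
  have hN : 0 < N := by positivity
  refine ⟨1 / (12 * N), min 1 (1 / (2 * M)), by positivity, by positivity, ?_⟩
  intro ρ hρ μ hμ hr ε hε
  have hcos := canalCos_centerCurve_sq_le hM hζ₁ (hμ.trans (min_le_right _ _)) ε ρ
  refine ⟨contDiff_centerCurve ε, contDiff_radius ρ μ, cross_centerCurve_ne_zero ε,
    fun t => (hcos t).trans_lt (by norm_num), hr, fun p => ?_⟩
  have hsin : 1 / 2 ≤ canalSin (centerCurve ε) (radius ρ μ) p.1 :=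
    Real.le_sqrt_of_sq_le (by linarith [hcos p.1])
  have hrN : radius ρ μ p.1 * (3 * N) < 1 / 2 := calc
    _ < (2 * (1 / (12 * N))) * (3 * N) :=
      mul_lt_mul_of_pos_right (by linarith [radius_lt_two_mul hr p.1]) (by positivity)
    _ = 1 / 2 := by field_simp; norm_num
  refine meridianSpeed_neg_of_lt ?_ hsin (hr p.1) hrN (normalTurning_le hsin ?_ ?_)
  · exact speed_centerCurve ε p.1 ▸ Real.one_le_sqrt.2 (one_le_speedSq ε p.1)
  · exact (hN₁ ε hε ρ μ (abs_le.1 (hμ.trans (min_le_left _ _))) p.1).trans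
      ((le_max_left _ _).trans (le_max_left _ _))
  · exact (hN₂ ε hε p.1).trans ((le_max_right _ _).trans (le_max_left _ _))

end

end Canal

theorem mainTheorem3 :
    ∃ (ε₁ ε₂ : ℝ → ℝ) (ρ₀ μ₀ : ℝ), 0 < ρ₀ ∧ 0 < μ₀ ∧
      ContDiffOn ℝ ∞ ε₁ (Ioo (-μ₀) μ₀) ∧ ContDiffOn ℝ ∞ ε₂ (Ioo (-μ₀) μ₀) ∧
      (fun μ => ε₁ μ - (-μ)) =O[𝓝 0] (fun μ => μ ^ 2) ∧
      (fun μ => ε₂ μ - μ) =O[𝓝 0] (fun μ => μ ^ 2) ∧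
      ∀ ρ ∈ Ioo 0 ρ₀, ∀ μ ∈ Ioo 0 μ₀, (∀ t, 0 < Canal.radius ρ μ t) →
        ε₁ μ < ε₂ μ ∧
        (∀ ε ∈ Icc (ε₁ μ) (ε₂ μ), Canal.IsSmoothImmersion (Canal.surface ε ρ μ) ∧
          ∀ p, ¬ Canal.IsUmbilic (Canal.surface ε ρ μ) p) ∧
        (∀ ε ∈ Ioo (ε₁ μ) (ε₂ μ),
          {C | Canal.IsPrincipalCycle (Canal.surface ε ρ μ) C}.ncard = 2 ∧
          ∀ C, Canal.IsPrincipalCycle (Canal.surface ε ρ μ) C →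
            Canal.IsHyperbolicPrincipalCycle (Canal.surface ε ρ μ) C) ∧
        (∀ ε, ε = ε₁ μ ∨ ε = ε₂ μ →
          {C | Canal.IsPrincipalCycle (Canal.surface ε ρ μ) C}.ncard = 1 ∧
          ∀ C, Canal.IsPrincipalCycle (Canal.surface ε ρ μ) C →
            Canal.IsDoublePrincipalCycle (Canal.surface ε ρ μ) C) := by
  obtain ⟨ε₁, ε₂, δ, hδ, hε₁, hε₂, hε₁_O, hε₂_O, hbif⟩ := Canal.exists_bifurcation_curves
  obtain ⟨ρ₀, μ₁, hρ₀, hμ₁, hregular⟩ := Canal.exists_isRegularCanal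
  have hsub : Ioo (-min δ μ₁) (min δ μ₁) ⊆ Ioo (-δ) δ :=
    Ioo_subset_Ioo (neg_le_neg (min_le_left _ _)) (min_le_left _ _)
  refine ⟨ε₁, ε₂, ρ₀, min δ μ₁, hρ₀, lt_min hδ hμ₁, hε₁.mono hsub, hε₂.mono hsub, hε₁_O, hε₂_O,
    fun ρ hρ μ hμ hr => ?_⟩
  obtain ⟨hlt, hIcc, hcycles⟩ := hbif μ ⟨hμ.1, hμ.2.trans_le (min_le_left _ _)⟩
  obtain ⟨hhyperbolic, hdouble⟩ := hcycles ρ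
  have hcanal : ∀ ε ∈ Icc (ε₁ μ) (ε₂ μ),
      Canal.IsRegularCanal (Canal.centerCurve ε) (Canal.radius ρ μ) := fun ε hε =>
    hregular ρ hρ.2 μ ((abs_of_pos hμ.1).trans_le (hμ.2.le.trans (min_le_right _ _))) hr ε (hIcc hε)
  refine ⟨hlt, fun ε hε => ⟨(hcanal ε hε).isSmoothImmersion, (hcanal ε hε).not_isUmbilic⟩,
    fun ε hε => ?_, fun ε hε => ?_⟩
  · obtain ⟨φ, hφ⟩ := hhyperbolic ε hε
    exact (hcanal ε (Ioo_subset_Icc_self hε)).two_hyperbolic_cycles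
      (Canal.centerCurve_periodic ε) (Canal.radius_periodic ρ μ) hφ
  · obtain ⟨φ, hφ⟩ := hdouble ε hε
    have hmem : ε ∈ Icc (ε₁ μ) (ε₂ μ) := by
      rcases hε with rfl | rfl
      exacts [left_mem_Icc.2 hlt.le, right_mem_Icc.2 hlt.le]
    exact (hcanal ε hmem).one_double_cycle
      (Canal.centerCurve_periodic ε) (Canal.radius_periodic ρ μ) hφ
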